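/- **Ribbon graphs.** A ribbon graph is a tuple $\Gamma=(\mathfrak h,\sigma_0,\sigma_1,B)$ where $\mathfrak h$ is a finite set of half-edges, $\sigma_0,\sigma_1$ are permutations of $\mathfrak h$, $\sigma_1$ is a fixed-point free involution, no cycle of $\sigma_0$ has length $1$ or $2$, and $B\subset\mathfrak h$ satisfies, with $\sigma_2=\sigma_0^{-1}\sigma_1$: if $x\in B$, then $\sigma_2(x)\in B$ and $\sigma_1(x)\notin B$. The cycles of $\sigma_0$ are the vertices $v(\Gamma)$, those of $\sigma_1$ the edges $e(\Gamma)$, the cycles of $\sigma_2$ contained in $B$ the boundary components $b(\Gamma)$, and the other cycles of $\sigma_2$ the faces. An edge $\{x,\sigma_1x\}$ is a boundary edge if it meets $B$, and internal otherwise. $\Gamma$ may be open ($B\ne\emptyset$) or closed ($B=\emptyset$), and need not be connected; the empty graph is allowed. It is trivalent if all cycles of $\sigma_0$ have length $3$. An $N$-coloring $\bar\varphi$ assigns to each face a color in $\{1,\dots,N\}$. Isomorphisms and automorphisms of $(\Gamma,\bar\varphi)$ are bijections of half-edges compatible with $\sigma_0,\sigma_1,B,\bar\varphi$. For $\lambda_1,\dots,\lambda_N>0$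 put $\tilde\lambda_e=\lambda_i+\lambda_j$ if $e$ is internal with faces of colors $i,j$ on its two sides, and $\tilde\lambda_e=\lambda_i$ if $e$ is a boundary edge whose side that is not in the boundary lies on a face of color $i$. For $n\ge 0$ let $$G_n(\Lambda)=\sum_{(\Gamma,\bar\varphi)}\frac{2^{|e(\Gamma)|-|v(\Gamma)|}\,Q^{|b(\Gamma)|}}{|\mathrm{Aut}(\Gamma,\bar\varphi)|}\prod_{e\in e(\Gamma)}\frac1{\tilde\lambda_e},$$ the sum running over the isomorphism classes of all trivalent $N$-colored ribbon graphs with $n$ vertices. **Matrix model.** Let $N\ge 0$, $Q\in\mathbb C$, $\Lambda=\mathrm{diag}(\lambda_1,\dots,\lambda_N)$ with all $\lambda_i>0$, let $\mathcal H_N$ be the space of Hermitian $N\times N$ matrices with Lebesgue measure $dX$, and let $$\mathcal C_\Lambda=\int_{\mathcal H_N}e^{-\mathrm{Tr}\,X^2\Lambda/2}\,dX,\qquad \langle f\rangle_\Lambda=\mathcal C_\Lambda^{-1}\int_{\mathcal H_N}f(X)\,e^{-\mathrm{Tr}\,X^2\Lambda/2}\,dX .$$ The Kontsevich–Penner model is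 $$\tau_Q=\det(\Lambda)^Q\,\mathcal C_\Lambda^{-1}\int dX\,\exp\Bigl(-\mathrm{Tr}\bigl(\tfrac{X^3}{3!}+\tfrac{X^2\Lambda}{2}+Q\log(X+\Lambda)\bigr)\Bigr).$$ This integral diverges over all of $\mathcal H_N$ and is understood near its critical point $X=0$: for $0<\varepsilon<1$ let $\tau_Q^{(\varepsilon)}(\Lambda)$ be the same expression with the integral taken over $\{X\in\mathcal H_N:(\mathrm{Tr}\,X^2)^{1/2}\le\varepsilon\min_i\lambda_i\}$, where $X+\Lambda$ is positive definite. **Proposition.** The asymptotic expansion of $\tau_Q$ as $\Lambda\to(\infty,\dots,\infty)$ is $\tau_Q=\sum_{n\ge0}G_n(\Lambda)$, the sum over all trivalent $N$-colored ribbon graphs, open or closed, connected or not. Precisely: 1. For every $n$ there are only finitely many isomorphism classes of trivalent $N$-colored ribbon graphs with $n$ vertices, so $G_n$ is a finite sum. 2. As a formal expansion, the identity holds term by term: for all $\lambda_1,\dots,\lambda_N>0$ and $n\ge0$, let $P_n(X)$ be the coefficient of $s^n$ in $$\exp\Bigl(-s\,\frac{\mathrm{Tr}\,X^3}{3!}+\sum_{k\ge1}\frac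 Qk\,s^k\,\mathrm{Tr}\bigl((-\Lambda^{-1}X)^k\bigr)\Bigr);$$ then $P_n(X)e^{-\mathrm{Tr}X^2\Lambda/2}$ is integrable on $\mathcal H_N$ and $\langle P_n\rangle_\Lambda=G_n(\Lambda)$. 3. For every $0<\varepsilon<1$ the integral defining $\tau_Q^{(\varepsilon)}(\Lambda)$ converges absolutely for all $\lambda_1,\dots,\lambda_N>0$, and for every $M\ge0$, $$\tau_Q^{(\varepsilon)}(\Lambda)=\sum_{n<2M}G_n(\Lambda)+O\Bigl(\bigl(\max_i\lambda_i^{-1}\bigr)^{3M}\Bigr)\qquad\text{as }\lambda_1,\dots,\lambda_N\to\infty\text{ independently.}$$ -/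

import Mathlib

open Filter MeasureTheory

/-! ### Ribbon graphs with boundary -/

/-- A ribbon graph (with or without boundary, connected or not): a finite set `H` of half-edges
(equivalently, directed edges), a permutation `σ₀` whose cycles are the vertices, a fixed-point free
involution `σ₁` whose cycles are the edges, and a set `B` of boundary half-edges. The inequalities on
`Function.minimalPeriod σ₀` say that no cycle of `σ₀` has length `1` or `2`. -/
structure RibbonGraph where
  H : Type
  finite_H : Finite H
  σ₀ : Equiv.Perm H
  σ₁ : Equiv.Perm H
  B : Set H
  σ₁_involutive : ∀ x, σ₁ (σ₁ x) = x
  σ₁_ne : ∀ x, σ₁ x ≠ x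
  /-- `B` is stable under `σ₂ = σ₀⁻¹ ∘ σ₁`. -/
  σ₂_mem_B : ∀ x, x ∈ B → σ₀⁻¹ (σ₁ x) ∈ B
  σ₁_notMem_B : ∀ x, x ∈ B → σ₁ x ∉ B
  period_ne_one : ∀ x, Function.minimalPeriod σ₀ x ≠ 1
  period_ne_two : ∀ x, Function.minimalPeriod σ₀ x ≠ 2

namespace RibbonGraph

/-- The permutation `σ₂ = σ₀⁻¹ ∘ σ₁`. Its cycles are the faces and the boundary components. -/
def σ₂ (Γ : RibbonGraph) : Equiv.Perm Γ.H := Γ.σ₀⁻¹ * Γ.σ₁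

/-- The vertices are the cycles of `σ₀` (fixed points would count as cycles). -/
def Vertex (Γ : RibbonGraph) : Type := Quotient (Equiv.Perm.SameCycle.setoid Γ.σ₀)

/-- The edges are the cycles of `σ₁`. -/
def Edge (Γ : RibbonGraph) : Type := Quotient (Equiv.Perm.SameCycle.setoid Γ.σ₁)

/-- The boundary components are the cycles of `σ₂` (fixed points count as cycles of length one)
whose half-edges lie in `B`. -/
def Boundary (Γ : RibbonGraph) : Type :=
  {q : Quotient (Equiv.Perm.SameCycle.setoid Γ.σ₂) // ∀ x, Quotient.mk _ x = q → x ∈ Γ.B}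

/-- All vertices have degree three. -/
def IsTrivalent (Γ : RibbonGraph) : Prop := ∀ x, Function.minimalPeriod Γ.σ₀ x = 3

end RibbonGraph

/-- An `N`-colored ribbon graph: the faces carry colors in `Fin N`, i.e. there is a map to `Fin N`
from the set of half-edges outside `B` that is constant along the cycles of `σ₂`. -/
structure ColoredRibbonGraph (N : ℕ) extends RibbonGraph where
  color : {x : H // x ∉ B} → Fin N
  color_σ₂ : ∀ x y : {x : H // x ∉ B}, y.1 = toRibbonGraph.σ₂ x.1 → color y = color x

namespace ColoredRibbonGraph

variable {N : ℕ}

/-- An isomorphism of colored ribbon graphs: a bijection of the half-edges that is compatible with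
`σ₀`, `σ₁`, the boundary half-edges and the colors of the faces. -/
structure Iso (Γ Γ' : ColoredRibbonGraph N) where
  toEquiv : Γ.H ≃ Γ'.H
  map_σ₀ : ∀ x, toEquiv (Γ.σ₀ x) = Γ'.σ₀ (toEquiv x)
  map_σ₁ : ∀ x, toEquiv (Γ.σ₁ x) = Γ'.σ₁ (toEquiv x)
  map_B : ∀ x, toEquiv x ∈ Γ'.B ↔ x ∈ Γ.B
  map_color : ∀ (x : Γ.H) (hx : x ∉ Γ.B) (hx' : toEquiv x ∉ Γ'.B),
    Γ'.color ⟨toEquiv x, hx'⟩ = Γ.color ⟨x, hx⟩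

/-- Being isomorphic, as an equivalence relation. -/
instance isoSetoid (N : ℕ) : Setoid (ColoredRibbonGraph N) where
  r Γ Γ' := Nonempty (Iso Γ Γ')
  iseqv := by
    refine ⟨fun Γ => ⟨⟨Equiv.refl _, fun _ => rfl, fun _ => rfl, fun _ => Iff.rfl,
      fun _ _ _ => rfl⟩⟩, ?_, ?_⟩
    · rintro Γ Γ' ⟨f⟩
      refine ⟨⟨f.toEquiv.symm, fun x => ?_, fun x => ?_, fun x => ?_, fun x hx hx' => ?_⟩⟩
      · rw [Equiv.symm_apply_eq, f.map_σ₀, Equiv.apply_symm_apply]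
      · rw [Equiv.symm_apply_eq, f.map_σ₁, Equiv.apply_symm_apply]
      · rw [← f.map_B, Equiv.apply_symm_apply]
      · have h := f.map_color (f.toEquiv.symm x) hx' (by rwa [Equiv.apply_symm_apply])
        simp only [Equiv.apply_symm_apply] at h
        exact h.symm
    · rintro Γ Γ' Γ'' ⟨f⟩ ⟨g⟩
      refine ⟨⟨f.toEquiv.trans g.toEquiv, fun x => ?_, fun x => ?_, fun x => ?_,
        fun x hx hx' => ?_⟩⟩
      · simp [f.map_σ₀, g.map_σ₀]
      · simp [f.map_σ₁, g.map_σ₁]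
      · simp [f.map_B, g.map_B]
      · have h1 : f.toEquiv x ∉ Γ'.B := fun h => hx ((f.map_B x).1 h)
        exact (g.map_color _ h1 hx').trans (f.map_color x hx h1)

/-- Isomorphism classes of `N`-colored ribbon graphs. -/
abbrev IsoClass (N : ℕ) : Type 1 := Quotient (isoSetoid N)

open Classical in
/-- The number `λ̃` attached to the edge of the half-edge `x`: for a boundary edge it is `λ_c`, where
`c` is the color of the face on the side of the edge that is not in the boundary, and for an internal
edge it is the sum of the two numbers `λ_c` coming from the faces on its two sides. -/
noncomputable def edgeLambda (Γ : ColoredRibbonGraph N) (lam : Fin N → ℝ) (x : Γ.H) : ℝ :=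
  if hx : x ∈ Γ.B then lam (Γ.color ⟨Γ.σ₁ x, Γ.σ₁_notMem_B x hx⟩)
  else if hy : Γ.σ₁ x ∈ Γ.B then lam (Γ.color ⟨x, hx⟩)
  else lam (Γ.color ⟨x, hx⟩) + lam (Γ.color ⟨Γ.σ₁ x, hy⟩)

/-- The contribution
`2 ^ (|e| - |v|) * Q ^ |b| / |Aut| * ∏ₑ 1 / λ̃ₑ` of a colored ribbon graph. The value of `edgeLambda`
does not depend on which of its two half-edges (`e.out`) represents an edge. -/
noncomputable def weight (Q : ℂ) (lam : Fin N → ℝ) (Γ : ColoredRibbonGraph N) : ℂ :=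
  (2 : ℂ) ^ ((Nat.card Γ.Edge : ℤ) - (Nat.card Γ.Vertex : ℤ)) * Q ^ Nat.card Γ.Boundary
      / (Nat.card (Iso Γ Γ) : ℂ)
    * ∏ᶠ e : Γ.Edge, ((Γ.edgeLambda lam (Quotient.out e) : ℝ) : ℂ)⁻¹

/-- The isomorphism classes of trivalent `N`-colored ribbon graphs with `n` vertices. Both
conditions, and `weight`, are invariant under isomorphism, so the representative `q.out` is
immaterial. -/
def trivalentClasses (N n : ℕ) : Set (IsoClass N) :=
  {q | q.out.IsTrivalent ∧ Nat.card q.out.Vertex = n}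

/-- The part of the sum over trivalent `N`-colored ribbon graphs that comes from the graphs with
`n` vertices (hence with `3n/2` edges). -/
noncomputable def graphSum (Q : ℂ) (lam : Fin N → ℝ) (n : ℕ) : ℂ :=
  ∑ᶠ q ∈ trivalentClasses N n, weight Q lam q.out

end ColoredRibbonGraph

/-! ### The Kontsevich-Penner matrix model -/

namespace KontsevichPenner

variable {N : ℕ}

/-- The Hermitian matrix with diagonal entries `u (i, i)` and entries `u (i, j) + √-1 * u (j, i)`
above the diagonal. This identifies the space of Hermitian matrices with `Fin N × Fin N → ℝ`, and
Lebesgue measure there is `dX = ∏ᵢ dXᵢᵢ ∏_{i<j} d(Re Xᵢⱼ) d(Im Xᵢⱼ)`. -/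
def hermitian (u : Fin N × Fin N → ℝ) : Matrix (Fin N) (Fin N) ℂ :=
  Matrix.of fun i j =>
    if i = j then (u (i, i) : ℂ)
    else if i < j then (u (i, j) : ℂ) + (u (j, i) : ℂ) * Complex.I
    else (u (j, i) : ℂ) - (u (i, j) : ℂ) * Complex.I

/-- `Λ = diag(λ₁, …, λ_N)`. -/
def Lam (lam : Fin N → ℝ) : Matrix (Fin N) (Fin N) ℂ :=
  Matrix.diagonal fun i => (lam i : ℂ)

/-- `exp(- Tr(X² Λ / 2))`. -/
noncomputable def gaussian (lam : Fin N → ℝ) (X : Matrix (Fin N) (Fin N) ℂ) : ℂ :=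
  Complex.exp (-((1 / 2 : ℂ) • (X ^ 2 * Lam lam)).trace)

/-- The normalization constant `∫ exp(- Tr(X² Λ / 2)) dX` over the Hermitian matrices. -/
noncomputable def normalization (lam : Fin N → ℝ) : ℂ :=
  ∫ u : Fin N × Fin N → ℝ, gaussian lam (hermitian u)

/-- The Gaussian average `⟨f⟩_Λ` over the Hermitian matrices. -/
noncomputable def average (lam : Fin N → ℝ) (f : Matrix (Fin N) (Fin N) ℂ → ℂ) : ℂ :=
  (normalization lam)⁻¹ * ∫ u : Fin N × Fin N → ℝ, f (hermitian u) * gaussian lam (hermitian u)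

/-- The power series `- s Tr X³ / 3! + ∑_{k ≥ 1} (Q / k) sᵏ Tr((-Λ⁻¹ X)ᵏ)` in the grading variable
`s`. Under `Λ ↦ t Λ`, `X ↦ t^(-1/2) X`, which preserves the Gaussian weight, both `X³` and `Λ⁻¹ X`
are multiplied by `t^(-3/2)`, and `s` stands for this factor. -/
noncomputable def interaction (Q : ℂ) (lam : Fin N → ℝ) (X : Matrix (Fin N) (Fin N) ℂ) :
    PowerSeries ℂ :=
  PowerSeries.mk fun k =>
    (if k = 1 then -(X ^ 3).trace / (Nat.factorial 3 : ℂ) else 0)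
      + (if k = 0 then 0 else Q / (k : ℂ) * ((-((Lam lam)⁻¹ * X)) ^ k).trace)

/-- The coefficient of `sⁿ` in the exponential of `interaction`. Only the terms `r ≤ n` of
`∑ᵣ (interaction)ʳ / r!` contribute to it, because the constant coefficient of `interaction`
is zero. -/
noncomputable def expansionCoeff (Q : ℂ) (lam : Fin N → ℝ) (n : ℕ)
    (X : Matrix (Fin N) (Fin N) ℂ) : ℂ :=
  ∑ r ∈ Finset.range (n + 1),
    PowerSeries.coeff n (interaction Q lam X ^ r) / (Nat.factorial r : ℂ)

/-- The integrand `exp(- Tr(X³ / 3! + X² Λ / 2 + Q log(X + Λ)))`, with the logarithm of a matrix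
given by the functional calculus. It is used only where `X + Λ` is positive definite. -/
noncomputable def integrand (Q : ℂ) (lam : Fin N → ℝ) (X : Matrix (Fin N) (Fin N) ℂ) : ℂ :=
  Complex.exp (-((1 / (Nat.factorial 3 : ℂ)) • X ^ 3 + (1 / 2 : ℂ) • (X ^ 2 * Lam lam)
    + Q • cfc Real.log (X + Lam lam)).trace)

/-- The ball `(Tr X²)^(1/2) ≤ ε minᵢ λᵢ` in the space of Hermitian matrices. -/
def nearSaddle (ε : ℝ) (lam : Fin N → ℝ) : Set (Fin N × Fin N → ℝ) :=
  {u | ∀ i, (hermitian u ^ 2).trace.re ≤ (ε * lam i) ^ 2}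

/-- The Kontsevich-Penner model
`det(Λ)^Q C_Λ⁻¹ ∫ dX exp(- Tr(X³ / 3! + X² Λ / 2 + Q log(X + Λ)))`, with the integration restricted
to the ball `nearSaddle ε lam` around the critical point `X = 0` of `X³ / 3! + X² Λ / 2`. -/
noncomputable def tau (ε : ℝ) (Q : ℂ) (lam : Fin N → ℝ) : ℂ :=
  (Lam lam).det ^ Q * (normalization lam)⁻¹
    * ∫ u in nearSaddle ε lam, integrand Q lam (hermitian u)

end KontsevichPenner

/-! The formal identity is Wick's theorem read as a gluing of ribbon graphs; the asymptotic
statement is Laplace's method with bounds uniform in `Λ`.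

Expansion. With `Z = -Λ⁻¹X`, the determinant factor is `det(1 - sZ)^(-Q) = ∑ₘ sᵐ/m! ∑_π Q^(cycles of
π) ∏ tr Z^(cycle length)`, where `π` runs over the permutations of `m` points
(`expansionCoeff_eq_sum`, by comparing differential equations in `s`). Hence `Pₙ` is a sum over `m +
k = n` of terms consisting of a permutation of `m` points and `k` traces `Tr X³`. Writing out the
indices gives monomials in the entries of `X`, and `average_prod` turns their averages into sums
over perfect matchings. A cycle of `π` becomes a boundary component, a point of `π` a vertex on the
boundary, a factor `Tr X³` one of the other vertices, an index a face color, and a matched pair an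
internal edge. The covariance `2/(λᵢ + λⱼ)` is the weight of that edge together with its factor `2`.

Counting graphs. Stability of `B` under `σ₂` means `σ₁ B = σ₀ B`. In a trivalent graph a vertex
therefore contains at most one boundary half-edge `x`; then `σ₀ x` is opposite to some boundary
half-edge, and the third half-edge is free. So every trivalent graph has a standard form: a
permutation, the colors and a matching, which is the type `Gluing`. The half-edges of a graph with
`m` boundary vertices and `k` others have `m! k! 3ᵏ` labelings by the standard ones
(`card_labeling`). Each labeling is also a gluing together with an isomorphism from it to the graph
(`card_labeling_eq_sum`). Comparing the counts turns the sum over isomorphism classes with weights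
`1/|Aut|` into a sum over gluings with weights `1/(m! k! 3ᵏ)` (`graphSum_eq_sum`), which is what
Wick's theorem produces (`average_partCoeff`).

Asymptotics. Put `r = max 1/λᵢ` and `q = Tr X²Λ`. The parameter `size = r^(3/2) (1 + q)²` bounds the
interaction geometrically: its `k`th coefficient is `O(sizeᵏ)`, uniformly in `Λ` and `X`. Where
`size` is small, the truncated exponential is within `O(size^(2M))` of the integrand. Where it is
not small, which includes everything outside the ball, crude bounds suffice because `size` divided
by a constant is at least `1` (`exists_norm_sub_expansion_le`). Integrating `size^(2M)` against the
Gaussian gives `r^(3M)` with a constant depending only on `ε`, `N`, `Q` and `M`. -/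

namespace KontsevichPenner

/-! ### Gaussian integrals over `ι → ℝ` and Wick's theorem -/

section Gauss

variable {ι : Type*} [Fintype ι]

/-- The diagonal quadratic form with weights `w`. -/
def quadForm (w : ι → ℝ) (u : ι → ℝ) : ℝ := ∑ c, w c * u c ^ 2

theorem continuous_quadForm (w : ι → ℝ) : Continuous (quadForm w) := by
  unfold quadForm; fun_prop

theorem quadForm_nonneg {w : ι → ℝ} (hw : ∀ c, 0 < w c) (u : ι → ℝ) : 0 ≤ quadForm w u :=
  Finset.sum_nonneg fun c _ => mul_nonneg (hw c).le (sq_nonneg _)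

theorem exp_neg_mul_quadForm (w : ι → ℝ) (a : ℝ) (u : ι → ℝ) :
    Real.exp (-a * quadForm w u) = ∏ c, Real.exp (-(a * w c) * u c ^ 2) := by
  rw [← Real.exp_sum, quadForm, Finset.mul_sum]
  congr 1
  exact Finset.sum_congr rfl fun c _ => by ring

theorem integrable_exp_neg_mul_quadForm {w : ι → ℝ} (hw : ∀ c, 0 < w c) {a : ℝ} (ha : 0 < a) :
    Integrable fun u : ι → ℝ => Real.exp (-a * quadForm w u) := by
  simp_rw [exp_neg_mul_quadForm]
  exact Integrable.fintype_prod fun c => integrable_exp_neg_mul_sq (mul_pos ha (hw c))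

theorem integral_exp_neg_mul_quadForm (w : ι → ℝ) (a : ℝ) :
    ∫ u : ι → ℝ, Real.exp (-a * quadForm w u) = ∏ c, √(Real.pi / (a * w c)) := by
  simp_rw [exp_neg_mul_quadForm]
  rw [integral_fintype_prod_volume_eq_prod (fun c (x : ℝ) => Real.exp (-(a * w c) * x ^ 2))]
  exact Finset.prod_congr rfl fun c _ => integral_gaussian _

theorem integral_exp_neg_mul_quadForm_pos {w : ι → ℝ} (hw : ∀ c, 0 < w c) {a : ℝ} (ha : 0 < a) :
    0 < ∫ u : ι → ℝ, Real.exp (-a * quadForm w u) := by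
  rw [integral_exp_neg_mul_quadForm]
  exact Finset.prod_pos fun c _ => Real.sqrt_pos.2 (div_pos Real.pi_pos (mul_pos ha (hw c)))

/-- The ratio of the two integrals depends only on the dimension, not on `w`. This keeps the final
error constant independent of `Λ` after division by the normalization. -/
theorem integral_exp_neg_mul_quadForm_eq {w : ι → ℝ} (hw : ∀ c, 0 < w c) {a : ℝ} (ha : 0 < a) :
    ∫ u : ι → ℝ, Real.exp (-a * quadForm w u)
      = √(1 / (2 * a)) ^ Fintype.card ι * ∫ u : ι → ℝ, Real.exp (-(1 / 2) * quadForm w u) := by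
  rw [integral_exp_neg_mul_quadForm, integral_exp_neg_mul_quadForm, Fintype.card,
    ← Finset.prod_const, ← Finset.prod_mul_distrib]
  refine Finset.prod_congr rfl fun c _ => ?_
  rw [← Real.sqrt_mul (by positivity)]
  congr 1
  have := (hw c).ne'
  field_simp

/-- Powers are dominated by exponentials, uniformly. -/
theorem exists_one_add_pow_le_exp (k : ℕ) {δ : ℝ} (hδ : 0 < δ) :
    ∃ C : ℝ, 0 < C ∧ ∀ x : ℝ, 0 ≤ x → (1 + x) ^ k ≤ C * Real.exp (δ * x) := by
  refine ⟨(k.factorial : ℝ) / δ ^ k * Real.exp δ, by positivity, fun x hx => ?_⟩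
  have h := Real.pow_div_factorial_le_exp (δ * (1 + x)) (by positivity) k
  rw [div_le_iff₀ (by positivity), mul_pow] at h
  have h2 : Real.exp (δ * (1 + x)) = Real.exp δ * Real.exp (δ * x) := by
    rw [← Real.exp_add]; ring_nf
  rw [h2] at h
  rw [div_mul_eq_mul_div, div_mul_eq_mul_div, le_div_iff₀ (by positivity)]
  linarith

/-- Half of the Gaussian exponent absorbs the polynomial growth; the other half remains integrable.
-/
theorem integrable_mul_gauss {w : ι → ℝ} (hw : ∀ c, 0 < w c) {f : (ι → ℝ) → ℂ}
    (hf : Continuous f) {C : ℝ} {k : ℕ} (hC : ∀ u, ‖f u‖ ≤ C * (1 + quadForm w u) ^ k) :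
    Integrable fun u => f u * (Real.exp (-(1 / 2) * quadForm w u) : ℂ) := by
  obtain ⟨D, hD, hDk⟩ := exists_one_add_pow_le_exp k (show (0 : ℝ) < 1 / 4 by norm_num)
  have hC0 : 0 ≤ C := by
    have h := (norm_nonneg _).trans (hC 0)
    simpa [quadForm] using h
  refine Integrable.mono' ((integrable_exp_neg_mul_quadForm hw
    (show (0 : ℝ) < 1 / 4 by norm_num)).const_mul (C * D)) ?_ (ae_of_all _ fun u => ?_)
  · have := continuous_quadForm w
    exact Continuous.aestronglyMeasurable (by fun_prop)
  · rw [norm_mul, Complex.norm_real, Real.norm_eq_abs, abs_of_pos (Real.exp_pos _)]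
    have h1 := hDk _ (quadForm_nonneg hw u)
    calc ‖f u‖ * Real.exp (-(1 / 2) * quadForm w u)
        ≤ C * (D * Real.exp (1 / 4 * quadForm w u)) * Real.exp (-(1 / 2) * quadForm w u) := by
          gcongr
          exact (hC u).trans (by gcongr)
      _ = C * D * (Real.exp (1 / 4 * quadForm w u) * Real.exp (-(1 / 2) * quadForm w u)) := by ring
      _ = _ := by rw [← Real.exp_add]; ring_nf

/-- The complex linear form with coefficients `a`. -/
def linForm (a : ι → ℂ) (u : ι → ℝ) : ℂ := ∑ c, a c * (u c : ℂ)

theorem continuous_linForm (a : ι → ℂ) : Continuous (linForm a) := by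
  unfold linForm; fun_prop

theorem abs_apply_le {w : ι → ℝ} (hw : ∀ c, 0 < w c) (u : ι → ℝ) (c : ι) :
    |u c| ≤ (1 / w c + 1) * (1 + quadForm w u) := by
  have h1 : w c * u c ^ 2 ≤ quadForm w u :=
    Finset.single_le_sum (f := fun c => w c * u c ^ 2)
      (fun c _ => mul_nonneg (hw c).le (sq_nonneg _)) (Finset.mem_univ c)
  have h2 : u c ^ 2 ≤ 1 / w c * quadForm w u := by
    rw [div_mul_eq_mul_div, one_mul, le_div_iff₀ (hw c)]; linarith
  have h3 : |u c| ≤ 1 + u c ^ 2 := by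
    rw [← sq_abs]; nlinarith [sq_nonneg (|u c| - 1), abs_nonneg (u c)]
  have h4 : 0 < 1 / w c := one_div_pos.2 (hw c)
  nlinarith [quadForm_nonneg hw u]

theorem exists_norm_linForm_le {w : ι → ℝ} (hw : ∀ c, 0 < w c) (a : ι → ℂ) :
    ∃ C : ℝ, 0 ≤ C ∧ ∀ u, ‖linForm a u‖ ≤ C * (1 + quadForm w u) := by
  refine ⟨∑ c, ‖a c‖ * (1 / w c + 1), Finset.sum_nonneg fun c _ => mul_nonneg (norm_nonneg _)
    (by have := hw c; positivity), fun u => ?_⟩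
  rw [Finset.sum_mul]
  refine (norm_sum_le _ _).trans (Finset.sum_le_sum fun c _ => ?_)
  rw [norm_mul, Complex.norm_real, Real.norm_eq_abs, mul_assoc]
  exact mul_le_mul_of_nonneg_left (abs_apply_le hw u c) (norm_nonneg _)

variable {L : Type*}

theorem integrable_prod_linForm_mul_gauss {w : ι → ℝ} (hw : ∀ c, 0 < w c) (a : L → ι → ℂ)
    (s : Finset L) :
    Integrable fun u => (∏ h ∈ s, linForm (a h) u) * (Real.exp (-(1 / 2) * quadForm w u) : ℂ) := by
  choose C hC0 hC using fun h => exists_norm_linForm_le hw (a h)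
  refine integrable_mul_gauss hw (C := ∏ h ∈ s, C h) (k := s.card)
    (continuous_finsetProd _ fun h _ => continuous_linForm _) fun u => ?_
  rw [norm_prod, ← Finset.prod_const, ← Finset.prod_mul_distrib]
  exact Finset.prod_le_prod (fun h _ => norm_nonneg _) fun h _ => hC h u

theorem hasDerivAt_linForm [DecidableEq ι] (a : ι → ℂ) (u : ι → ℝ) (c : ι) :
    HasLineDerivAt ℝ (linForm a) (a c) u (Pi.single c 1) := by
  unfold HasLineDerivAt
  have : (fun t : ℝ => linForm a (u + t • Pi.single c 1)) = fun t : ℝ => linForm a u + a c * t := by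
    funext t
    simp only [linForm, Pi.add_apply, Pi.smul_apply, smul_eq_mul, Complex.ofReal_add,
      mul_add, Finset.sum_add_distrib]
    congr 1
    rw [Finset.sum_eq_single c]
    · simp
    · intro b _ hb; simp [Pi.single_eq_of_ne hb]
    · simp
  rw [this]
  simpa using ((Complex.ofRealCLM.hasDerivAt (x := (0 : ℝ))).const_mul (a c)).const_add (linForm a u)

theorem hasLineDerivAt_gauss [DecidableEq ι] (w : ι → ℝ) (u : ι → ℝ) (c : ι) :
    HasLineDerivAt ℝ (fun u => (Real.exp (-(1 / 2) * quadForm w u) : ℂ))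
      (-(w c * u c : ℂ) * (Real.exp (-(1 / 2) * quadForm w u) : ℂ)) u (Pi.single c 1) := by
  unfold HasLineDerivAt
  have : (fun t : ℝ => (Real.exp (-(1 / 2) * quadForm w (u + t • Pi.single c 1)) : ℂ))
      = fun t : ℝ => ((Real.exp (-(1 / 2) * (quadForm w u + w c * ((u c + t) ^ 2 - u c ^ 2)))
        : ℝ) : ℂ) := by
    funext t
    have : quadForm w (u + t • Pi.single c 1)
        = quadForm w u + w c * ((u c + t) ^ 2 - u c ^ 2) := by
      rw [← sub_eq_iff_eq_add']
      simp only [quadForm, ← Finset.sum_sub_distrib]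
      rw [Finset.sum_eq_single c]
      · simp; ring
      · intro b _ hb; simp [Pi.single_eq_of_ne hb]
      · simp
    rw [this]
  rw [this]
  have h1 : HasDerivAt (fun t : ℝ => -(1 / 2) * (quadForm w u + w c * ((u c + t) ^ 2 - u c ^ 2)))
      (-(w c * u c)) 0 := by
    have h := (((((hasDerivAt_id (0 : ℝ)).const_add (u c)).pow 2).sub_const (u c ^ 2)).const_mul
      (w c)).const_add (quadForm w u) |>.const_mul (-(1 / 2 : ℝ))
    refine HasDerivAt.congr_deriv h ?_
    simp; ring
  have h2 := h1.exp.ofReal_comp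
  refine HasDerivAt.congr_deriv h2 ?_
  push_cast
  simp
  ring

/-- Gaussian integration by parts. -/
theorem integral_linForm_mul_prod [DecidableEq ι] [DecidableEq L] {w : ι → ℝ} (hw : ∀ c, 0 < w c)
    (b : ι → ℂ) (a : L → ι → ℂ) (s : Finset L) :
    ∫ u, (linForm b u * ∏ h ∈ s, linForm (a h) u) * (Real.exp (-(1 / 2) * quadForm w u) : ℂ)
      = ∑ h ∈ s, (∑ c, b c * a h c / w c) *
        ∫ u, (∏ h' ∈ s.erase h, linForm (a h') u)
          * (Real.exp (-(1 / 2) * quadForm w u) : ℂ) := by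
  set g : (ι → ℝ) → ℂ := fun u => (Real.exp (-(1 / 2) * quadForm w u) : ℂ) with hg
  have hint : ∀ s : Finset L, Integrable fun u => (∏ h ∈ s, linForm (a h) u) * g u :=
    fun s => integrable_prod_linForm_mul_gauss hw a s
  have hint' : ∀ c : ι, Integrable fun u : ι → ℝ => ((u c : ℂ) * ∏ h ∈ s, linForm (a h) u) * g u := by
    intro c
    -- The extra factor `u c` is treated as one more linear form, indexed by `none`.
    have := integrable_prod_linForm_mul_gauss hw
      (fun o : Option L => o.elim (Pi.single c 1) a) s.insertNone
    refine this.congr (ae_of_all _ fun u => ?_)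
    have h1 : linForm (Pi.single c 1) u = (u c : ℂ) := by
      rw [linForm, Finset.sum_eq_single c] <;> simp +contextual
    simp [Finset.insertNone, h1, hg]
  -- Since `u c * g` is `-1 / w c` times the derivative of `g` along coordinate `c`, integration by
  -- parts moves this derivative onto the product.
  have key : ∀ c : ι, ∫ u, ((u c : ℂ) * ∏ h ∈ s, linForm (a h) u) * g u
      = ∑ h ∈ s, (a h c / w c) * ∫ u, (∏ h' ∈ s.erase h, linForm (a h') u) * g u := by
    intro c
    have hwc : (w c : ℂ) ≠ 0 := by exact_mod_cast (hw c).ne'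
    have hd : ∀ u, HasLineDerivAt ℝ (fun u => ∏ h ∈ s, linForm (a h) u)
        (∑ h ∈ s, (∏ h' ∈ s.erase h, linForm (a h') u) • a h c) u (Pi.single c 1) := by
      intro u
      have := HasDerivAt.fun_finsetProd (u := s) (x := (0 : ℝ))
        (f := fun h (t : ℝ) => linForm (a h) (u + t • Pi.single c 1))
        (f' := fun h => a h c) (fun h _ => hasDerivAt_linForm (a h) u c)
      simpa [HasLineDerivAt] using this
    have hib := integral_bilinear_hasLineDerivAt_right_eq_neg_left_of_integrable
      (μ := (volume : Measure (ι → ℝ))) (B := ContinuousLinearMap.mul ℝ ℂ)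
      (f := fun u => ∏ h ∈ s, linForm (a h) u)
      (f' := fun u => ∑ h ∈ s, (∏ h' ∈ s.erase h, linForm (a h') u) • a h c)
      (g := g) (g' := fun u => -(w c * u c : ℂ) * g u) (v := Pi.single c 1) ?_ ?_ ?_
      (fun u _ => hd u) (fun u _ => hasLineDerivAt_gauss w u c)
    · simp only [ContinuousLinearMap.mul_apply'] at hib
      have e1 : (fun u : ι → ℝ => (∏ h ∈ s, linForm (a h) u) * (-(w c * u c : ℂ) * g u))
          = fun u => -(w c : ℂ) * (((u c : ℂ) * ∏ h ∈ s, linForm (a h) u) * g u) := by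
        funext u; ring
      have e2 : (fun u : ι → ℝ => (∑ h ∈ s, (∏ h' ∈ s.erase h, linForm (a h') u) • a h c) * g u)
          = fun u => ∑ h ∈ s, a h c * ((∏ h' ∈ s.erase h, linForm (a h') u) * g u) := by
        funext u
        rw [Finset.sum_mul]
        exact Finset.sum_congr rfl fun h _ => by rw [smul_eq_mul]; ring
      rw [e1, e2, integral_const_mul, integral_finsetSum _ fun h _ => (hint _).const_mul _] at hib
      simp_rw [integral_const_mul] at hib
      have hib' : (w c : ℂ) * ∫ u, ((u c : ℂ) * ∏ h ∈ s, linForm (a h) u) * g u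
          = ∑ h ∈ s, a h c * ∫ u, (∏ h' ∈ s.erase h, linForm (a h') u) * g u := by
        linear_combination -hib
      rw [← mul_right_inj' hwc, hib', Finset.mul_sum]
      exact Finset.sum_congr rfl fun h _ => by field_simp
    · simp only [ContinuousLinearMap.mul_apply', Finset.sum_mul]
      refine integrable_finsetSum _ fun h _ => ((hint (s.erase h)).const_mul (a h c)).congr
        (ae_of_all _ fun u => ?_)
      simp only [smul_eq_mul]; ring
    · simp only [ContinuousLinearMap.mul_apply']
      refine ((hint' c).const_mul (-(w c : ℂ))).congr (ae_of_all _ fun u => ?_)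
      ring
    · simpa only [ContinuousLinearMap.mul_apply'] using hint s
  have e3 : (fun u => (linForm b u * ∏ h ∈ s, linForm (a h) u) * g u)
      = fun u => ∑ c, b c * (((u c : ℂ) * ∏ h ∈ s, linForm (a h) u) * g u) := by
    funext u
    rw [linForm, Finset.sum_mul, Finset.sum_mul]
    exact Finset.sum_congr rfl fun c _ => by ring
  rw [e3, integral_finsetSum _ fun c _ => (hint' c).const_mul _]
  simp_rw [integral_const_mul, key, Finset.mul_sum, Finset.sum_mul]
  rw [Finset.sum_comm]
  refine Finset.sum_congr rfl fun h _ => Finset.sum_congr rfl fun c _ => by ring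

/-! ### Perfect matchings and Wick's theorem. -/

open Classical in
/-- The involutions of `L` with support `s`, i.e. the perfect matchings of `s`. -/
noncomputable def matchings [Fintype L] (s : Finset L) : Finset (Equiv.Perm L) :=
  {τ | (∀ x, τ (τ x) = x) ∧ ∀ x, τ x ≠ x ↔ x ∈ s}

theorem mem_matchings [Fintype L] {s : Finset L} {τ : Equiv.Perm L} :
    τ ∈ matchings s ↔ (∀ x, τ (τ x) = x) ∧ ∀ x, τ x ≠ x ↔ x ∈ s := by
  simp [matchings]

/-- Multiplying by the transposition of a matched pair turns the pair into fixed points and changes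
nothing else. The same multiplication undoes this in `swap_mul_mem_matchings`; together they give
the bijection behind `sum_matchings_eq`. -/
theorem swap_mul_mem_matchings_erase [Fintype L] [DecidableEq L] {s : Finset L} {h h' : L}
    {τ : Equiv.Perm L} (hτ : τ ∈ matchings s) (hh : τ h = h') :
    Equiv.swap h h' * τ ∈ matchings ((s.erase h).erase h') := by
  rw [mem_matchings] at hτ ⊢
  obtain ⟨h1, h2⟩ := hτ
  have hh' : τ h' = h := by rw [← hh, h1]
  have hv : ∀ x, x ≠ h → x ≠ h' → (Equiv.swap h h' * τ) x = τ x := fun x hx hx' => by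
    rw [Equiv.Perm.mul_apply, Equiv.swap_apply_of_ne_of_ne]
    · rintro h3; exact hx' (by rw [← hh, ← h3, h1])
    · rintro h3; exact hx (τ.injective (h3.trans hh.symm))
  have hv1 : (Equiv.swap h h' * τ) h = h := by simp [hh]
  have hv2 : (Equiv.swap h h' * τ) h' = h' := by simp [hh']
  refine ⟨fun x => ?_, fun x => ?_⟩
  · by_cases hx : x = h
    · rw [hx, hv1, hv1]
    by_cases hx' : x = h'
    · rw [hx', hv2, hv2]
    rw [hv x hx hx', hv, h1]
    · rintro h3; exact hx' (by rw [← hh, ← h3, h1])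
    · rintro h3; exact hx (τ.injective (h3.trans hh.symm))
  · by_cases hx : x = h
    · subst hx; simp [hh]
    by_cases hx' : x = h'
    · subst hx'; simp [hh']
    rw [hv x hx hx', h2]
    simp [hx, hx']

theorem swap_mul_mem_matchings [Fintype L] [DecidableEq L] {s : Finset L} {h h' : L}
    (hne : h ≠ h') (hs : h ∈ s) (hs' : h' ∈ s)
    {τ : Equiv.Perm L} (hτ : τ ∈ matchings ((s.erase h).erase h')) :
    Equiv.swap h h' * τ ∈ matchings s ∧ (Equiv.swap h h' * τ) h = h' := by
  rw [mem_matchings] at hτ ⊢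
  obtain ⟨h1, h2⟩ := hτ
  have t1 : τ h = h := by by_contra h3; simpa using (h2 h).1 h3
  have t2 : τ h' = h' := by by_contra h3; simpa using (h2 h').1 h3
  have hv : ∀ x, x ≠ h → x ≠ h' → (Equiv.swap h h' * τ) x = τ x := fun x hx hx' => by
    rw [Equiv.Perm.mul_apply, Equiv.swap_apply_of_ne_of_ne]
    · rintro h3; exact hx (τ.injective (h3.trans t1.symm))
    · rintro h3; exact hx' (τ.injective (h3.trans t2.symm))
  have hv1 : (Equiv.swap h h' * τ) h = h' := by simp [t1]
  have hv2 : (Equiv.swap h h' * τ) h' = h := by simp [t2]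
  refine ⟨⟨fun x => ?_, fun x => ?_⟩, hv1⟩
  · by_cases hx : x = h
    · rw [hx, hv1, hv2]
    by_cases hx' : x = h'
    · rw [hx', hv2, hv1]
    rw [hv x hx hx', hv, h1]
    · rintro h3; exact hx (τ.injective (h3.trans t1.symm))
    · rintro h3; exact hx' (τ.injective (h3.trans t2.symm))
  · by_cases hx : x = h
    · subst hx; simp [hv1, hs, hne.symm]
    by_cases hx' : x = h'
    · subst hx'; simp [hv2, hs', hne]
    rw [hv x hx hx', h2]
    simp [hx, hx']

/-- Matchings are sorted by the partner `h'` of `h`. The recursion is the one that integration by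
parts gives for Gaussian moments. -/
theorem sum_matchings_eq [Fintype L] [DecidableEq L] (S : L → L → ℂ) {s : Finset L} {h : L}
    (hs : h ∈ s) :
    ∑ τ ∈ matchings s, ∏ x ∈ s, S x (τ x) = ∑ h' ∈ s.erase h, S h h' * S h' h *
      ∑ τ ∈ matchings ((s.erase h).erase h'), ∏ x ∈ (s.erase h).erase h', S x (τ x) := by
  have hmem : ∀ τ ∈ matchings s, τ h ∈ s.erase h := fun τ hτ => by
    rw [mem_matchings] at hτ
    have h3 : τ h ≠ h := (hτ.2 h).2 hs
    refine Finset.mem_erase.2 ⟨h3, (hτ.2 _).1 ?_⟩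
    rw [hτ.1]; exact h3.symm
  rw [← Finset.sum_fiberwise_of_maps_to hmem]
  refine Finset.sum_congr rfl fun h' hh' => ?_
  obtain ⟨hne, hs'⟩ := Finset.mem_erase.1 hh'
  rw [Finset.mul_sum]
  refine Finset.sum_bij' (fun τ _ => Equiv.swap h h' * τ) (fun τ _ => Equiv.swap h h' * τ)
    (fun τ hτ => ?_) (fun τ hτ => ?_) (fun τ _ => by simp [← mul_assoc])
    (fun τ _ => by simp [← mul_assoc]) (fun τ hτ => ?_)
  · obtain ⟨h1, h2⟩ := Finset.mem_filter.1 hτ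
    exact swap_mul_mem_matchings_erase h1 h2
  · exact Finset.mem_filter.2 (swap_mul_mem_matchings hne.symm hs hs' hτ)
  · obtain ⟨h1, h2⟩ := Finset.mem_filter.1 hτ
    have h3 := (mem_matchings.1 h1).1
    rw [← Finset.mul_prod_erase s _ hs, ← Finset.mul_prod_erase (s.erase h) _ hh', h2, ← h2, h3, h2,
      mul_assoc]
    congr 2
    refine Finset.prod_congr rfl fun x hx => ?_
    have hx1 := Finset.ne_of_mem_erase hx
    have hx2 := Finset.ne_of_mem_erase (Finset.mem_of_mem_erase hx)
    rw [Equiv.Perm.mul_apply, Equiv.swap_apply_of_ne_of_ne]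
    · rintro h4; exact hx1 (by rw [← h2, ← h4, h3])
    · rintro h4; exact hx2 (τ.injective (h4.trans h2.symm))

/-- **Wick's theorem** for products of linear forms under a diagonal Gaussian. The covariance of two
forms is split as `S h h' * S h' h`, so that a matching contributes a product over half-edges. -/
theorem wick [DecidableEq ι] [Fintype L] [DecidableEq L] {w : ι → ℝ} (hw : ∀ c, 0 < w c)
    (a : L → ι → ℂ) (S : L → L → ℂ) (hS : ∀ h h', S h h' * S h' h = ∑ c, a h c * a h' c / w c)
    (s : Finset L) :
    ∫ u, (∏ h ∈ s, linForm (a h) u) * (Real.exp (-(1 / 2) * quadForm w u) : ℂ)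
      = (∑ τ ∈ matchings s, ∏ h ∈ s, S h (τ h))
        * ∫ u, (Real.exp (-(1 / 2) * quadForm w u) : ℂ) := by
  induction s using Finset.strongInduction with
  | H s ih =>
    -- The empty set has exactly one matching, the identity permutation; for nonempty `s` both sides
    -- obey the same recursion.
    rcases s.eq_empty_or_nonempty with rfl | ⟨h, hs⟩
    · have : matchings (∅ : Finset L) = {1} := by
        ext τ
        simp only [mem_matchings, Finset.notMem_empty, iff_false, not_not, Finset.mem_singleton]
        constructor
        · rintro ⟨_, h⟩; ext x; simp [h]
        · rintro rfl; simp
      simp [this]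
    · rw [sum_matchings_eq S hs, Finset.sum_mul]
      simp_rw [← Finset.mul_prod_erase s _ hs]
      rw [integral_linForm_mul_prod hw]
      refine Finset.sum_congr rfl fun h' hh' => ?_
      rw [ih _ ((Finset.erase_subset _ _).trans_ssubset (Finset.erase_ssubset hs)), hS, mul_assoc]

end Gauss

end KontsevichPenner

namespace KontsevichPenner

/-! ### The Gaussian measure on Hermitian matrices -/

section Hermitian

variable {N : ℕ}

/-- The weights of the quadratic form `Tr X² Λ` in the coordinates of `hermitian`. -/
def coordWeight (lam : Fin N → ℝ) (c : Fin N × Fin N) : ℝ :=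
  if c.1 = c.2 then lam c.1 else lam c.1 + lam c.2

theorem coordWeight_pos {lam : Fin N → ℝ} (h : ∀ i, 0 < lam i) (c : Fin N × Fin N) :
    0 < coordWeight lam c := by
  unfold coordWeight
  split_ifs
  · exact h _
  · exact add_pos (h _) (h _)

/-- The coefficients of the entries of `hermitian u` as linear forms in `u`. -/
noncomputable def entryCoeff (p : Fin N × Fin N) (c : Fin N × Fin N) : ℂ :=
  if p.1 = p.2 then (if c = p then 1 else 0)
  else if p.1 < p.2 then (if c = p then 1 else 0) + (if c = p.swap then Complex.I else 0)
  else (if c = p.swap then 1 else 0) - (if c = p then Complex.I else 0)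

theorem hermitian_apply_eq (u : Fin N × Fin N → ℝ) (i j : Fin N) :
    hermitian u i j = linForm (entryCoeff (i, j)) u := by
  unfold hermitian linForm entryCoeff
  simp only [Matrix.of_apply]
  split_ifs with h1 h2
  · subst h1; simp
  · simp [add_mul, Finset.sum_add_distrib, mul_comm Complex.I]
  · simp [sub_mul, Finset.sum_sub_distrib, mul_comm Complex.I]

theorem continuous_hermitian_apply (i j : Fin N) : Continuous fun u => hermitian u i j := by
  simp_rw [hermitian_apply_eq]; exact continuous_linForm _

theorem continuous_hermitian : Continuous (hermitian (N := N)) :=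
  continuous_matrix fun i j => continuous_hermitian_apply i j

theorem star_hermitian_apply (u : Fin N × Fin N → ℝ) (i j : Fin N) :
    star (hermitian u i j) = hermitian u j i := by
  unfold hermitian
  simp only [Matrix.of_apply]
  rcases lt_trichotomy i j with h | rfl | h
  · simp [h, h.ne, h.ne', h.not_gt, sub_eq_add_neg]
  · simp
  · simp [h, h.ne, h.ne', h.not_gt]

theorem isHermitian_hermitian (u : Fin N × Fin N → ℝ) : (hermitian u).IsHermitian := by
  ext i j
  rw [Matrix.conjTranspose_apply, star_hermitian_apply]

theorem hermitian_mul_apply_swap (u : Fin N × Fin N → ℝ) (i j : Fin N) :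
    hermitian u i j * hermitian u j i
      = (((if i = j then u (i, i) ^ 2 else u (i, j) ^ 2 + u (j, i) ^ 2 : ℝ)) : ℂ) := by
  unfold hermitian
  simp only [Matrix.of_apply]
  rcases lt_trichotomy i j with h | rfl | h
  · simp only [h.ne, h.ne', h, h.not_gt, if_true, if_false]
    push_cast
    linear_combination (-(u (j, i) : ℂ) ^ 2) * Complex.I_sq
  · simp [sq]
  · simp only [h.ne, h.ne', h, h.not_gt, if_true, if_false]
    push_cast
    linear_combination (-(u (i, j) : ℂ) ^ 2) * Complex.I_sq

/-- `Tr X²Λ = ∑ λᵢ |Xᵢⱼ|²`, and an off-diagonal coordinate occurs in both `|Xᵢⱼ|²` and `|Xⱼᵢ|²`,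
once with weight `λᵢ` and once with `λⱼ`. -/
theorem trace_sq_mul_Lam (lam : Fin N → ℝ) (u : Fin N × Fin N → ℝ) :
    (hermitian u ^ 2 * Lam lam).trace = ((quadForm (coordWeight lam) u : ℝ) : ℂ) := by
  have h1 : (hermitian u ^ 2 * Lam lam).trace
      = ∑ i, ∑ j, ((lam i * (if i = j then u (i, i) ^ 2 else u (i, j) ^ 2 + u (j, i) ^ 2) : ℝ) : ℂ)
      := by
    simp only [Lam, Matrix.trace, Matrix.diag_apply, Matrix.mul_diagonal]
    refine Finset.sum_congr rfl fun i _ => ?_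
    rw [sq, Matrix.mul_apply, Finset.sum_mul]
    refine Finset.sum_congr rfl fun j _ => ?_
    rw [hermitian_mul_apply_swap]
    push_cast; ring
  rw [h1, quadForm, Fintype.sum_prod_type]
  norm_cast
  have h2 : ∀ i j : Fin N, lam i * (if i = j then u (i, i) ^ 2 else u (i, j) ^ 2 + u (j, i) ^ 2)
      = lam i * u (i, j) ^ 2 + (if i = j then 0 else lam i * u (j, i) ^ 2) := fun i j => by
    split_ifs with h
    · subst h; ring
    · ring
  have h3 : ∀ i j : Fin N, coordWeight lam (i, j) * u (i, j) ^ 2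
      = lam i * u (i, j) ^ 2 + (if j = i then 0 else lam j * u (i, j) ^ 2) := fun i j => by
    unfold coordWeight
    by_cases h : i = j
    · subst h; simp
    · simp [h, Ne.symm h]; ring
  simp_rw [h2, h3, Finset.sum_add_distrib]
  congr 1
  exact Finset.sum_comm

theorem gaussian_hermitian (lam : Fin N → ℝ) (u : Fin N × Fin N → ℝ) :
    gaussian lam (hermitian u) = (Real.exp (-(1 / 2) * quadForm (coordWeight lam) u) : ℂ) := by
  rw [gaussian, Matrix.trace_smul, trace_sq_mul_Lam, smul_eq_mul, Complex.ofReal_exp]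
  push_cast
  ring_nf

theorem normalization_eq (lam : Fin N → ℝ) :
    normalization lam = ((∫ u, Real.exp (-(1 / 2) * quadForm (coordWeight lam) u) : ℝ) : ℂ) := by
  simp_rw [normalization, gaussian_hermitian]
  exact integral_ofReal

theorem normalization_ne_zero {lam : Fin N → ℝ} (h : ∀ i, 0 < lam i) : normalization lam ≠ 0 := by
  rw [normalization_eq]
  exact_mod_cast (integral_exp_neg_mul_quadForm_pos (coordWeight_pos h) one_half_pos).ne'

theorem sum_entryCoeff_mul_eq (f : Fin N × Fin N → ℂ) (i j : Fin N) :
    ∑ c, entryCoeff (i, j) c * f c = if i = j then f (i, i)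
      else if i < j then f (i, j) + Complex.I * f (j, i) else f (j, i) - Complex.I * f (i, j) := by
  unfold entryCoeff
  dsimp only
  split_ifs with h1 h2
  · subst h1; simp
  · simp [add_mul, Finset.sum_add_distrib]
  · simp [sub_mul, Finset.sum_sub_distrib]

theorem entryCoeff_diag (k l i : Fin N) :
    entryCoeff (k, l) (i, i) = if k = i ∧ l = i then 1 else 0 := by
  unfold entryCoeff
  simp only [Prod.swap, Prod.mk.injEq]
  grind

theorem entryCoeff_upper (k l : Fin N) {i j : Fin N} (h : i < j) :
    entryCoeff (k, l) (i, j) = if (k = i ∧ l = j) ∨ (k = j ∧ l = i) then 1 else 0 := by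
  unfold entryCoeff
  simp only [Prod.swap, Prod.mk.injEq]
  grind

theorem entryCoeff_lower (k l : Fin N) {i j : Fin N} (h : i < j) :
    entryCoeff (k, l) (j, i) = if k = i ∧ l = j then Complex.I
      else if k = j ∧ l = i then -Complex.I else 0 := by
  unfold entryCoeff
  simp only [Prod.swap, Prod.mk.injEq]
  grind

/-- The covariance of the matrix entries. -/
theorem sum_entryCoeff_mul {lam : Fin N → ℝ} (h : ∀ i, 0 < lam i) (p p' : Fin N × Fin N) :
    ∑ c, entryCoeff p c * entryCoeff p' c / (coordWeight lam c : ℂ)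
      = if p' = p.swap then 2 / ((lam p.1 : ℂ) + lam p.2) else 0 := by
  obtain ⟨i, j⟩ := p
  obtain ⟨k, l⟩ := p'
  have hI := Complex.I_mul_I
  have hl : ∀ i, (lam i : ℂ) ≠ 0 := fun i => by exact_mod_cast (h i).ne'
  simp_rw [mul_div_assoc]
  rw [sum_entryCoeff_mul_eq]
  simp only [Prod.swap, Prod.mk.injEq]
  rcases lt_trichotomy i j with hij | rfl | hij
  · simp only [hij.ne, hij, if_true, if_false, entryCoeff_upper _ _ hij, entryCoeff_lower _ _ hij,
      coordWeight, hij.ne', ← mul_div_assoc, add_comm (lam j), ← add_div, Complex.ofReal_add]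
    -- For equal off-diagonal index pairs the real and imaginary parts cancel because `I² = -1`; for
    -- opposite pairs they add up to twice the variance.
    by_cases h1 : k = i ∧ l = j
    · obtain ⟨rfl, rfl⟩ := h1
      simp [hij.ne]
    · by_cases h2 : k = j ∧ l = i
      · obtain ⟨rfl, rfl⟩ := h2
        simp [hij.ne']; norm_num
      · simp [h1, h2]
  · simp only [if_true, entryCoeff_diag, coordWeight]
    split_ifs
    · have := hl i
      field_simp; norm_num
    · simp
  · simp only [hij.ne', hij.not_gt, if_false, entryCoeff_upper _ _ hij, entryCoeff_lower _ _ hij,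
      coordWeight, hij.ne, ← mul_div_assoc, add_comm (lam j), ← sub_div, Complex.ofReal_add]
    by_cases h1 : k = i ∧ l = j
    · obtain ⟨rfl, rfl⟩ := h1
      simp [hij.ne]
    · by_cases h2 : k = j ∧ l = i
      · obtain ⟨rfl, rfl⟩ := h2
        simp [hij.ne']; norm_num
      · simp [h1, h2]

/-- One half of the covariance of two matrix entries with indices `p` and `p'`. -/
noncomputable def halfProp (lam : Fin N → ℝ) (p p' : Fin N × Fin N) : ℂ :=
  if p.1 = p'.2 then (√(2 / (lam p.1 + lam p.2)) : ℂ) else 0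

/-- Each factor imposes one of the two index identifications and carries the square root of the
variance. A matched pair thus becomes a product over its two half-edges, each of which compares the
colors on one side of the ribbon. -/
theorem halfProp_mul_halfProp {lam : Fin N → ℝ} (h : ∀ i, 0 < lam i) (p p' : Fin N × Fin N) :
    halfProp lam p p' * halfProp lam p' p
      = ∑ c, entryCoeff p c * entryCoeff p' c / (coordWeight lam c : ℂ) := by
  rw [sum_entryCoeff_mul h]
  obtain ⟨i, j⟩ := p
  obtain ⟨k, l⟩ := p'
  simp only [halfProp, Prod.swap, Prod.mk.injEq]
  by_cases h1 : i = l
  · by_cases h2 : k = j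
    · subst h1 h2
      simp only [if_true, and_self]
      rw [add_comm (lam k), ← Complex.ofReal_mul,
        Real.mul_self_sqrt (by have := h i; have := h k; positivity)]
      push_cast; rfl
    · simp [h1, h2]
  · simp [h1, Ne.symm h1]

theorem integrable_prod_hermitian_mul_gaussian {L : Type*} [Fintype L] {lam : Fin N → ℝ}
    (h : ∀ i, 0 < lam i) (p : L → Fin N × Fin N) :
    Integrable fun u => (∏ x, hermitian u (p x).1 (p x).2) * gaussian lam (hermitian u) := by
  simp_rw [gaussian_hermitian, hermitian_apply_eq]
  exact integrable_prod_linForm_mul_gauss (coordWeight_pos h) (fun x => entryCoeff (p x)) _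

/-- Wick's theorem for the entries of a Gaussian Hermitian matrix. -/
theorem average_prod {L : Type*} [Fintype L] [DecidableEq L] {lam : Fin N → ℝ}
    (h : ∀ i, 0 < lam i) (p : L → Fin N × Fin N) :
    average lam (fun X => ∏ x, X (p x).1 (p x).2)
      = ∑ τ ∈ matchings (Finset.univ : Finset L), ∏ x, halfProp lam (p x) (p (τ x)) := by
  rw [average, inv_mul_eq_iff_eq_mul₀ (normalization_ne_zero h), normalization, mul_comm]
  simp_rw [gaussian_hermitian, hermitian_apply_eq]
  exact wick (coordWeight_pos h) (fun x => entryCoeff (p x))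
    (fun x y => halfProp lam (p x) (p y)) (fun x y => halfProp_mul_halfProp h _ _) _

theorem average_sum {κ : Type*} (s : Finset κ) (lam : Fin N → ℝ)
    (f : κ → Matrix (Fin N) (Fin N) ℂ → ℂ)
    (hf : ∀ k ∈ s, Integrable fun u => f k (hermitian u) * gaussian lam (hermitian u)) :
    average lam (fun X => ∑ k ∈ s, f k X) = ∑ k ∈ s, average lam (f k) := by
  simp only [average, Finset.sum_mul]
  rw [integral_finsetSum _ hf, Finset.mul_sum]

theorem average_const_mul (lam : Fin N → ℝ) (z : ℂ) (f : Matrix (Fin N) (Fin N) ℂ → ℂ) :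
    average lam (fun X => z * f X) = z * average lam f := by
  simp only [average, mul_assoc]
  rw [integral_const_mul]
  ring

end Hermitian

end KontsevichPenner

/-! ### Cycle counts and the exponential formula -/

section Cycles

variable {α β : Type*}

theorem Equiv.Perm.SameCycle.rel {e : Equiv.Perm α} (r : Setoid α) (h : ∀ x, r x (e x)) {x y : α}
    (hxy : e.SameCycle x y) : r x y := by
  obtain ⟨n, rfl⟩ := hxy
  induction n using Int.induction_on with
  | zero => exact r.refl _
  | succ n ih =>
    rw [add_comm, zpow_add, zpow_one, Equiv.Perm.mul_apply]
    exact r.trans ih (h _)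
  | pred n ih =>
    refine r.trans ih (r.symm ?_)
    have := h ((e ^ (-(n : ℤ) - 1)) x)
    rwa [← Equiv.Perm.mul_apply, ← zpow_one_add, add_sub_cancel] at this

theorem Equiv.Perm.SameCycle.apply_eq {e : Equiv.Perm α} {f : α → β} (h : ∀ x, f (e x) = f x)
    {x y : α} (hxy : e.SameCycle x y) : f x = f y :=
  hxy.rel (Setoid.ker f) fun x => (h x).symm

theorem Equiv.Perm.SameCycle.map_of_step {e : Equiv.Perm α} {e' : Equiv.Perm β} {g : α → β}
    (h : ∀ x, e'.SameCycle (g x) (g (e x))) {x y : α} (hxy : e.SameCycle x y) :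
    e'.SameCycle (g x) (g y) :=
  hxy.rel ((Equiv.Perm.SameCycle.setoid e').comap g) h

/-- The number of cycles of a permutation, fixed points included. -/
noncomputable def cycleCount (e : Equiv.Perm α) : ℕ :=
  Nat.card (Quotient (Equiv.Perm.SameCycle.setoid e))

theorem card_eq_cycleCount {κ : Type*} {e : Equiv.Perm α} (f : α → κ) (hf : Function.Surjective f)
    (h1 : ∀ x, f (e x) = f x) (h2 : ∀ x y, f x = f y → e.SameCycle x y) :
    Nat.card κ = cycleCount e := by
  refine (Nat.card_congr (Equiv.ofBijective
    (Quotient.lift f fun x y (hxy : e.SameCycle x y) => hxy.apply_eq h1) ⟨?_, ?_⟩)).symm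
  · rintro ⟨x⟩ ⟨y⟩ hxy
    exact Quotient.sound (h2 x y hxy)
  · intro k
    obtain ⟨x, rfl⟩ := hf k
    exact ⟨Quotient.mk _ x, rfl⟩

theorem cycleCount_optionCongr [Finite α] (e : Equiv.Perm α) :
    cycleCount (e.optionCongr : Equiv.Perm (Option α)) = cycleCount e + 1 := by
  unfold cycleCount
  rw [← Finite.card_option]
  refine (card_eq_cycleCount (e := (e.optionCongr : Equiv.Perm (Option α)))
    (Option.map (Quotient.mk (Equiv.Perm.SameCycle.setoid e))) ?_ ?_ ?_).symm
  · rintro (_ | ⟨⟨x⟩⟩)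
    · exact ⟨none, rfl⟩
    · exact ⟨some x, rfl⟩
  · rintro (_ | x)
    · rfl
    · simp only [Equiv.optionCongr_apply, Option.map_some, Option.some_inj]
      exact Quotient.sound (Equiv.Perm.sameCycle_apply_left.2 (Equiv.Perm.SameCycle.refl _ _))
  · rintro (_ | x) (_ | y) h
    · exact Equiv.Perm.SameCycle.refl _ _
    · simp at h
    · simp at h
    · simp only [Option.map_some, Option.some_inj] at h
      refine Equiv.Perm.SameCycle.map_of_step (fun x => ?_) (Quotient.exact h)
      exact Equiv.Perm.sameCycle_apply_right.2 (Equiv.Perm.SameCycle.refl _ _)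

/-- The permutation inserts `none` into the cycle of `p`, immediately before `p`, so no cycle is
created or merged. -/
theorem cycleCount_swap_mul_optionCongr [DecidableEq α] (e : Equiv.Perm α) (p : α) :
    cycleCount (Equiv.swap none (some p) * e.optionCongr : Equiv.Perm (Option α))
      = cycleCount e := by
  have hcyc : ∀ x, e.SameCycle x (e x) := fun x =>
    Equiv.Perm.sameCycle_apply_right.2 (Equiv.Perm.SameCycle.refl _ _)
  set π : Equiv.Perm (Option α) := Equiv.swap none (some p) * e.optionCongr with hπ
  have hπcyc : ∀ x, π.SameCycle x (π x) := fun x =>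
    Equiv.Perm.sameCycle_apply_right.2 (Equiv.Perm.SameCycle.refl _ _)
  have hnone : π none = some p := by simp [hπ]
  have hp : ∀ x, e x = p → π (some x) = none := fun x hx => by simp [hπ, hx]
  have hsome : ∀ x, e x ≠ p → π (some x) = some (e x) := fun x hx => by
    simp only [hπ, Equiv.Perm.mul_apply, Equiv.optionCongr_apply, Option.map_some]
    exact Equiv.swap_apply_of_ne_of_ne (by simp) (by simpa using hx)
  have hstep : ∀ x, π.SameCycle (some x) (some (e x)) := fun x => by
    by_cases hx : e x = p
    · have h1 := hπcyc (some x)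
      have h2 := hπcyc none
      rw [hp x hx] at h1
      rw [hnone, ← hx] at h2
      exact h1.trans h2
    · rw [← hsome x hx]; exact hπcyc _
  refine (card_eq_cycleCount (κ := Quotient (Equiv.Perm.SameCycle.setoid e)) (e := π)
    (fun o => Quotient.mk _ (o.getD p)) ?_ ?_ ?_).symm
  · rintro ⟨x⟩
    exact ⟨some x, rfl⟩
  · rintro (_ | x)
    · simp [hnone]
    · by_cases hx : e x = p
      · rw [hp x hx]
        exact Quotient.sound (by rw [← hx]; exact (hcyc x).symm)
      · rw [hsome x hx]
        exact Quotient.sound (hcyc x).symm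
  · have key : ∀ o : Option α, π.SameCycle o (some (o.getD p)) := by
      rintro (_ | x)
      · simpa [hnone] using hπcyc none
      · exact Equiv.Perm.SameCycle.refl _ _
    intro x y h
    exact (key x).trans ((Equiv.Perm.SameCycle.map_of_step hstep (Quotient.exact h)).trans
      (key y).symm)

end Cycles

/-! ### Permutation sums weighted by cycle counts. -/

section PermSum

variable {α β ι : Type*} [Fintype α] [Fintype β] [Fintype ι] [DecidableEq α] [DecidableEq β]

/-- The sum over permutations `π`, weighted by `Q` to the number of cycles, of the products over the
cycles of `π` of the traces of the products of the matrices along the cycle. -/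
noncomputable def permSum (Q : ℂ) (W : α → Matrix ι ι ℂ) : ℂ :=
  ∑ π : Equiv.Perm α, Q ^ cycleCount π * ∑ i : α → ι, ∏ a, W a (i (π a)) (i a)

theorem cycleCount_permCongr {α β : Type*} (f : α ≃ β) (e : Equiv.Perm α) :
    cycleCount (f.permCongr e) = cycleCount e := by
  refine (card_eq_cycleCount (e := f.permCongr e)
    (fun x => Quotient.mk (Equiv.Perm.SameCycle.setoid e) (f.symm x)) ?_ ?_ ?_).symm
  · rintro ⟨x⟩
    exact ⟨f x, congrArg _ (f.symm_apply_apply x)⟩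
  · intro x
    refine Quotient.sound ?_
    simp only [Equiv.permCongr_apply, Equiv.symm_apply_apply]
    exact Equiv.Perm.sameCycle_apply_left.2 (Equiv.Perm.SameCycle.refl _ _)
  · intro x y h
    have := Equiv.Perm.SameCycle.map_of_step (e' := f.permCongr e) (g := f) (fun x => ?_)
      (Quotient.exact h)
    · simpa using this
    · have h2 : f (e x) = f.permCongr e (f x) := by simp
      rw [h2]
      exact Equiv.Perm.sameCycle_apply_right.2 (Equiv.Perm.SameCycle.refl _ _)

theorem permSum_comp_equiv (Q : ℂ) (f : α ≃ β) (W : β → Matrix ι ι ℂ) :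
    permSum Q (fun a => W (f a)) = permSum Q W := by
  unfold permSum
  refine Fintype.sum_equiv f.permCongr _ _ fun π => ?_
  rw [cycleCount_permCongr]
  congr 1
  refine Fintype.sum_equiv (f.arrowCongr (Equiv.refl ι)) _ _ fun i => ?_
  refine Fintype.prod_equiv f _ _ fun a => ?_
  simp

theorem permSum_of_isEmpty [IsEmpty α] (Q : ℂ) (W : α → Matrix ι ι ℂ) : permSum Q W = 1 := by
  have : ∀ π : Equiv.Perm α, cycleCount π = 0 := fun π => by
    have : IsEmpty (Quotient (Equiv.Perm.SameCycle.setoid π)) := ⟨by rintro ⟨x⟩; exact isEmptyElim x⟩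
    simp [cycleCount]
  simp [permSum, this]

/-- Either `none` is a fixed point and contributes a cycle and a trace, or it lies between some `a`
and the next point of the cycle. In the second case, summing over the index at `none` multiplies its
matrix into that of `a`. -/
theorem permSum_option (Q : ℂ) (W : Option α → Matrix ι ι ℂ) :
    permSum Q W = Q * (W none).trace * permSum Q (fun a => W (some a))
      + ∑ a, permSum Q (Function.update (fun a => W (some a)) a (W none * W (some a))) := by
  unfold permSum
  rw [← Equiv.sum_comp (Equiv.Perm.decomposeOption (α := α)).symm, Fintype.sum_prod_type,
    Fintype.sum_option]
  congr 1
  · rw [Finset.mul_sum]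
    refine Finset.sum_congr rfl fun e _ => ?_
    simp only [Equiv.Perm.decomposeOption_symm_apply, Equiv.swap_self, ← Equiv.Perm.one_def, one_mul,
      cycleCount_optionCongr]
    rw [← Equiv.sum_comp (Equiv.piOptionEquivProd (β := fun _ => ι)).symm, Fintype.sum_prod_type]
    simp only [Fintype.prod_option, Equiv.optionCongr_apply, Option.map_none, Option.map_some]
    simp only [Equiv.piOptionEquivProd, Equiv.coe_fn_symm_mk, Matrix.trace, Matrix.diag_apply]
    simp_rw [← Finset.mul_sum, ← Finset.sum_mul]
    ring
  · rw [Finset.sum_comm, Finset.sum_comm (s := (Finset.univ : Finset α))]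
    refine Finset.sum_congr rfl fun e _ => ?_
    -- The insertion point is written as `e a`, so that the sum runs over the predecessor `a` of
    -- `none`, whose matrix absorbs `W none`.
    rw [← Equiv.sum_comp e]
    refine Finset.sum_congr rfl fun a _ => ?_
    simp only [Equiv.Perm.decomposeOption_symm_apply, cycleCount_swap_mul_optionCongr]
    congr 1
    rw [← Equiv.sum_comp (Equiv.piOptionEquivProd (β := fun _ => ι)).symm, Fintype.sum_prod_type,
      Finset.sum_comm]
    refine Finset.sum_congr rfl fun i _ => ?_
    rw [← Finset.mul_prod_erase Finset.univ _ (Finset.mem_univ a), Function.update_self,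
      Matrix.mul_apply, Finset.sum_mul]
    refine Finset.sum_congr rfl fun j _ => ?_
    rw [Fintype.prod_option, ← Finset.mul_prod_erase Finset.univ _ (Finset.mem_univ a), ← mul_assoc]
    congr 1
    · simp [Equiv.piOptionEquivProd]
    · refine Finset.prod_congr rfl fun b hb => ?_
      have hb := Finset.ne_of_mem_erase hb
      rw [Function.update_of_ne hb]
      have h1 : (Equiv.swap none (some (e a)) * e.optionCongr : Equiv.Perm (Option α)) (some b)
          = some (e b) := by
        rw [Equiv.Perm.mul_apply, Equiv.optionCongr_apply, Option.map_some,
          Equiv.swap_apply_of_ne_of_ne (by simp) (by simpa using hb)]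
      simp only [h1, Equiv.piOptionEquivProd, Equiv.coe_fn_symm_mk]

variable [DecidableEq ι]

theorem permSum_fin_succ (Q : ℂ) (Y : Matrix ι ι ℂ) (m : ℕ) :
    permSum Q (fun _ : Fin (m + 1) => Y)
      = permSum Q (fun o : Option (Fin m) => o.elim (Y ^ 1) fun _ => Y) := by
  rw [← permSum_comp_equiv Q (finSuccEquiv m)]
  congr 1
  funext a
  rcases h : finSuccEquiv m a with _ | b <;> simp

/-- The terms are sorted by the cycle through the marked point: `x.1` other points lie on it, and
`x.2` points are left over. The power of `Y` at the marked point grows as points are merged into it.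
For `j = 1` this is the differential equation of the generating function of `permSum`. -/
theorem permSum_elim (Q : ℂ) (Y : Matrix ι ι ℂ) (j m : ℕ) :
    permSum Q (fun o : Option (Fin m) => o.elim (Y ^ j) fun _ => Y) / (m.factorial : ℂ)
      = ∑ x ∈ Finset.HasAntidiagonal.antidiagonal m, Q * (Y ^ (j + x.1)).trace *
          (permSum Q (fun _ : Fin x.2 => Y) / (x.2.factorial : ℂ)) := by
  induction m generalizing j with
  | zero => simp [permSum_option, permSum_of_isEmpty]
  | succ m ih =>
    rw [Finset.Nat.sum_antidiagonal_succ, permSum_option]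
    -- By symmetry all `m + 1` choices of the neighbor give the same value, with `a` as the new
    -- marked point; this multiplicity cancels the factor `m + 1` of the factorial.
    have h1 : ∀ a : Fin (m + 1),
        permSum Q (Function.update (fun _ : Fin (m + 1) => Y) a (Y ^ j * Y))
          = permSum Q (fun o : Option (Fin m) => o.elim (Y ^ (j + 1)) fun _ => Y) := fun a => by
      rw [← permSum_comp_equiv Q (finSuccEquiv' a)]
      congr 1
      funext b
      by_cases hb : b = a
      · subst hb; simp [pow_succ]
      · rw [Function.update_of_ne hb]
        obtain ⟨c, rfl⟩ := Fin.exists_succAbove_eq hb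
        simp
    simp only [Option.elim_none, Option.elim_some, h1, Finset.sum_const, Finset.card_univ,
      Fintype.card_fin, nsmul_eq_mul, add_div, add_zero]
    congr 1
    · ring
    · have h2 : ((m.factorial : ℕ) : ℂ) ≠ 0 := by exact_mod_cast m.factorial_ne_zero
      have h3 : ((m + 1 : ℕ) : ℂ) ≠ 0 := by exact_mod_cast m.succ_ne_zero
      rw [Nat.factorial_succ, Nat.cast_mul, mul_div_mul_left _ _ h3, ih]
      exact Finset.sum_congr rfl fun x _ => by rw [add_assoc, add_comm 1]

end PermSum

/-! ### The exponential of a power series, by its differential equation -/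

namespace PowerSeries

/-- The equation determines the coefficient of degree `n + 1` from those of degree at most `n`. -/
theorem eq_of_derivative_eq_mul {c f g : PowerSeries ℂ} (hf : derivative ℂ f = c * f)
    (hg : derivative ℂ g = c * g) (h0 : coeff 0 f = coeff 0 g) : f = g := by
  ext n
  induction n using Nat.strong_induction_on with
  | _ n ih =>
    cases n with
    | zero => exact h0
    | succ n =>
      have h1 : ∀ h : PowerSeries ℂ, derivative ℂ h = c * h →
          coeff (n + 1) h * ((n : ℂ) + 1)
            = ∑ x ∈ Finset.HasAntidiagonal.antidiagonal n, coeff x.1 c * coeff x.2 h := fun h hh => by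
        rw [← coeff_mul, ← hh, coeff_derivative]
      have h2 : ((n : ℂ) + 1) ≠ 0 := by exact_mod_cast n.succ_ne_zero
      refine mul_right_cancel₀ h2 ?_
      rw [h1 f hf, h1 g hg]
      refine Finset.sum_congr rfl fun x hx => ?_
      rw [ih x.2 (Nat.lt_succ_of_le (Finset.HasAntidiagonal.antidiagonal.snd_le hx))]

theorem coeff_pow_eq_zero_of_lt {f : PowerSeries ℂ} (hf : coeff 0 f = 0) {n r : ℕ} (h : n < r) :
    coeff n (f ^ r) = 0 := by
  have : (X : PowerSeries ℂ) ∣ f := X_dvd_iff.2 (by simpa using hf)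
  exact X_pow_dvd_iff.1 (pow_dvd_pow_of_dvd this r) n h

/-- The exponential of a power series without constant term. -/
noncomputable def expSeries (f : PowerSeries ℂ) : PowerSeries ℂ :=
  mk fun n => ∑ r ∈ Finset.range (n + 1), coeff n (f ^ r) / (r.factorial : ℂ)

theorem coeff_expSeries_eq {f : PowerSeries ℂ} (hf : coeff 0 f = 0) {n R : ℕ} (h : n < R) :
    coeff n (expSeries f) = ∑ r ∈ Finset.range R, coeff n (f ^ r) / (r.factorial : ℂ) := by
  rw [expSeries, coeff_mk]
  refine Finset.sum_subset (Finset.range_subset_range.2 h) fun r _ hr => ?_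
  rw [coeff_pow_eq_zero_of_lt hf (by simpa using hr), zero_div]

theorem derivative_expSeries {f : PowerSeries ℂ} (hf : coeff 0 f = 0) :
    derivative ℂ (expSeries f) = derivative ℂ f * expSeries f := by
  ext n
  -- After the term `r = 0` is split off, the remaining exponents are `r + 1` with `r ≤ n`, which is
  -- the truncation needed on the right-hand side.
  rw [coeff_derivative, coeff_expSeries_eq hf n.succ.lt_succ_self, Finset.sum_range_succ', mul_comm,
    coeff_mul, mul_add, Finset.mul_sum]
  have h0 : coeff (n + 1) (f ^ 0) = 0 := by simp [coeff_one]
  rw [h0, zero_div, mul_zero, add_zero]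
  have h1 : ∀ r : ℕ, ((n : ℂ) + 1) * (coeff (n + 1) (f ^ (r + 1)) / ((r + 1).factorial : ℂ))
      = ∑ x ∈ Finset.HasAntidiagonal.antidiagonal n, coeff x.1 (derivative ℂ f) * (coeff x.2 (f ^ r)
        / (r.factorial : ℂ)) := fun r => by
    have h2 : ((r.factorial : ℕ) : ℂ) ≠ 0 := by exact_mod_cast r.factorial_ne_zero
    have h3 : ((r : ℂ) + 1) ≠ 0 := by exact_mod_cast r.succ_ne_zero
    have h4 : coeff n (derivative ℂ (f ^ (r + 1))) = ((r : ℂ) + 1) * coeff n (derivative ℂ f * f ^ r)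
        := by
      rw [Derivation.leibniz_pow]
      rw [nsmul_eq_mul, smul_eq_mul, Nat.add_sub_cancel, mul_comm (f ^ r), ← map_natCast C,
        coeff_C_mul]
      push_cast
      rfl
    rw [coeff_derivative, coeff_mul] at h4
    rw [Nat.factorial_succ]
    push_cast
    simp_rw [← mul_div_assoc, ← Finset.sum_div]
    rw [mul_comm, h4]
    field_simp
  simp_rw [h1]
  rw [Finset.sum_comm]
  refine Finset.sum_congr rfl fun x hx => ?_
  rw [← Finset.mul_sum, coeff_expSeries_eq hf (Nat.lt_succ_of_le (Finset.HasAntidiagonal.antidiagonal.snd_le hx))]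

theorem coeff_zero_expSeries (f : PowerSeries ℂ) : coeff 0 (expSeries f) = 1 := by
  simp [expSeries]

end PowerSeries

/-! ### The coefficients of the expansion as permutation sums. -/

namespace KontsevichPenner

variable {N : ℕ}

theorem expansionCoeff_eq_coeff (Q : ℂ) (lam : Fin N → ℝ) (n : ℕ) (X : Matrix (Fin N) (Fin N) ℂ) :
    expansionCoeff Q lam n X = PowerSeries.coeff n (PowerSeries.expSeries (interaction Q lam X)) := by
  simp [expansionCoeff, PowerSeries.expSeries]

theorem coeff_zero_interaction (Q : ℂ) (lam : Fin N → ℝ) (X : Matrix (Fin N) (Fin N) ℂ) :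
    PowerSeries.coeff 0 (interaction Q lam X) = 0 := by
  simp [interaction]

/-- The exponential of the interaction and the product of the two generating functions `D`
(logarithmic part) and `E` (cubic part) solve the same linear differential equation in `s` and have
constant term `1`. -/
theorem expansionCoeff_eq_sum (Q : ℂ) (lam : Fin N → ℝ) (n : ℕ) (X : Matrix (Fin N) (Fin N) ℂ) :
    expansionCoeff Q lam n X = ∑ x ∈ Finset.HasAntidiagonal.antidiagonal n,
      (permSum Q (fun _ : Fin x.1 => -((Lam lam)⁻¹ * X)) / (x.1.factorial : ℂ))
        * ((-(X ^ 3).trace / 6) ^ x.2 / (x.2.factorial : ℂ)) := by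
  rw [expansionCoeff_eq_coeff]
  set Z := -((Lam lam)⁻¹ * X) with hZ
  set b : ℂ := -(X ^ 3).trace / 6 with hb
  set D : PowerSeries ℂ := PowerSeries.mk fun m =>
    permSum Q (fun _ : Fin m => Z) / (m.factorial : ℂ) with hD
  set E : PowerSeries ℂ := PowerSeries.mk fun k => b ^ k / (k.factorial : ℂ) with hE
  have hD' : PowerSeries.derivative ℂ D
      = (PowerSeries.mk fun k => Q * (Z ^ (1 + k)).trace) * D := by
    ext m
    rw [PowerSeries.coeff_derivative, PowerSeries.coeff_mul]
    simp only [hD, PowerSeries.coeff_mk]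
    rw [← permSum_elim, ← permSum_fin_succ, Nat.factorial_succ]
    have h2 : ((m.factorial : ℕ) : ℂ) ≠ 0 := by exact_mod_cast m.factorial_ne_zero
    have h3 : ((m : ℂ) + 1) ≠ 0 := by exact_mod_cast m.succ_ne_zero
    push_cast
    field_simp
  have hE' : PowerSeries.derivative ℂ E = PowerSeries.C b * E := by
    ext k
    rw [PowerSeries.coeff_derivative, PowerSeries.coeff_C_mul]
    simp only [hE, PowerSeries.coeff_mk, Nat.factorial_succ]
    have h2 : ((k.factorial : ℕ) : ℂ) ≠ 0 := by exact_mod_cast k.factorial_ne_zero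
    have h3 : ((k : ℂ) + 1) ≠ 0 := by exact_mod_cast k.succ_ne_zero
    push_cast
    field_simp
    ring
  have hI : PowerSeries.derivative ℂ (interaction Q lam X)
      = (PowerSeries.mk fun k => Q * (Z ^ (1 + k)).trace) + PowerSeries.C b := by
    ext k
    rw [PowerSeries.coeff_derivative, map_add, PowerSeries.coeff_C]
    simp only [interaction, PowerSeries.coeff_mk, ← hZ]
    have h3 : ((k : ℂ) + 1) ≠ 0 := by exact_mod_cast k.succ_ne_zero
    rcases eq_or_ne k 0 with rfl | hk
    · simp [hb, Nat.factorial]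
      ring
    · simp only [hk, Nat.add_eq_right, if_false, zero_add, add_zero, Nat.add_eq_zero_iff, one_ne_zero,
        and_false, add_comm 1 k]
      push_cast
      field_simp
  have key : PowerSeries.expSeries (interaction Q lam X) = D * E := by
    refine PowerSeries.eq_of_derivative_eq_mul
      (PowerSeries.derivative_expSeries (coeff_zero_interaction Q lam X)) ?_ ?_
    · rw [Derivation.leibniz, hD', hE', hI, smul_eq_mul, smul_eq_mul]
      ring
    · rw [PowerSeries.coeff_zero_expSeries, PowerSeries.coeff_mul]
      simp [hD, hE, permSum_of_isEmpty]
  rw [key, PowerSeries.coeff_mul]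
  simp [hD, hE]

end KontsevichPenner

/-! ### Permutations all of whose cycles have the same length -/

section ConstantPeriod

variable {α I : Type*} {e : Equiv.Perm α} {p : ℕ}

theorem Equiv.Perm.sameCycle_iterate (e : Equiv.Perm α) (n : ℕ) (x : α) :
    e.SameCycle x (e^[n] x) := by
  refine ⟨n, ?_⟩
  rw [zpow_natCast, Equiv.Perm.iterate_eq_pow]

theorem Equiv.Perm.SameCycle.exists_iterate_lt [Finite α]
    (hp : ∀ x, Function.minimalPeriod e x = p) {x y : α} (h : e.SameCycle x y) :
    ∃ j < p, e^[j] x = y := by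
  obtain ⟨n, rfl⟩ := h.exists_nat_pow_eq
  have h0 : 0 < p := by
    rw [← hp x]
    exact Function.minimalPeriod_pos_of_mem_periodicPts
      (e.injective.mem_periodicPts x)
  refine ⟨n % p, Nat.mod_lt _ h0, ?_⟩
  rw [← hp x, Function.iterate_mod_minimalPeriod_eq, Equiv.Perm.iterate_eq_pow]

/-- A permutation with constant period, with a system of representatives of its cycles. -/
theorem bijective_iterate_of_minimalPeriod [Finite α]
    (hp : ∀ x, Function.minimalPeriod e x = p) {b : I → α}
    (hb : Function.Bijective fun i => Quotient.mk (Equiv.Perm.SameCycle.setoid e) (b i)) :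
    Function.Bijective fun x : I × Fin p => e^[x.2] (b x.1) := by
  constructor
  · rintro ⟨i, j⟩ ⟨i', j'⟩ h
    dsimp only at h
    have h1 : e.SameCycle (b i) (b i') :=
      ((e.sameCycle_iterate j (b i)).trans (h ▸ Equiv.Perm.SameCycle.refl _ _)).trans
        (e.sameCycle_iterate j' (b i')).symm
    obtain rfl : i = i' := hb.1 (Quotient.sound h1)
    have h2 := Function.iterate_injOn_Iio_minimalPeriod (f := e) (x := b i)
      (show (j : ℕ) ∈ Set.Iio _ by rw [hp]; exact j.2)
      (show (j' : ℕ) ∈ Set.Iio _ by rw [hp]; exact j'.2) h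
    rw [Fin.ext h2]
  · intro x
    obtain ⟨i, hi⟩ := hb.2 (Quotient.mk _ x)
    obtain ⟨j, hj, hjx⟩ := Equiv.Perm.SameCycle.exists_iterate_lt hp (Quotient.exact hi)
    exact ⟨(i, ⟨j, hj⟩), hjx⟩

theorem bijective_iterate_out [Finite α] (hp : ∀ x, Function.minimalPeriod e x = p) :
    Function.Bijective fun x : Quotient (Equiv.Perm.SameCycle.setoid e) × Fin p =>
      e^[x.2] (Quotient.out x.1) :=
  bijective_iterate_of_minimalPeriod hp (by
    simp only [Quotient.out_eq]; exact Function.bijective_id)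

theorem card_eq_mul_cycleCount [Finite α] (hp : ∀ x, Function.minimalPeriod e x = p) :
    Nat.card α = p * cycleCount e := by
  rw [← Nat.card_congr (Equiv.ofBijective _ (bijective_iterate_out hp)), Nat.card_prod, Nat.card_fin,
    mul_comm, cycleCount]

theorem minimalPeriod_eq_two (h1 : ∀ x, e (e x) = x) (h2 : ∀ x, e x ≠ x) (x : α) :
    Function.minimalPeriod e x = 2 :=
  have : Fact (Nat.Prime 2) := ⟨Nat.prime_two⟩
  Function.minimalPeriod_eq_prime (h1 x) (h2 x)

theorem prod_eq_prod_cycles_of_involutive [Fintype α] (h1 : ∀ x, e (e x) = x) (h2 : ∀ x, e x ≠ x)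
    [Fintype (Quotient (Equiv.Perm.SameCycle.setoid e))] (s : α → ℂ) :
    ∏ x, s x = ∏ c : Quotient (Equiv.Perm.SameCycle.setoid e),
      s (Quotient.out c) * s (e (Quotient.out c)) := by
  rw [← Fintype.prod_bijective _ (bijective_iterate_out (minimalPeriod_eq_two h1 h2)) _ s
    fun _ => rfl, Fintype.prod_prod_type]
  refine Finset.prod_congr rfl fun c _ => ?_
  simp [Fin.prod_univ_two]

end ConstantPeriod

namespace ColoredRibbonGraph

/-! ### The half-edges of a trivalent ribbon graph in standard form -/

/-- The half-edges that belong to no boundary edge, for a trivalent graph with a boundary half-edge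
at the vertices `A` and none at the vertices `K`. -/
abbrev FreeHalf (A K : Type) : Type := A ⊕ K × Fin 3

/-- The half-edges of a trivalent graph with a boundary half-edge at the vertices `A`, and none at
the vertices `K`. -/
abbrev StdHalf (A K : Type) : Type := A ⊕ A ⊕ FreeHalf A K

variable {A K : Type} {N : ℕ}

/-- Half-edges in standard form as pairs of a vertex and a position. -/
def stdHalfEquiv (A K : Type) : StdHalf A K ≃ (A ⊕ K) × Fin 3 where
  toFun
    | Sum.inl a => (Sum.inl a, 0)
    | Sum.inr (Sum.inl a) => (Sum.inl a, 1)
    | Sum.inr (Sum.inr (Sum.inl a)) => (Sum.inl a, 2)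
    | Sum.inr (Sum.inr (Sum.inr (k, j))) => (Sum.inr k, j)
  invFun
    | (Sum.inl a, j) => ![Sum.inl a, Sum.inr (Sum.inl a), Sum.inr (Sum.inr (Sum.inl a))] j
    | (Sum.inr k, j) => Sum.inr (Sum.inr (Sum.inr (k, j)))
  left_inv := by rintro (a | a | a | ⟨k, j⟩) <;> rfl
  right_inv := by
    rintro ⟨a | k, j⟩
    · fin_cases j <;> rfl
    · rfl

/-- The rotation of the half-edges around the vertices. -/
def stdRot (A K : Type) : Equiv.Perm (StdHalf A K) where
  toFun
    | Sum.inl a => Sum.inr (Sum.inl a)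
    | Sum.inr (Sum.inl a) => Sum.inr (Sum.inr (Sum.inl a))
    | Sum.inr (Sum.inr (Sum.inl a)) => Sum.inl a
    | Sum.inr (Sum.inr (Sum.inr (k, j))) => Sum.inr (Sum.inr (Sum.inr (k, j + 1)))
  invFun
    | Sum.inl a => Sum.inr (Sum.inr (Sum.inl a))
    | Sum.inr (Sum.inl a) => Sum.inl a
    | Sum.inr (Sum.inr (Sum.inl a)) => Sum.inr (Sum.inl a)
    | Sum.inr (Sum.inr (Sum.inr (k, j))) => Sum.inr (Sum.inr (Sum.inr (k, j - 1)))
  left_inv := by rintro (a | a | a | ⟨k, j⟩) <;> simp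
  right_inv := by rintro (a | a | a | ⟨k, j⟩) <;> simp

theorem stdHalfEquiv_stdRot (x : StdHalf A K) :
    stdHalfEquiv A K (stdRot A K x)
      = ((stdHalfEquiv A K x).1, (stdHalfEquiv A K x).2 + 1) := by
  rcases x with a | a | a | ⟨k, j⟩
  · rfl
  · rfl
  · exact Prod.ext rfl (show (0 : Fin 3) = 2 + 1 by decide)
  · rfl

theorem minimalPeriod_stdRot (x : StdHalf A K) : Function.minimalPeriod (stdRot A K) x = 3 := by
  have : Fact (Nat.Prime 3) := ⟨Nat.prime_three⟩
  refine Function.minimalPeriod_eq_prime ?_ ?_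
  · rcases x with a | a | a | ⟨k, j⟩
    · rfl
    · rfl
    · rfl
    · change Sum.inr (Sum.inr (Sum.inr (k, j + 1 + 1 + 1))) = _
      fin_cases j <;> rfl
  · rcases x with a | a | a | ⟨k, j⟩ <;> simp [Function.IsFixedPt, stdRot]

theorem card_stdHalf [Finite A] [Finite K] :
    Nat.card (StdHalf A K) = 3 * (Nat.card A + Nat.card K) := by
  rw [Nat.card_congr (stdHalfEquiv A K), Nat.card_prod, Nat.card_sum, Nat.card_fin, mul_comm]

/-- The colors of the faces on the two sides of a free half-edge. -/
def ends (d : Equiv.Perm A × (A → Fin N) × (K → Fin 3 → Fin N)) : FreeHalf A K → Fin N × Fin N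
  -- The first color is that of the half-edge `x` itself, the second that of `σ₀⁻¹ x`, which is `σ₂
  -- (σ₁ x)` and hence lies on the face of `σ₁ x`. The function `d.2.1` colors the middle half-edges
  -- of the boundary vertices. The free half-edge at `a` has the color of the middle half-edge at `π
  -- a`, because `σ₂` sends the latter to the former.
  | Sum.inl a => (d.2.1 (d.1 a), d.2.1 a)
  | Sum.inr (k, j) => (d.2.2 k j, d.2.2 k (j - 1))

/-- A trivalent colored ribbon graph in standard form: the permutation of the boundary half-edges,
the colors of the corners, and a matching of the free half-edges that respects the colors. -/
abbrev Gluing (A K : Type) (N : ℕ) : Type :=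
  {g : (Equiv.Perm A × (A → Fin N) × (K → Fin 3 → Fin N)) × Equiv.Perm (FreeHalf A K) //
    (∀ x, g.2 (g.2 x) = x) ∧ (∀ x, g.2 x ≠ x) ∧ ∀ x, (ends g.1 x).1 = (ends g.1 (g.2 x)).2}

namespace Gluing

/-- The permutation `σ₁` of a graph in standard form. -/
def flip (π : Equiv.Perm A) (τ : Equiv.Perm (FreeHalf A K)) (h : ∀ x, τ (τ x) = x) :
    Equiv.Perm (StdHalf A K) where
  toFun
    | Sum.inl a => Sum.inr (Sum.inl (π a))
    | Sum.inr (Sum.inl a) => Sum.inl (π.symm a)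
    | Sum.inr (Sum.inr x) => Sum.inr (Sum.inr (τ x))
  invFun
    | Sum.inl a => Sum.inr (Sum.inl (π a))
    | Sum.inr (Sum.inl a) => Sum.inl (π.symm a)
    | Sum.inr (Sum.inr x) => Sum.inr (Sum.inr (τ x))
  left_inv := by rintro (a | a | x) <;> simp [h]
  right_inv := by rintro (a | a | x) <;> simp [h]

/-- The colors of the half-edges of a graph in standard form, with junk values on the boundary. -/
def colorFun (d : Equiv.Perm A × (A → Fin N) × (K → Fin 3 → Fin N)) : StdHalf A K → Fin N
  | Sum.inl a => d.2.1 a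
  | Sum.inr (Sum.inl a) => d.2.1 a
  | Sum.inr (Sum.inr x) => (ends d x).1

/-- The colored ribbon graph described by a `Gluing`. -/
def toGraph [Finite A] [Finite K] (g : Gluing A K N) : ColoredRibbonGraph N where
  H := StdHalf A K
  finite_H := inferInstance
  σ₀ := stdRot A K
  σ₁ := flip g.1.1.1 g.1.2 g.2.1
  B := Set.range Sum.inl
  σ₁_involutive := (flip g.1.1.1 g.1.2 g.2.1).left_inv
  σ₁_ne := by
    have := g.2.2.1
    rintro (a | a | x)
    · simp [flip]
    · simp [flip]
    · simpa [flip] using this x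
  σ₂_mem_B := by
    rintro _ ⟨a, rfl⟩
    -- On the boundary half-edges `σ₂` is the permutation `π` itself.
    exact ⟨g.1.1.1 a, rfl⟩
  σ₁_notMem_B := by
    rintro _ ⟨a, rfl⟩ ⟨b, hb⟩
    simp [flip] at hb
  period_ne_one := fun x => by rw [minimalPeriod_stdRot]; norm_num
  period_ne_two := fun x => by rw [minimalPeriod_stdRot]; norm_num
  color := fun x => colorFun g.1.1 x.1
  color_σ₂ := by
    rintro ⟨x, hx⟩ ⟨y, hy⟩ (h : y = (stdRot A K).symm (flip g.1.1.1 g.1.2 g.2.1 x))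
    subst h
    have key : ∀ x : FreeHalf A K,
        colorFun g.1.1 ((stdRot A K).symm (Sum.inr (Sum.inr x))) = (ends g.1.1 x).2 := by
      rintro (a | ⟨k, j⟩) <;> rfl
    rcases x with a | a | x
    · exact absurd ⟨a, rfl⟩ hx
    · exact congrArg g.1.1.2.1 (g.1.1.1.apply_symm_apply a)
    · exact (key _).trans (g.2.2.2 x).symm

end Gluing

/-! ### Labelings of the half-edges -/

theorem Iso.toEquiv_injective {Γ Γ' : ColoredRibbonGraph N} :
    Function.Injective (Iso.toEquiv : Iso Γ Γ' → (Γ.H ≃ Γ'.H)) := by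
  rintro ⟨f, _, _, _, _⟩ ⟨g, _, _, _, _⟩ h
  cases h
  rfl

/-- Composition of isomorphisms. -/
def Iso.comp {Γ Γ' Γ'' : ColoredRibbonGraph N} (g : Iso Γ' Γ'') (f : Iso Γ Γ') : Iso Γ Γ'' where
  toEquiv := f.toEquiv.trans g.toEquiv
  map_σ₀ x := by simp [f.map_σ₀, g.map_σ₀]
  map_σ₁ x := by simp [f.map_σ₁, g.map_σ₁]
  map_B x := by simp [f.map_B, g.map_B]
  map_color x hx hx' := by
    have h1 : f.toEquiv x ∉ Γ'.B := fun h => hx ((f.map_B x).1 h)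
    exact (g.map_color _ h1 hx').trans (f.map_color x hx h1)

/-- The inverse of an isomorphism. -/
def Iso.inv {Γ Γ' : ColoredRibbonGraph N} (f : Iso Γ Γ') : Iso Γ' Γ where
  toEquiv := f.toEquiv.symm
  map_σ₀ x := by rw [Equiv.symm_apply_eq, f.map_σ₀, Equiv.apply_symm_apply]
  map_σ₁ x := by rw [Equiv.symm_apply_eq, f.map_σ₁, Equiv.apply_symm_apply]
  map_B x := by rw [← f.map_B, Equiv.apply_symm_apply]
  map_color x hx hx' := by
    have h := f.map_color (f.toEquiv.symm x) hx' (by rwa [Equiv.apply_symm_apply])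
    simp only [Equiv.apply_symm_apply] at h
    exact h.symm

instance (Γ : ColoredRibbonGraph N) : Finite Γ.H := Γ.finite_H

instance (Γ Γ' : ColoredRibbonGraph N) : Finite (Iso Γ Γ') :=
  Finite.of_injective _ Iso.toEquiv_injective

theorem card_iso_eq_card_aut {Γ Γ' : ColoredRibbonGraph N} (f : Iso Γ Γ') :
    Nat.card (Iso Γ Γ') = Nat.card (Iso Γ' Γ') := by
  refine Nat.card_congr ⟨fun g => g.comp f.inv, fun g => g.comp f, fun g => ?_, fun g => ?_⟩ <;>
  · apply Iso.toEquiv_injective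
    ext x
    simp [Iso.comp, Iso.inv]

theorem card_aut_pos (Γ : ColoredRibbonGraph N) : 0 < Nat.card (Iso Γ Γ) := by
  have : Nonempty (Iso Γ Γ) := ⟨⟨Equiv.refl _, fun _ => rfl, fun _ => rfl, fun _ => Iff.rfl,
    fun _ _ _ => rfl⟩⟩
  exact Nat.card_pos

/-- The labelings of the half-edges of `Γ` that bring it to standard form. -/
abbrev Labeling (A K : Type) (Γ : ColoredRibbonGraph N) : Type :=
  {e : StdHalf A K ≃ Γ.H // (∀ x, e (stdRot A K x) = Γ.σ₀ (e x)) ∧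
    ∀ x, e x ∈ Γ.B ↔ x ∈ Set.range Sum.inl}

/-- The labeling underlying an isomorphism with a graph in standard form. -/
def labelingOfIso [Finite A] [Finite K] {Γ : ColoredRibbonGraph N}
    (f : Σ g : Gluing A K N, Iso g.toGraph Γ) : Labeling A K Γ :=
  ⟨f.2.toEquiv, f.2.map_σ₀, f.2.map_B⟩

/-- The labeling determines the gluing: transporting `σ₁` back recovers `π` and `τ`, and
transporting the colors back recovers those of the standard form. -/
theorem labelingOfIso_injective [Finite A] [Finite K] {Γ : ColoredRibbonGraph N} :
    Function.Injective (labelingOfIso (A := A) (K := K) (Γ := Γ)) := by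
  rintro ⟨⟨⟨⟨π, i, c⟩, τ⟩, h1, h2, h3⟩, f⟩ ⟨⟨⟨⟨π', i', c'⟩, τ'⟩, h1', h2', h3'⟩, f'⟩ h
  have hf : ∀ x, f.toEquiv x = f'.toEquiv x := fun x =>
    congrFun (congrArg (fun e : StdHalf A K ≃ Γ.H => (e : StdHalf A K → Γ.H))
      (congrArg Subtype.val h)) x
  have hσ : ∀ x, Gluing.flip π τ h1 x = Gluing.flip π' τ' h1' x := fun x => by
    apply f.toEquiv.injective
    refine (f.map_σ₁ x).trans ?_
    rw [hf x, hf (Gluing.flip π' τ' h1' x)]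
    exact (f'.map_σ₁ x).symm
  have hc : ∀ x, x ∉ Set.range (Sum.inl : A → StdHalf A K) →
      Gluing.colorFun (π, i, c) x = Gluing.colorFun (π', i', c') x := fun x hx => by
    have hx' : f.toEquiv x ∉ Γ.B := fun h => hx ((f.map_B x).1 h)
    have e1 := f.map_color x hx hx'
    have e2 := f'.map_color x hx (by rwa [← hf x])
    refine e1.symm.trans (Eq.trans ?_ e2)
    congr 2
    exact hf x
  obtain rfl : π = π' := by
    ext a
    simpa [Gluing.flip] using hσ (Sum.inl a)
  obtain rfl : τ = τ' := by
    ext1 x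
    simpa [Gluing.flip] using hσ (Sum.inr (Sum.inr x))
  obtain rfl : i = i' := by
    funext a
    exact hc (Sum.inr (Sum.inl a)) (by simp)
  obtain rfl : c = c' := by
    funext k j
    exact hc (Sum.inr (Sum.inr (Sum.inr (k, j)))) (by simp)
  obtain rfl : f = f' := Iso.toEquiv_injective (Equiv.ext hf)
  rfl

/-- For `x ∈ B`, the half-edge `σ₁ x` is `σ₀` of an element of `B`. So `σ₁`, pulled back along the
labeling, exchanges boundary and middle half-edges and acts as a fixed-point free involution on the
free ones. -/
theorem labelingOfIso_surjective [Finite A] [Finite K] {Γ : ColoredRibbonGraph N} :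
    Function.Surjective (labelingOfIso (A := A) (K := K) (Γ := Γ)) := by
  rintro ⟨e, h0, hB⟩
  have hB' : ∀ a, e (Sum.inl a) ∈ Γ.B := fun a => (hB _).2 ⟨a, rfl⟩
  have hrot : ∀ x, Γ.σ₀⁻¹ (e x) = e ((stdRot A K).symm x) := fun x => by
    rw [Equiv.Perm.inv_eq_iff_eq, ← h0, Equiv.apply_symm_apply]
  -- the conjugate of `σ₁`
  set s : StdHalf A K → StdHalf A K := fun x => e.symm (Γ.σ₁ (e x)) with hs
  have hes : ∀ x, e (s x) = Γ.σ₁ (e x) := fun x => e.apply_symm_apply _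
  have hss : ∀ x, s (s x) = x := fun x => by simp [hs, Γ.σ₁_involutive]
  have hsne : ∀ x, s x ≠ x := fun x h => Γ.σ₁_ne (e x) (by rw [← hes, h])
  have hbd : ∀ a, ∃ b, s (Sum.inl a) = Sum.inr (Sum.inl b) := fun a => by
    have h1 := Γ.σ₂_mem_B _ (hB' a)
    rw [← hes, hrot, hB] at h1
    obtain ⟨b, hb⟩ := h1
    refine ⟨b, ?_⟩
    rw [eq_comm, Equiv.symm_apply_eq] at hb
    exact hb
  choose π₀ hπ₀ using hbd
  have hinj : Function.Injective π₀ := fun a b hab => by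
    have h1 : s (Sum.inl a) = s (Sum.inl b) := by rw [hπ₀, hπ₀, hab]
    have h2 := congrArg s h1
    rw [hss, hss] at h2
    exact Sum.inl.inj h2
  set π : Equiv.Perm A := Equiv.ofBijective π₀ (Finite.injective_iff_bijective.1 hinj) with hπ
  have hπa : ∀ a, s (Sum.inl a) = Sum.inr (Sum.inl (π a)) := hπ₀
  have hmid : ∀ a, s (Sum.inr (Sum.inl a)) = Sum.inl (π.symm a) := fun a => by
    rw [← hss (Sum.inl (π.symm a)), hπa, Equiv.apply_symm_apply]
  have hfree : ∀ x, ∃ y, s (Sum.inr (Sum.inr x)) = Sum.inr (Sum.inr y) := fun x => by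
    rcases hy : s (Sum.inr (Sum.inr x)) with a | a | y
    · have := congrArg s hy
      rw [hss, hπa] at this
      simp at this
    · have := congrArg s hy
      rw [hss, hmid] at this
      simp at this
    · exact ⟨y, rfl⟩
  choose τ₀ hτ₀ using hfree
  have hττ : ∀ x, τ₀ (τ₀ x) = x := fun x => by
    have := hss (Sum.inr (Sum.inr x))
    rw [hτ₀, hτ₀] at this
    simpa using this
  set τ : Equiv.Perm (FreeHalf A K) := ⟨τ₀, τ₀, hττ, hττ⟩ with hτ
  have hflip : ∀ x, Gluing.flip π τ hττ x = s x := by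
    rintro (a | a | x)
    · exact (hπa a).symm
    · exact (hmid a).symm
    · exact (hτ₀ x).symm
  -- the colors
  have hnB : ∀ x : A ⊕ FreeHalf A K, e (Sum.inr x) ∉ Γ.B := fun x h => by
    rw [hB] at h; simp at h
  set i : A → Fin N := fun a => Γ.color ⟨_, hnB (Sum.inl a)⟩ with hi
  set c : K → Fin 3 → Fin N := fun k j => Γ.color ⟨_, hnB (Sum.inr (Sum.inr (k, j)))⟩ with hcc
  have hcol : ∀ (x y : A ⊕ FreeHalf A K), Sum.inr y = (stdRot A K).symm (s (Sum.inr x)) →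
      Γ.color ⟨_, hnB y⟩ = Γ.color ⟨_, hnB x⟩ := fun x y hxy => by
    refine Γ.color_σ₂ ⟨_, hnB x⟩ ⟨_, hnB y⟩ ?_
    change e (Sum.inr y) = Γ.σ₀⁻¹ (Γ.σ₁ (e (Sum.inr x)))
    rw [← hes, hrot, hxy]
  have hleg : ∀ a, Γ.color ⟨_, hnB (Sum.inr (Sum.inl a))⟩ = i (π a) := fun a => by
    refine hcol (Sum.inl (π a)) (Sum.inr (Sum.inl a)) ?_
    rw [hmid, Equiv.symm_apply_apply]
    rfl
  have hfst : ∀ x, (ends (π, i, c) x).1 = Γ.color ⟨_, hnB (Sum.inr x)⟩ := by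
    rintro (a | ⟨k, j⟩)
    · exact (hleg a).symm
    · rfl
  have hends : ∀ x, (ends (π, i, c) x).1 = (ends (π, i, c) (τ x)).2 := fun x => by
    rw [hfst]
    have hx : s (Sum.inr (Sum.inr x)) = Sum.inr (Sum.inr (τ x)) := hτ₀ x
    rcases hy : τ x with a | ⟨k, j⟩
    · refine (hcol (Sum.inr x) (Sum.inl a) ?_).symm
      rw [hx, hy]; rfl
    · refine (hcol (Sum.inr x) (Sum.inr (Sum.inr (k, j - 1))) ?_).symm
      rw [hx, hy]; rfl
  refine ⟨⟨⟨⟨(π, i, c), τ⟩, hττ, fun x hx => hsne (Sum.inr (Sum.inr x)) ?_, hends⟩,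
    ⟨e, h0, fun x => ?_, hB, ?_⟩⟩, rfl⟩
  · rw [hτ₀]; exact congrArg (fun y => Sum.inr (Sum.inr y)) hx
  · exact (congrArg e (hflip x)).trans (hes x)
  · rintro (a | a | x) hx hx'
    · exact absurd ⟨a, rfl⟩ hx
    · rfl
    · exact (hfst x).symm

/-- This is the orbit-stabilizer count: each nonempty `Iso g.toGraph Γ` has `|Aut Γ|` elements. -/
theorem card_labeling_eq_sum [Finite A] [Finite K] [Fintype (Gluing A K N)]
    (Γ : ColoredRibbonGraph N) :
    Nat.card (Labeling A K Γ) = ∑ g : Gluing A K N, Nat.card (Iso g.toGraph Γ) := by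
  rw [← Nat.card_sigma]
  exact (Nat.card_congr (Equiv.ofBijective _
    ⟨labelingOfIso_injective, labelingOfIso_surjective⟩)).symm

end ColoredRibbonGraph

/-! ### The number of labelings of a trivalent graph. -/

namespace ColoredRibbonGraph

variable {A K : Type} {N : ℕ}

/-- The automorphisms of the half-edges in standard form, with their vertices and boundary. -/
abbrev StdAut (A K : Type) : Type :=
  {e : Equiv.Perm (StdHalf A K) // (∀ x, e (stdRot A K x) = stdRot A K (e x)) ∧
    ∀ x, e x ∈ Set.range Sum.inl ↔ x ∈ Set.range (Sum.inl : A → StdHalf A K)}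

/-- Labelings form a torsor under `StdAut`, and `f` serves as base point. -/
theorem card_labeling_eq_card_stdAut {Γ : ColoredRibbonGraph N} (f : Labeling A K Γ) :
    Nat.card (Labeling A K Γ) = Nat.card (StdAut A K) := by
  refine Nat.card_congr ⟨fun e => ⟨e.1.trans f.1.symm, fun x => ?_, fun x => ?_⟩,
    fun e => ⟨e.1.trans f.1, fun x => ?_, fun x => ?_⟩, fun e => ?_, fun e => ?_⟩
  · simp only [Equiv.trans_apply]
    rw [e.2.1, Equiv.symm_apply_eq, f.2.1, Equiv.apply_symm_apply]
  · simp only [Equiv.trans_apply]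
    rw [← f.2.2, Equiv.apply_symm_apply, e.2.2]
  · simp only [Equiv.trans_apply]
    rw [e.2.1, f.2.1]
  · simp only [Equiv.trans_apply]
    rw [f.2.2, e.2.2]
  · exact Subtype.ext (Equiv.ext fun x => by simp)
  · exact Subtype.ext (Equiv.ext fun x => by simp)

/-- The automorphism of the standard half-edges given by permutations of the vertices of both kinds
and rotations at the vertices without boundary. -/
def stdAutOf (x : Equiv.Perm A × Equiv.Perm K × (K → Fin 3)) : StdAut A K where
  val :=
    { toFun
        | Sum.inl a => Sum.inl (x.1 a)
        | Sum.inr (Sum.inl a) => Sum.inr (Sum.inl (x.1 a))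
        | Sum.inr (Sum.inr (Sum.inl a)) => Sum.inr (Sum.inr (Sum.inl (x.1 a)))
        | Sum.inr (Sum.inr (Sum.inr (k, j))) =>
          Sum.inr (Sum.inr (Sum.inr (x.2.1 k, x.2.2 k + j)))
      invFun
        | Sum.inl a => Sum.inl (x.1.symm a)
        | Sum.inr (Sum.inl a) => Sum.inr (Sum.inl (x.1.symm a))
        | Sum.inr (Sum.inr (Sum.inl a)) => Sum.inr (Sum.inr (Sum.inl (x.1.symm a)))
        | Sum.inr (Sum.inr (Sum.inr (k, j))) =>
          Sum.inr (Sum.inr (Sum.inr (x.2.1.symm k, j - x.2.2 (x.2.1.symm k))))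
      left_inv := by rintro (a | a | a | ⟨k, j⟩) <;> simp
      right_inv := by rintro (a | a | a | ⟨k, j⟩) <;> simp }
  property := by
    constructor
    · rintro (a | a | a | ⟨k, j⟩) <;> simp [stdRot, add_assoc]
    · rintro (a | a | a | ⟨k, j⟩) <;> simp

/-- A vertex in `A` cannot be rotated, since its boundary half-edge is distinguished; a vertex in
`K` can be rotated in three ways. One half-edge of each vertex determines the automorphism. -/
theorem stdAutOf_bijective [Finite A] [Finite K] :
    Function.Bijective (stdAutOf (A := A) (K := K)) := by
  constructor
  · rintro ⟨p, r, s⟩ ⟨p', r', s'⟩ h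
    have h1 : ∀ x, (stdAutOf (p, r, s)).1 x = (stdAutOf (p', r', s')).1 x := fun x => by rw [h]
    have hp : p = p' := Equiv.ext fun a => by simpa [stdAutOf] using h1 (Sum.inl a)
    have hrs : ∀ k, r k = r' k ∧ s k = s' k := fun k => by
      simpa [stdAutOf] using h1 (Sum.inr (Sum.inr (Sum.inr (k, 0))))
    rw [hp, Equiv.ext fun k => (hrs k).1, funext fun k => (hrs k).2]
  · rintro ⟨e, h0, hB⟩
    have hinv : ∀ x, e ((stdRot A K).symm x) = (stdRot A K).symm (e x) := fun x => by
      rw [Equiv.eq_symm_apply, ← h0, Equiv.apply_symm_apply]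
    have hp : ∀ a, ∃ b, e (Sum.inl a) = Sum.inl b := fun a => by
      obtain ⟨b, hb⟩ := (hB (Sum.inl a)).2 ⟨a, rfl⟩
      exact ⟨b, hb.symm⟩
    choose p₀ hp₀ using hp
    have hpinj : Function.Injective p₀ := fun a b hab => by
      have h1 : e (Sum.inl a) = e (Sum.inl b) := by rw [hp₀, hp₀, hab]
      exact Sum.inl.inj (e.injective h1)
    have hmid : ∀ a, e (Sum.inr (Sum.inl a)) = Sum.inr (Sum.inl (p₀ a)) := fun a => by
      have := h0 (Sum.inl a)
      rw [hp₀] at this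
      exact this
    have hleg : ∀ a, e (Sum.inr (Sum.inr (Sum.inl a))) = Sum.inr (Sum.inr (Sum.inl (p₀ a))) :=
      fun a => by
        have := h0 (Sum.inr (Sum.inl a))
        rw [hmid] at this
        exact this
    -- If a half-edge of a vertex in `K` were sent to a vertex in `A`, one of its rotations would be
    -- sent into the boundary.
    have hr : ∀ k, ∃ y : K × Fin 3,
        e (Sum.inr (Sum.inr (Sum.inr (k, 0)))) = Sum.inr (Sum.inr (Sum.inr y)) := fun k => by
      rcases h : e (Sum.inr (Sum.inr (Sum.inr (k, 0)))) with a | a | a | y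
      · have := (hB _).1 ⟨a, h.symm⟩
        simp at this
      · have h1 := hinv (Sum.inr (Sum.inr (Sum.inr (k, 0))))
        rw [h] at h1
        have := (hB _).1 ⟨a, h1.symm⟩
        simp [stdRot] at this
      · have h1 := hinv ((stdRot A K).symm (Sum.inr (Sum.inr (Sum.inr (k, 0)))))
        rw [hinv (Sum.inr (Sum.inr (Sum.inr (k, 0)))), h] at h1
        have := (hB _).1 ⟨a, h1.symm⟩
        simp [stdRot] at this
      · exact ⟨y, rfl⟩
    choose y hy using hr
    have hyj : ∀ k j, e (Sum.inr (Sum.inr (Sum.inr (k, j))))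
        = Sum.inr (Sum.inr (Sum.inr ((y k).1, (y k).2 + j))) := fun k j => by
      have h1 : e (Sum.inr (Sum.inr (Sum.inr (k, 0 + 1))))
          = Sum.inr (Sum.inr (Sum.inr ((y k).1, (y k).2 + 1))) := by
        have := h0 (Sum.inr (Sum.inr (Sum.inr (k, 0))))
        rw [hy] at this
        exact this
      have h2 : e (Sum.inr (Sum.inr (Sum.inr (k, 0 + 1 + 1))))
          = Sum.inr (Sum.inr (Sum.inr ((y k).1, (y k).2 + 1 + 1))) := by
        have := h0 (Sum.inr (Sum.inr (Sum.inr (k, 0 + 1))))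
        rw [h1] at this
        exact this
      fin_cases j
      · simpa using hy k
      · exact h1
      · rw [add_assoc (y k).2] at h2; exact h2
    have hrinj : Function.Injective fun k => (y k).1 := fun k k' h => by
      have h1 : e (Sum.inr (Sum.inr (Sum.inr (k, 0))))
          = e (Sum.inr (Sum.inr (Sum.inr (k', (y k).2 - (y k').2)))) := by
        rw [hyj, hyj]
        dsimp only at h
        simp [h]
      have := e.injective h1
      simp only [Sum.inr.injEq, Prod.mk.injEq] at this
      exact this.1
    refine ⟨(Equiv.ofBijective p₀ (Finite.injective_iff_bijective.1 hpinj),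
      Equiv.ofBijective _ (Finite.injective_iff_bijective.1 hrinj), fun k => (y k).2), ?_⟩
    refine Subtype.ext (Equiv.ext ?_)
    rintro (a | a | a | ⟨k, j⟩)
    · exact (hp₀ a).symm
    · exact (hmid a).symm
    · exact (hleg a).symm
    · exact (hyj k j).symm

theorem card_stdAut [Finite A] [Finite K] :
    Nat.card (StdAut A K)
      = (Nat.card A).factorial * ((Nat.card K).factorial * 3 ^ Nat.card K) := by
  rw [← Nat.card_congr (Equiv.ofBijective _ stdAutOf_bijective), Nat.card_prod, Nat.card_prod,
    Nat.card_perm, Nat.card_perm, Nat.card_fun, Nat.card_fin]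

theorem _root_.RibbonGraph.IsTrivalent.card_H {Γ : ColoredRibbonGraph N} (hΓ : Γ.IsTrivalent) :
    Nat.card Γ.H = 3 * Nat.card Γ.Vertex :=
  card_eq_mul_cycleCount hΓ

/-- The half-edge after a boundary half-edge is not in the boundary. -/
theorem σ₀_notMem_B {Γ : ColoredRibbonGraph N} {x : Γ.H} (hx : x ∈ Γ.B) : Γ.σ₀ x ∉ Γ.B := by
  -- `σ₂` restricts to a permutation of the finite set `B`
  have hmaps : Set.MapsTo Γ.σ₂ Γ.B Γ.B := fun y hy => Γ.σ₂_mem_B y hy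
  obtain ⟨⟨y, hy⟩, hyx⟩ := Finite.surjective_of_injective
    (hmaps.restrict_inj.2 Γ.σ₂.injective.injOn) ⟨x, hx⟩
  obtain rfl : Γ.σ₂ y = x := congrArg Subtype.val hyx
  have h : Γ.σ₀ (Γ.σ₂ y) = Γ.σ₁ y := by simp [RibbonGraph.σ₂]
  rw [h]
  exact Γ.σ₁_notMem_B y hy

theorem _root_.RibbonGraph.IsTrivalent.σ₀_σ₀_σ₀ {Γ : ColoredRibbonGraph N} (hΓ : Γ.IsTrivalent) (x : Γ.H) :
    Γ.σ₀ (Γ.σ₀ (Γ.σ₀ x)) = x := by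
  have h := Function.isPeriodicPt_minimalPeriod Γ.σ₀ x
  rwa [hΓ x] at h

theorem _root_.RibbonGraph.IsTrivalent.σ₀_σ₀_notMem_B {Γ : ColoredRibbonGraph N} (hΓ : Γ.IsTrivalent) {x : Γ.H}
    (hx : x ∈ Γ.B) : Γ.σ₀ (Γ.σ₀ x) ∉ Γ.B := fun h =>
  σ₀_notMem_B h (by rwa [hΓ.σ₀_σ₀_σ₀])

/-- The vertex of a half-edge. -/
def vertexOf (Γ : ColoredRibbonGraph N) (x : Γ.H) : Γ.Vertex :=
  Quotient.mk (Equiv.Perm.SameCycle.setoid Γ.σ₀) x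

/-- If `x` is in the boundary, its successor is not, and neither is the third half-edge, whose
successor is `x`. -/
theorem _root_.RibbonGraph.IsTrivalent.eq_of_vertexOf_eq {Γ : ColoredRibbonGraph N} (hΓ : Γ.IsTrivalent) {x y : Γ.H}
    (hx : x ∈ Γ.B) (hy : y ∈ Γ.B) (h : Γ.vertexOf x = Γ.vertexOf y) : x = y := by
  obtain ⟨j, hj, rfl⟩ := Equiv.Perm.SameCycle.exists_iterate_lt hΓ (Quotient.exact h)
  interval_cases j
  · rfl
  · exact absurd hy (σ₀_notMem_B hx)
  · exact absurd hy (hΓ.σ₀_σ₀_notMem_B hx)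

instance (Γ : ColoredRibbonGraph N) : Finite Γ.Vertex := Quotient.finite _

theorem _root_.RibbonGraph.IsTrivalent.card_B_le {Γ : ColoredRibbonGraph N} (hΓ : Γ.IsTrivalent) :
    Nat.card Γ.B ≤ Nat.card Γ.Vertex :=
  Nat.card_le_card_of_injective (fun x : Γ.B => Γ.vertexOf x.1) fun x y h =>
    Subtype.ext (hΓ.eq_of_vertexOf_eq x.2 y.2 h)

/-- Each vertex gets a base half-edge: the boundary half-edge if there is one, an arbitrary one
otherwise. Rotating the base half-edges produces the labeling. -/
theorem _root_.RibbonGraph.IsTrivalent.nonempty_labeling [Finite A] [Finite K] {Γ : ColoredRibbonGraph N}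
    (hΓ : Γ.IsTrivalent) (hA : Nat.card Γ.B = Nat.card A)
    (hK : Nat.card Γ.Vertex = Nat.card A + Nat.card K) : Nonempty (Labeling A K Γ) := by
  classical
  obtain ⟨b⟩ : Nonempty (A ≃ Γ.B) := Finite.card_eq.1 hA.symm
  set β : A → Γ.Vertex := fun a => Γ.vertexOf (b a).1 with hβ
  have hβinj : Function.Injective β := fun x y h =>
    b.injective (Subtype.ext (hΓ.eq_of_vertexOf_eq (b x).2 (b y).2 h))
  have hcompl : Nat.card K = Nat.card {v // v ∉ Set.range β} := by
    have h1 := Nat.card_congr (Equiv.Set.sumCompl (Set.range β))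
    rw [Nat.card_sum, Nat.card_range_of_injective hβinj] at h1
    have h2 : Nat.card {v // v ∉ Set.range β} = Nat.card ↑(Set.range β)ᶜ := rfl
    omega
  obtain ⟨κ⟩ : Nonempty (K ≃ {v // v ∉ Set.range β}) := Finite.card_eq.1 hcompl
  set base : A ⊕ K → Γ.H := Sum.elim (fun a => (b a).1) fun k => Quotient.out (κ k).1 with hbase
  have hcls : ∀ k, Γ.vertexOf (base (Sum.inr k)) = (κ k).1 := fun k => Quotient.out_eq _
  have hbij : Function.Bijective fun i => Γ.vertexOf (base i) := by
    constructor
    · rintro (a | k) (a' | k') h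
      · rw [hβinj h]
      · exact absurd ⟨a, h.trans (hcls k')⟩ (κ k').2
      · exact absurd ⟨a', h.symm.trans (hcls k)⟩ (κ k).2
      · dsimp only at h
        rw [hcls, hcls] at h
        rw [κ.injective (Subtype.ext h)]
    · intro v
      by_cases hv : v ∈ Set.range β
      · obtain ⟨a, rfl⟩ := hv
        exact ⟨Sum.inl a, rfl⟩
      · refine ⟨Sum.inr (κ.symm ⟨v, hv⟩), ?_⟩
        dsimp only
        rw [hcls, Equiv.apply_symm_apply]
  set F : (A ⊕ K) × Fin 3 ≃ Γ.H :=
    Equiv.ofBijective _ (bijective_iterate_of_minimalPeriod hΓ hbij) with hF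
  have hFa : ∀ i j, F (i, j) = Γ.σ₀^[j] (base i) := fun i j => rfl
  refine ⟨(stdHalfEquiv A K).trans F, fun x => ?_, fun x => ?_⟩
  · simp only [Equiv.trans_apply, stdHalfEquiv_stdRot]
    obtain ⟨i, j⟩ := stdHalfEquiv A K x
    rw [hFa, hFa]
    fin_cases j
    · rfl
    · rfl
    · exact (hΓ.σ₀_σ₀_σ₀ _).symm
  · rcases x with a | a | a | ⟨k, j⟩
    · exact iff_of_true (b a).2 ⟨a, rfl⟩
    · exact iff_of_false (σ₀_notMem_B (b a).2) (by simp)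
    · exact iff_of_false (hΓ.σ₀_σ₀_notMem_B (b a).2) (by simp)
    · refine iff_of_false (fun h => (κ k).2 ⟨b.symm ⟨_, h⟩, ?_⟩) (by simp)
      simp only [hβ, Equiv.apply_symm_apply]
      rw [← hcls]
      exact (Quotient.sound (Equiv.Perm.sameCycle_iterate _ _ _)).symm

end ColoredRibbonGraph

/-! ### Weights of standard forms and the sum over isomorphism classes. -/

namespace ColoredRibbonGraph

variable {A K : Type} {N : ℕ}

theorem isTrivalent_of_labeling {Γ : ColoredRibbonGraph N} (e : Labeling A K Γ) :
    Γ.IsTrivalent := fun y => by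
  obtain ⟨x, rfl⟩ := e.1.surjective y
  have : Fact (Nat.Prime 3) := ⟨Nat.prime_three⟩
  have h3 : Function.IsPeriodicPt (stdRot A K) 3 x := by
    have := Function.isPeriodicPt_minimalPeriod (stdRot A K) x
    rwa [minimalPeriod_stdRot] at this
  have hsemi : Function.Semiconj e.1 (stdRot A K) Γ.σ₀ := e.2.1
  refine Function.minimalPeriod_eq_prime (h3.map hsemi) fun h => ?_
  have h1 : stdRot A K x = x := e.1.injective ((e.2.1 x).trans h)
  have h2 := Function.minimalPeriod_eq_one_iff_isFixedPt.2 h1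
  rw [minimalPeriod_stdRot] at h2
  norm_num at h2

theorem card_B_of_labeling {Γ : ColoredRibbonGraph N} (e : Labeling A K Γ) :
    Nat.card Γ.B = Nat.card A := by
  refine (Nat.card_congr (Equiv.ofBijective
    (fun a : A => (⟨e.1 (Sum.inl a), (e.2.2 _).2 ⟨a, rfl⟩⟩ : Γ.B)) ⟨fun a b h => ?_, ?_⟩)).symm
  · exact Sum.inl.inj (e.1.injective (congrArg Subtype.val h))
  · rintro ⟨y, hy⟩
    obtain ⟨x, rfl⟩ := e.1.surjective y
    obtain ⟨a, rfl⟩ := (e.2.2 x).1 hy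
    exact ⟨a, rfl⟩

variable [Finite A] [Finite K]

theorem _root_.RibbonGraph.IsTrivalent.card_labeling {Γ : ColoredRibbonGraph N}
    (hΓ : Γ.IsTrivalent) (hA : Nat.card Γ.B = Nat.card A)
    (hK : Nat.card Γ.Vertex = Nat.card A + Nat.card K) :
    Nat.card (Labeling A K Γ)
      = (Nat.card A).factorial * ((Nat.card K).factorial * 3 ^ Nat.card K) := by
  obtain ⟨f⟩ := hΓ.nonempty_labeling hA hK
  rw [card_labeling_eq_card_stdAut f, card_stdAut]

theorem card_vertex_of_labeling {Γ : ColoredRibbonGraph N} (e : Labeling A K Γ) :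
    Nat.card Γ.Vertex = Nat.card A + Nat.card K := by
  have h1 := (isTrivalent_of_labeling e).card_H
  rw [← Nat.card_congr e.1, card_stdHalf] at h1
  omega

/-- The isomorphism conjugates `π` to the restriction of `σ₂` to `B`. -/
theorem card_boundary_of_iso {Γ : ColoredRibbonGraph N} {g : Gluing A K N} (f : Iso g.toGraph Γ) :
    Nat.card Γ.Boundary = cycleCount g.1.1.1 := by
  have hB : ∀ a, f.toEquiv (Sum.inl a : StdHalf A K) ∈ Γ.B := fun a => (f.map_B _).2 ⟨a, rfl⟩
  have hσ : ∀ a, Γ.σ₂ (f.toEquiv (Sum.inl a : StdHalf A K))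
      = f.toEquiv (Sum.inl (g.1.1.1 a) : StdHalf A K) := fun a => by
    change Γ.σ₀⁻¹ (Γ.σ₁ _) = _
    rw [Equiv.Perm.inv_eq_iff_eq]
    exact (f.map_σ₁ (Sum.inl a : StdHalf A K)).symm.trans
      (f.map_σ₀ (Sum.inl (g.1.1.1 a) : StdHalf A K))
  have hstep : ∀ x, Γ.σ₂.SameCycle x (Γ.σ₂ x) := fun x =>
    Equiv.Perm.sameCycle_apply_right.2 (Equiv.Perm.SameCycle.refl _ _)
  have hBcyc : ∀ {x y}, Γ.σ₂.SameCycle x y → x ∈ Γ.B → y ∈ Γ.B := fun {x y} h hx => by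
    obtain ⟨n, rfl⟩ := h.exists_nat_pow_eq
    rw [← Equiv.Perm.iterate_eq_pow]
    exact Set.MapsTo.iterate (f := Γ.σ₂) (s := Γ.B) (fun z hz => Γ.σ₂_mem_B z hz) n hx
  refine card_eq_cycleCount (e := g.1.1.1) (κ := Γ.Boundary)
    (fun a => ⟨Quotient.mk (Equiv.Perm.SameCycle.setoid Γ.σ₂) (f.toEquiv (Sum.inl a : StdHalf A K)),
      fun x hx => hBcyc (Quotient.exact hx).symm (hB a)⟩) ?_ ?_ ?_
  · rintro ⟨⟨y⟩, hy⟩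
    have hyB : y ∈ Γ.B := hy y rfl
    obtain ⟨x, rfl⟩ := f.toEquiv.surjective y
    obtain ⟨a, rfl⟩ := (f.map_B x).1 hyB
    exact ⟨a, rfl⟩
  · intro a
    refine Subtype.ext (Quotient.sound ?_)
    rw [← hσ]
    exact (hstep _).symm
  · intro a b h
    have h1 : Γ.σ₂.SameCycle _ _ := Quotient.exact (congrArg Subtype.val h)
    obtain ⟨n, hn⟩ := h1.exists_nat_pow_eq
    have h2 : ∀ n : ℕ, Γ.σ₂^[n] (f.toEquiv (Sum.inl a : StdHalf A K))
        = f.toEquiv (Sum.inl (g.1.1.1^[n] a) : StdHalf A K) := fun n => by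
      induction n with
      | zero => rfl
      | succ n ih => rw [Function.iterate_succ_apply', ih, hσ, Function.iterate_succ_apply']
    rw [← Equiv.Perm.iterate_eq_pow, h2] at hn
    have h3 : g.1.1.1^[n] a = b := Sum.inl.inj (f.toEquiv.injective hn)
    rw [← h3]
    exact Equiv.Perm.sameCycle_iterate _ _ _

/-- The square root of the weight of an edge, as a function of its half-edges; for a boundary edge
the weight is split asymmetrically. -/
noncomputable def halfWeight (lam : Fin N → ℝ)
    (d : Equiv.Perm A × (A → Fin N) × (K → Fin 3 → Fin N)) : StdHalf A K → ℂ
  | Sum.inl _ => 2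
  | Sum.inr (Sum.inl a) => (lam (d.2.1 a) : ℂ)⁻¹
  | Sum.inr (Sum.inr x) => (√(2 / (lam (ends d x).1 + lam (ends d x).2)) : ℂ)

/-- The two halves of an edge multiply to its share of `2^|e| ∏ 1/λ̃ₑ`. -/
theorem halfWeight_mul_halfWeight {Γ : ColoredRibbonGraph N} {g : Gluing A K N}
    (f : Iso g.toGraph Γ) {lam : Fin N → ℝ} (hlam : ∀ i, 0 < lam i) (x : StdHalf A K) :
    halfWeight lam g.1.1 x * halfWeight lam g.1.1 (Gluing.flip g.1.1.1 g.1.2 g.2.1 x)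
      = 2 * ((Γ.edgeLambda lam (f.toEquiv x) : ℝ) : ℂ)⁻¹ := by
  have hB : ∀ a, f.toEquiv (Sum.inl a : StdHalf A K) ∈ Γ.B := fun a => (f.map_B _).2 ⟨a, rfl⟩
  have hnB : ∀ x : A ⊕ FreeHalf A K, f.toEquiv (Sum.inr x : StdHalf A K) ∉ Γ.B := fun x h => by
    have := (f.map_B _).1 h
    obtain ⟨a, ha⟩ := this
    exact absurd ha (by simp)
  have hσ : ∀ x : StdHalf A K, Γ.σ₁ (f.toEquiv x)
      = f.toEquiv (Gluing.flip g.1.1.1 g.1.2 g.2.1 x : StdHalf A K) := fun x => (f.map_σ₁ x).symm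
  have hcol : ∀ (y : Γ.H) (hy : y ∉ Γ.B) (x : StdHalf A K), f.toEquiv x = y →
      Γ.color ⟨y, hy⟩ = Gluing.colorFun g.1.1 x := by
    rintro _ hy x rfl
    exact f.map_color x (fun h => hy ((f.map_B x).2 h)) hy
  rcases x with a | a | x
  · rw [edgeLambda, dif_pos (hB a), hcol _ _ _ (hσ _).symm]
    rfl
  · have h1 : Γ.σ₁ (f.toEquiv (Sum.inr (Sum.inl a) : StdHalf A K)) ∈ Γ.B := by
      rw [hσ]; exact hB _
    rw [edgeLambda, dif_neg (hnB _), dif_pos h1, hcol _ _ _ rfl, mul_comm]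
    rfl
  · have h1 : Γ.σ₁ (f.toEquiv (Sum.inr (Sum.inr x) : StdHalf A K)) ∉ Γ.B := by
      rw [hσ]; exact hnB _
    rw [edgeLambda, dif_neg (hnB _), dif_neg h1, hcol _ _ _ rfl, hcol _ _ _ (hσ _).symm]
    change (√(2 / (lam (ends g.1.1 x).1 + lam (ends g.1.1 x).2)) : ℂ)
      * (√(2 / (lam (ends g.1.1 (g.1.2 x)).1 + lam (ends g.1.1 (g.1.2 x)).2)) : ℂ)
      = 2 * ((lam (ends g.1.1 x).1 + lam (ends g.1.1 (g.1.2 x)).1 : ℝ) : ℂ)⁻¹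
    -- Matched half-edges see the same two colors in opposite order, so both carry the same square
    -- root.
    have h2 : (ends g.1.1 x).2 = (ends g.1.1 (g.1.2 x)).1 := by
      have := g.2.2.2 (g.1.2 x)
      rw [g.2.1] at this
      exact this.symm
    rw [h2, ← g.2.2.2 x, add_comm (lam (ends g.1.1 (g.1.2 x)).1), ← Complex.ofReal_mul,
      Real.mul_self_sqrt (div_nonneg zero_le_two (add_pos (hlam _) (hlam _)).le), div_eq_mul_inv]
    push_cast
    rfl

/-- The weight of a graph in standard form, without the order of the automorphism group. -/
noncomputable def Gluing.weight [Fintype A] [Fintype K] (Q : ℂ) (lam : Fin N → ℝ)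
    (g : Gluing A K N) : ℂ :=
  (2 : ℂ)⁻¹ ^ Nat.card K * Q ^ cycleCount g.1.1.1 * (∏ a, (lam (g.1.1.2.1 a) : ℂ)⁻¹)
    * ∏ x : FreeHalf A K, (√(2 / (lam (ends g.1.1 x).1 + lam (ends g.1.1 x).2)) : ℂ)

/-- The product of `halfWeight` over all half-edges is `2^|e| ∏ 1/λ̃ₑ`. The factors `2` on the
boundary half-edges cancel the part of `2^(-|v|)` coming from the boundary vertices, which leaves
`2^(-|K|)`. -/
theorem weight_mul_card_aut [Fintype A] [Fintype K] {Γ : ColoredRibbonGraph N} {g : Gluing A K N}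
    (f : Iso g.toGraph Γ) (Q : ℂ) {lam : Fin N → ℝ} (hlam : ∀ i, 0 < lam i) :
    weight Q lam Γ * Nat.card (Iso Γ Γ) = g.weight Q lam := by
  classical
  have : Fintype Γ.H := Fintype.ofFinite _
  let hE : Fintype (Quotient (Equiv.Perm.SameCycle.setoid Γ.σ₁)) := Fintype.ofFinite _
  let hE' : Fintype Γ.Edge := hE
  have haut : (Nat.card (Iso Γ Γ) : ℂ) ≠ 0 := by exact_mod_cast (card_aut_pos Γ).ne'
  have hprod : ∏ x : StdHalf A K, halfWeight lam g.1.1 x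
      = 2 ^ Nat.card Γ.Edge * ∏ᶠ c : Γ.Edge, ((Γ.edgeLambda lam (Quotient.out c) : ℝ) : ℂ)⁻¹ := by
    have h1 : ∏ x : StdHalf A K, halfWeight lam g.1.1 x
        = ∏ y : Γ.H, halfWeight lam g.1.1 (f.toEquiv.symm y) :=
      (Equiv.prod_comp (ι := Γ.H) (κ := StdHalf A K) f.toEquiv.symm
        (fun x => halfWeight lam g.1.1 x)).symm
    have h2 := prod_eq_prod_cycles_of_involutive Γ.σ₁_involutive Γ.σ₁_ne
      (fun y => halfWeight lam g.1.1 (f.toEquiv.symm y))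
    have h3 : ∀ y : Γ.H, halfWeight lam g.1.1 (f.toEquiv.symm y)
        * halfWeight lam g.1.1 (f.toEquiv.symm (Γ.σ₁ y))
        = 2 * ((Γ.edgeLambda lam y : ℝ) : ℂ)⁻¹ := fun y => by
      obtain ⟨x, rfl⟩ := f.toEquiv.surjective y
      have h4 : Γ.σ₁ (f.toEquiv x) = f.toEquiv (g.toGraph.σ₁ x) := (f.map_σ₁ x).symm
      rw [h4, Equiv.symm_apply_apply, Equiv.symm_apply_apply]
      exact halfWeight_mul_halfWeight f hlam x
    simp only [h3] at h2
    rw [h1, h2, Finset.prod_mul_distrib, Finset.prod_const, Finset.card_univ,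
      ← Nat.card_eq_fintype_card]
    congr 1
    exact (finprod_eq_prod_of_fintype
      fun c : Γ.Edge => ((Γ.edgeLambda lam (Quotient.out c) : ℝ) : ℂ)⁻¹).symm
  have hV : Nat.card Γ.Vertex = Nat.card A + Nat.card K := card_vertex_of_labeling (labelingOfIso ⟨g, f⟩)
  have e1 : weight Q lam Γ * Nat.card (Iso Γ Γ)
      = (2 ^ Nat.card Γ.Edge * ∏ᶠ c : Γ.Edge, ((Γ.edgeLambda lam (Quotient.out c) : ℝ) : ℂ)⁻¹)
        * Q ^ Nat.card Γ.Boundary / 2 ^ Nat.card Γ.Vertex := by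
    rw [weight, zpow_sub₀ two_ne_zero, zpow_natCast, zpow_natCast]
    field_simp
  rw [e1, ← hprod, card_boundary_of_iso f, hV, Fintype.prod_sum_type, Fintype.prod_sum_type]
  simp only [halfWeight, Finset.prod_const, Finset.card_univ, Gluing.weight,
    Nat.card_eq_fintype_card]
  rw [pow_add, inv_pow]
  field_simp

/-- The standard forms of the trivalent graphs with `n` vertices. -/
abbrev GluingsOfCard (N n : ℕ) : Type :=
  Σ x : (Finset.HasAntidiagonal.antidiagonal n : Finset (ℕ × ℕ)), Gluing (Fin x.1.1) (Fin x.1.2) N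

/-- The isomorphism class of a graph in standard form. -/
def GluingsOfCard.toClass {n : ℕ} (t : GluingsOfCard N n) : IsoClass N :=
  Quotient.mk _ t.2.toGraph

theorem GluingsOfCard.nonempty_iso {n : ℕ} (t : GluingsOfCard N n) :
    Nonempty (Iso t.2.toGraph t.toClass.out) :=
  Quotient.exact (Quotient.out_eq t.toClass).symm

theorem GluingsOfCard.toClass_eq_iff {n : ℕ} (t : GluingsOfCard N n) (q : IsoClass N) :
    t.toClass = q ↔ Nonempty (Iso t.2.toGraph q.out) := by
  constructor
  · rintro rfl; exact t.nonempty_iso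
  · intro h
    rw [← Quotient.out_eq q]
    exact Quotient.sound h

/-- A vertex has at most one boundary half-edge, so `|B| ≤ n`, and the graph has a standard form
with `|B|` vertices on the boundary and `n - |B|` others. Finiteness of the set of classes follows,
as `GluingsOfCard N n` is finite. -/
theorem range_toClass (N n : ℕ) :
    Set.range (GluingsOfCard.toClass (N := N) (n := n)) = trivalentClasses N n := by
  ext q
  constructor
  · rintro ⟨t, rfl⟩
    obtain ⟨f⟩ := t.nonempty_iso
    have e := labelingOfIso ⟨t.2, f⟩
    refine ⟨isTrivalent_of_labeling e, ?_⟩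
    rw [card_vertex_of_labeling e, Nat.card_fin, Nat.card_fin]
    exact Finset.HasAntidiagonal.mem_antidiagonal.1 t.1.2
  · rintro ⟨h3, hn⟩
    have hle := h3.card_B_le
    rw [hn] at hle
    set m := Nat.card q.out.B with hm
    have hmem : (m, n - m) ∈ Finset.HasAntidiagonal.antidiagonal n :=
      Finset.HasAntidiagonal.mem_antidiagonal.2 (Nat.add_sub_cancel' hle)
    obtain ⟨e⟩ := h3.nonempty_labeling (A := Fin m) (K := Fin (n - m)) (by rw [Nat.card_fin])
      (by rw [hn, Nat.card_fin, Nat.card_fin, Nat.add_sub_cancel' hle])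
    obtain ⟨⟨g, f⟩, -⟩ := labelingOfIso_surjective e
    refine ⟨⟨⟨(m, n - m), hmem⟩, g⟩, ?_⟩
    rw [GluingsOfCard.toClass_eq_iff]
    exact ⟨f⟩

theorem finite_trivalentClasses (N n : ℕ) : (trivalentClasses N n).Finite := by
  rw [← range_toClass]
  exact Set.finite_range _

-- By the two counts of labelings, the number of gluings in the class `q`, times `|Aut q|`, is `m!
-- k! 3ᵏ`; each of them has weight `|Aut q|` times that of `q`.
open Classical in
theorem weight_out_eq_sum [∀ m k, Fintype (Gluing (Fin m) (Fin k) N)] (Q : ℂ) {lam : Fin N → ℝ}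
    (hlam : ∀ i, 0 < lam i) {n : ℕ} {q : IsoClass N} (hq : q ∈ trivalentClasses N n) :
    weight Q lam q.out = ∑ t : GluingsOfCard N n, if t.toClass = q then
      t.2.weight Q lam / ((t.1.1.1.factorial : ℂ) * (t.1.1.2.factorial * 3 ^ t.1.1.2)) else 0 := by
  rw [← range_toClass] at hq
  obtain ⟨t₀, ht₀⟩ := hq
  rw [GluingsOfCard.toClass_eq_iff] at ht₀
  obtain ⟨f₀⟩ := ht₀
  have haut : (Nat.card (Iso q.out q.out) : ℂ) ≠ 0 := by exact_mod_cast (card_aut_pos _).ne'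
  have e₀ := labelingOfIso ⟨t₀.2, f₀⟩
  have hlab := (isTrivalent_of_labeling e₀).card_labeling (card_B_of_labeling e₀)
    (card_vertex_of_labeling e₀)
  rw [card_labeling_eq_sum] at hlab
  simp only [Nat.card_fin] at hlab
  have hiso : ∀ g : Gluing (Fin t₀.1.1.1) (Fin t₀.1.1.2) N, (Nat.card (Iso g.toGraph q.out) : ℂ)
      = if Nonempty (Iso g.toGraph q.out) then (Nat.card (Iso q.out q.out) : ℂ) else 0 := fun g => by
    split_ifs with h
    · obtain ⟨f⟩ := h
      rw [card_iso_eq_card_aut f]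
    · rw [not_nonempty_iff] at h
      simp
  have hsum : (t₀.1.1.1.factorial : ℂ) * (t₀.1.1.2.factorial * 3 ^ t₀.1.1.2)
      = ∑ g : Gluing (Fin t₀.1.1.1) (Fin t₀.1.1.2) N,
        if Nonempty (Iso g.toGraph q.out) then (Nat.card (Iso q.out q.out) : ℂ) else 0 := by
    simp_rw [← hiso]
    exact_mod_cast hlab.symm
  have hpos : (t₀.1.1.1.factorial : ℂ) * (t₀.1.1.2.factorial * 3 ^ t₀.1.1.2) ≠ 0 := by
    have h1 := t₀.1.1.1.factorial_ne_zero
    have h2 := t₀.1.1.2.factorial_ne_zero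
    exact_mod_cast mul_ne_zero h1 (mul_ne_zero h2 (pow_ne_zero _ three_ne_zero))
  rw [show (∑ t : GluingsOfCard N n, if t.toClass = q then
      t.2.weight Q lam / ((t.1.1.1.factorial : ℂ) * (t.1.1.2.factorial * 3 ^ t.1.1.2)) else 0)
      = ∑ x : (Finset.HasAntidiagonal.antidiagonal n : Finset (ℕ × ℕ)), ∑ g : Gluing (Fin x.1.1) (Fin x.1.2) N, if Nonempty (Iso g.toGraph q.out) then
        g.weight Q lam / ((x.1.1.factorial : ℂ) * (x.1.2.factorial * 3 ^ x.1.2)) else 0 from ?_,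
    Finset.sum_eq_single t₀.1]
  · have h1 : ∀ g : Gluing (Fin t₀.1.1.1) (Fin t₀.1.1.2) N,
        (if Nonempty (Iso g.toGraph q.out) then g.weight Q lam
          / ((t₀.1.1.1.factorial : ℂ) * (t₀.1.1.2.factorial * 3 ^ t₀.1.1.2)) else 0)
        = weight Q lam q.out / ((t₀.1.1.1.factorial : ℂ) * (t₀.1.1.2.factorial * 3 ^ t₀.1.1.2))
          * (if Nonempty (Iso g.toGraph q.out) then (Nat.card (Iso q.out q.out) : ℂ) else 0) :=
      fun g => by
        split_ifs with h
        · obtain ⟨f⟩ := h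
          rw [← weight_mul_card_aut f Q hlam]
          ring
        · simp
    simp_rw [h1]
    rw [← Finset.mul_sum, ← hsum, div_mul_cancel₀ _ hpos]
  -- The class fixes `m` as the number of boundary half-edges, and then `k = n - m`, so only one
  -- summand survives.
  · intro x _ hx
    refine Finset.sum_eq_zero fun g _ => if_neg ?_
    rintro ⟨f⟩
    apply hx
    have e := labelingOfIso ⟨g, f⟩
    have h1 := (card_B_of_labeling e).symm.trans (card_B_of_labeling e₀)
    have h2 := Finset.HasAntidiagonal.mem_antidiagonal.1 x.2
    have h3 := Finset.HasAntidiagonal.mem_antidiagonal.1 t₀.1.2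
    rw [Nat.card_fin, Nat.card_fin] at h1
    refine Subtype.ext (Prod.ext h1 ?_)
    omega
  · intro h; exact absurd (Finset.mem_univ _) h
  · simp_rw [GluingsOfCard.toClass_eq_iff]
    rw [← Finset.univ_sigma_univ, Finset.sum_sigma]

/-- The sum over trivalent graphs as a sum over standard forms. -/
theorem graphSum_eq_sum [∀ m k, Fintype (Gluing (Fin m) (Fin k) N)] (Q : ℂ) {lam : Fin N → ℝ}
    (hlam : ∀ i, 0 < lam i) (n : ℕ) :
    graphSum Q lam n = ∑ x ∈ Finset.HasAntidiagonal.antidiagonal n,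
      (∑ g : Gluing (Fin x.1) (Fin x.2) N, g.weight Q lam)
        / ((x.1.factorial : ℂ) * (x.2.factorial * 3 ^ x.2)) := by
  classical
  rw [graphSum, finsum_mem_eq_finite_toFinset_sum _ (finite_trivalentClasses N n),
    Finset.sum_congr rfl fun q hq => weight_out_eq_sum Q hlam ((Set.Finite.mem_toFinset _).1 hq),
    Finset.sum_comm]
  have h1 : ∀ t : GluingsOfCard N n, t.toClass ∈ (finite_trivalentClasses N n).toFinset := fun t => by
    rw [Set.Finite.mem_toFinset, ← range_toClass]
    exact ⟨t, rfl⟩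
  simp only [Finset.sum_ite_eq, h1, if_true]
  rw [← Finset.sum_coe_sort (Finset.HasAntidiagonal.antidiagonal n)]
  simp_rw [Finset.sum_div]
  exact Fintype.sum_sigma (fun t : GluingsOfCard N n => t.2.weight Q lam
    / ((t.1.1.1.factorial : ℂ) * (t.1.1.2.factorial * 3 ^ t.1.1.2)))

end ColoredRibbonGraph

/-! ### Gaussian averages as sums over gluings. -/

namespace KontsevichPenner

open ColoredRibbonGraph

variable {N : ℕ}

theorem trace_pow_three_eq_sum (X : Matrix (Fin N) (Fin N) ℂ) :
    (X ^ 3).trace = ∑ c : Fin 3 → Fin N, ∏ j, X (c j) (c (j - 1)) := by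
  let e : (Fin 3 → Fin N) ≃ Fin N × Fin N × Fin N :=
    -- The factors `X (c j) (c (j - 1))` run through the cycle in the order `0, 2, 1`; the
    -- decreasing index agrees with `ends`.
    { toFun := fun c => (c 0, c 2, c 1)
      invFun := fun p => ![p.1, p.2.2, p.2.1]
      left_inv := fun c => by funext j; fin_cases j <;> rfl
      right_inv := fun p => rfl }
  rw [Fintype.sum_equiv e _ (fun p => X p.1 p.2.1 * (X p.2.1 p.2.2 * X p.2.2 p.1)),
    Fintype.sum_prod_type]
  · simp only [pow_succ, pow_zero, one_mul, Matrix.trace, Matrix.diag_apply, Matrix.mul_apply,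
      Fintype.sum_prod_type, Finset.sum_mul]
    refine Finset.sum_congr rfl fun i _ => ?_
    rw [Finset.sum_comm]
    refine Finset.sum_congr rfl fun j _ => Finset.sum_congr rfl fun k _ => by ring
  · intro c
    rw [Fin.prod_univ_three]
    change X (c 0) (c 2) * X (c 1) (c 0) * X (c 2) (c 1)
      = X (c 0) (c 2) * (X (c 2) (c 1) * X (c 1) (c 0))
    ring

theorem Lam_inv {lam : Fin N → ℝ} (h : ∀ i, 0 < lam i) :
    (Lam lam)⁻¹ = Matrix.diagonal fun i => (lam i : ℂ)⁻¹ := by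
  refine Matrix.inv_eq_right_inv ?_
  rw [Lam, Matrix.diagonal_mul_diagonal, ← Matrix.diagonal_one]
  congr 1
  funext i
  have : (lam i : ℂ) ≠ 0 := by exact_mod_cast (h i).ne'
  exact mul_inv_cancel₀ this

/-- The summation indices of the traces are the corner colors, and the entries of `X` sit at the
free half-edges. -/
theorem permSum_mul_trace_pow_eq (Q : ℂ) {lam : Fin N → ℝ} (h : ∀ i, 0 < lam i) (m k : ℕ)
    (X : Matrix (Fin N) (Fin N) ℂ) :
    permSum Q (fun _ : Fin m => -((Lam lam)⁻¹ * X)) * (X ^ 3).trace ^ k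
      = ∑ d : Equiv.Perm (Fin m) × (Fin m → Fin N) × (Fin k → Fin 3 → Fin N),
        ((-1) ^ m * Q ^ cycleCount d.1 * ∏ a, (lam (d.2.1 a) : ℂ)⁻¹)
          * ∏ x : FreeHalf (Fin m) (Fin k), X (ends d x).1 (ends d x).2 := by
  rw [trace_pow_three_eq_sum, Fintype.sum_pow, permSum, Fintype.sum_prod_type, Finset.sum_mul]
  refine Finset.sum_congr rfl fun π _ => ?_
  rw [Fintype.sum_prod_type, mul_assoc, Finset.sum_mul, Finset.mul_sum]
  refine Finset.sum_congr rfl fun i _ => ?_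
  rw [Finset.mul_sum, Finset.mul_sum]
  refine Finset.sum_congr rfl fun c _ => ?_
  have h1 : ∏ a, (-((Lam lam)⁻¹ * X)) (i (π a)) (i a)
      = (-1) ^ m * (∏ a, (lam (i a) : ℂ)⁻¹) * ∏ a, X (i (π a)) (i a) := by
    -- `Λ⁻¹` acts on the row index `i (π a)`; reindexing by `π` removes the shift from the product.
    rw [← Equiv.prod_comp π fun a => (lam (i a) : ℂ)⁻¹, mul_assoc, ← Finset.prod_mul_distrib]
    simp only [Matrix.neg_apply, Lam_inv h, Matrix.diagonal_mul]
    rw [Finset.prod_neg]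
    simp
  rw [h1, Fintype.prod_sum_type, Fintype.prod_prod_type]
  simp only [ends]
  ring

/-- A matching that violates a color condition has a vanishing `halfProp` factor, so the Wick sum
reduces to gluings. -/
theorem sum_gluing_weight (Q : ℂ) (lam : Fin N → ℝ) (m k : ℕ)
    [Fintype (Gluing (Fin m) (Fin k) N)] :
    ∑ g : Gluing (Fin m) (Fin k) N, g.weight Q lam
      = ∑ d : Equiv.Perm (Fin m) × (Fin m → Fin N) × (Fin k → Fin 3 → Fin N),
        ((2 : ℂ)⁻¹ ^ k * Q ^ cycleCount d.1 * ∏ a, (lam (d.2.1 a) : ℂ)⁻¹)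
          * ∑ τ ∈ matchings (Finset.univ : Finset (FreeHalf (Fin m) (Fin k))),
            ∏ x, halfProp lam (ends d x) (ends d (τ x)) := by
  classical
  set F : (Equiv.Perm (Fin m) × (Fin m → Fin N) × (Fin k → Fin 3 → Fin N))
      × Equiv.Perm (FreeHalf (Fin m) (Fin k)) → ℂ := fun g =>
    ((2 : ℂ)⁻¹ ^ k * Q ^ cycleCount g.1.1 * ∏ a, (lam (g.1.2.1 a) : ℂ)⁻¹)
      * ∏ x : FreeHalf (Fin m) (Fin k), (√(2 / (lam (ends g.1 x).1 + lam (ends g.1 x).2)) : ℂ)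
    with hF
  have h1 : ∀ g : Gluing (Fin m) (Fin k) N, g.weight Q lam = F g.1 := fun g => by
    rw [Gluing.weight, Nat.card_fin]
  rw [Finset.sum_congr rfl fun g _ => h1 g, ← Finset.sum_subtype (Finset.univ.filter fun g =>
    (∀ x, g.2 (g.2 x) = x) ∧ (∀ x, g.2 x ≠ x) ∧ ∀ x, (ends g.1 x).1 = (ends g.1 (g.2 x)).2)
    (fun g => by rw [Finset.mem_filter, and_iff_right (Finset.mem_univ g)]) F,
    Finset.sum_filter, Fintype.sum_prod_type]
  simp only [hF]
  refine Finset.sum_congr rfl fun d _ => ?_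
  rw [Finset.mul_sum, ← Finset.sum_filter_add_sum_filter_not (matchings Finset.univ)
    (fun τ => ∀ x, (ends d x).1 = (ends d (τ x)).2), ← Finset.sum_filter]
  have h2 : ∑ τ ∈ matchings Finset.univ with ¬ ∀ x, (ends d x).1 = (ends d (τ x)).2,
      ((2 : ℂ)⁻¹ ^ k * Q ^ cycleCount d.1 * ∏ a, (lam (d.2.1 a) : ℂ)⁻¹)
        * ∏ x, halfProp lam (ends d x) (ends d (τ x)) = 0 := by
    refine Finset.sum_eq_zero fun τ hτ => ?_
    obtain ⟨x, hx⟩ := not_forall.1 (Finset.mem_filter.1 hτ).2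
    rw [Finset.prod_eq_zero (Finset.mem_univ x) (if_neg hx), mul_zero]
  rw [h2, add_zero]
  refine Finset.sum_congr ?_ fun τ hτ => ?_
  · ext τ
    rw [Finset.mem_filter, Finset.mem_filter, mem_matchings, and_iff_right (Finset.mem_univ τ)]
    simp only [Finset.mem_univ, iff_true, and_assoc]
  · congr 1
    refine Finset.prod_congr rfl fun x _ => ?_
    exact (if_pos ((Finset.mem_filter.1 hτ).2 x)).symm

/-- A matching of the `m + 3k` free half-edges requires `m + k` to be even; otherwise the sum is
empty. So the signs from `-Λ⁻¹X` and `-Tr X³/3!` disappear. -/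
theorem neg_one_pow_mul_sum_gluing_weight (Q : ℂ) (lam : Fin N → ℝ) (m k : ℕ)
    [Fintype (Gluing (Fin m) (Fin k) N)] :
    (-1) ^ (m + k) * ∑ g : Gluing (Fin m) (Fin k) N, g.weight Q lam
      = ∑ g : Gluing (Fin m) (Fin k) N, g.weight Q lam := by
  rw [Finset.mul_sum]
  refine Finset.sum_congr rfl fun g _ => ?_
  have h := card_eq_mul_cycleCount (minimalPeriod_eq_two g.2.1 g.2.2.1)
  rw [Nat.card_sum, Nat.card_prod, Nat.card_fin, Nat.card_fin, Nat.card_fin] at h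
  rw [Even.neg_one_pow (by rw [Nat.even_iff]; omega), one_mul]

theorem integrable_sum_mul_gaussian {κ : Type*} (s : Finset κ) (lam : Fin N → ℝ)
    (f : κ → Matrix (Fin N) (Fin N) ℂ → ℂ)
    (hf : ∀ k ∈ s, Integrable fun u => f k (hermitian u) * gaussian lam (hermitian u)) :
    Integrable fun u => (∑ k ∈ s, f k (hermitian u)) * gaussian lam (hermitian u) := by
  simp_rw [Finset.sum_mul]
  exact integrable_finsetSum _ hf

theorem integrable_const_mul_mul_gaussian {lam : Fin N → ℝ} (z : ℂ)
    {f : Matrix (Fin N) (Fin N) ℂ → ℂ}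
    (hf : Integrable fun u => f (hermitian u) * gaussian lam (hermitian u)) :
    Integrable fun u => (z * f (hermitian u)) * gaussian lam (hermitian u) := by
  simp_rw [mul_assoc]
  exact hf.const_mul z

/-- The contribution of a coloring to the expansion, as a monomial in the matrix entries. -/
noncomputable def monomial (Q : ℂ) (lam : Fin N → ℝ) {m k : ℕ}
    (d : Equiv.Perm (Fin m) × (Fin m → Fin N) × (Fin k → Fin 3 → Fin N))
    (X : Matrix (Fin N) (Fin N) ℂ) : ℂ :=
  ((-1) ^ m * Q ^ cycleCount d.1 * ∏ a, (lam (d.2.1 a) : ℂ)⁻¹)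
    * ∏ y : FreeHalf (Fin m) (Fin k), X (ends d y).1 (ends d y).2

theorem integrable_monomial (Q : ℂ) {lam : Fin N → ℝ} (h : ∀ i, 0 < lam i) {m k : ℕ}
    (d : Equiv.Perm (Fin m) × (Fin m → Fin N) × (Fin k → Fin 3 → Fin N)) :
    Integrable fun u => monomial Q lam d (hermitian u) * gaussian lam (hermitian u) :=
  integrable_const_mul_mul_gaussian
    (f := fun X => ∏ y : FreeHalf (Fin m) (Fin k), X (ends d y).1 (ends d y).2) _
    (integrable_prod_hermitian_mul_gaussian h (ends d))

/-- The part of the expansion that comes from graphs with `m` vertices on the boundary and `k`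
other vertices. -/
noncomputable def partCoeff (Q : ℂ) (lam : Fin N → ℝ) (m k : ℕ)
    (X : Matrix (Fin N) (Fin N) ℂ) : ℂ :=
  ((-1 / 6) ^ k / ((m.factorial : ℂ) * k.factorial)) *
    ∑ d : Equiv.Perm (Fin m) × (Fin m → Fin N) × (Fin k → Fin 3 → Fin N), monomial Q lam d X

theorem integrable_partCoeff (Q : ℂ) {lam : Fin N → ℝ} (h : ∀ i, 0 < lam i) (m k : ℕ) :
    Integrable fun u => partCoeff Q lam m k (hermitian u) * gaussian lam (hermitian u) :=
  integrable_const_mul_mul_gaussian (f := fun X => ∑ d, monomial Q lam d X) _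
    (integrable_sum_mul_gaussian Finset.univ lam (fun d X => monomial Q lam d X)
      fun d _ => integrable_monomial Q h d)

theorem average_partCoeff (Q : ℂ) {lam : Fin N → ℝ} (h : ∀ i, 0 < lam i) (m k : ℕ)
    [Fintype (Gluing (Fin m) (Fin k) N)] :
    average lam (partCoeff Q lam m k) = (∑ g : Gluing (Fin m) (Fin k) N, g.weight Q lam)
      / ((m.factorial : ℂ) * (k.factorial * 3 ^ k)) := by
  have e1 : average lam (partCoeff Q lam m k) = _ :=
    average_const_mul lam _ (fun X => ∑ d, monomial Q lam d X)
  rw [e1, average_sum Finset.univ lam (fun d X => monomial Q lam d X)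
      fun d _ => integrable_monomial Q h d, ← neg_one_pow_mul_sum_gluing_weight, sum_gluing_weight,
    Finset.mul_sum, Finset.mul_sum, Finset.sum_div]
  refine Finset.sum_congr rfl fun d _ => ?_
  have e2 : average lam (monomial Q lam d) = _ := average_const_mul lam _
    (fun X => ∏ y : FreeHalf (Fin m) (Fin k), X (ends d y).1 (ends d y).2)
  have e3 : average lam (fun X => monomial Q lam d X) = average lam (monomial Q lam d) := rfl
  rw [e3, e2, average_prod h]
  have h1 : ((m.factorial : ℕ) : ℂ) ≠ 0 := by exact_mod_cast m.factorial_ne_zero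
  have h2 : ((k.factorial : ℕ) : ℂ) ≠ 0 := by exact_mod_cast k.factorial_ne_zero
  -- Of each `1/3!`, the factor `1/2` belongs to the weight of the graph and the factor `1/3` to the
  -- rotations of the vertex.
  have h3 : (-1 / 6 : ℂ) ^ k = (-1) ^ k * (2 : ℂ)⁻¹ ^ k / 3 ^ k := by
    rw [← mul_pow, ← div_pow]; norm_num
  rw [h3, pow_add]
  field_simp

theorem expansionCoeff_eq_sum_partCoeff (Q : ℂ) {lam : Fin N → ℝ} (h : ∀ i, 0 < lam i) (n : ℕ)
    (X : Matrix (Fin N) (Fin N) ℂ) :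
    expansionCoeff Q lam n X
      = ∑ x ∈ Finset.HasAntidiagonal.antidiagonal n, partCoeff Q lam x.1 x.2 X := by
  rw [expansionCoeff_eq_sum]
  refine Finset.sum_congr rfl fun x _ => ?_
  simp only [partCoeff, monomial]
  rw [← permSum_mul_trace_pow_eq Q h, show -(X ^ 3).trace / 6 = (-1 / 6) * (X ^ 3).trace by ring,
    mul_pow]
  ring

theorem integrable_expansionCoeff (Q : ℂ) {lam : Fin N → ℝ} (h : ∀ i, 0 < lam i) (n : ℕ) :
    Integrable fun u => expansionCoeff Q lam n (hermitian u) * gaussian lam (hermitian u) := by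
  simp_rw [expansionCoeff_eq_sum_partCoeff Q h]
  exact integrable_sum_mul_gaussian _ lam (fun x : ℕ × ℕ => partCoeff Q lam x.1 x.2)
    fun x _ => integrable_partCoeff Q h x.1 x.2

theorem average_expansionCoeff (Q : ℂ) {lam : Fin N → ℝ} (h : ∀ i, 0 < lam i) (n : ℕ) :
    average lam (expansionCoeff Q lam n) = graphSum Q lam n := by
  classical
  have : ∀ m k, Fintype (Gluing (Fin m) (Fin k) N) := fun m k => Fintype.ofFinite _
  rw [graphSum_eq_sum Q h, show expansionCoeff Q lam n = _ from
    funext fun X => expansionCoeff_eq_sum_partCoeff Q h n X,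
    average_sum _ lam (fun x : ℕ × ℕ => partCoeff Q lam x.1 x.2)
      fun x _ => integrable_partCoeff Q h x.1 x.2]
  exact Finset.sum_congr rfl fun x _ => average_partCoeff Q h x.1 x.2

end KontsevichPenner

/-! ### Estimates for the exponential of a power series -/

namespace PowerSeries

variable {w : ℝ} {f g : PowerSeries ℂ}

theorem norm_coeff_mul_le {F G : ℝ} (hw : 0 ≤ w) (hF : 0 ≤ F)
    {n : ℕ} (hf : ∀ k ≤ n, ‖coeff k f‖ ≤ F * w ^ k) (hg : ∀ k ≤ n, ‖coeff k g‖ ≤ G * w ^ k) :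
    ‖coeff n (f * g)‖ ≤ (n + 1) * (F * G) * w ^ n := by
  rw [coeff_mul]
  refine (norm_sum_le_of_le _ (n := fun _ => F * G * w ^ n) fun x hx => ?_).trans ?_
  · rw [norm_mul]
    have h1 := hf x.1 (Finset.HasAntidiagonal.antidiagonal.fst_le hx)
    have h2 := hg x.2 (Finset.HasAntidiagonal.antidiagonal.snd_le hx)
    calc ‖coeff x.1 f‖ * ‖coeff x.2 g‖ ≤ (F * w ^ x.1) * (G * w ^ x.2) :=
          mul_le_mul h1 h2 (norm_nonneg _) (by positivity)
      _ = F * G * w ^ (x.1 + x.2) := by rw [pow_add]; ring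
      _ = F * G * w ^ n := by rw [Finset.HasAntidiagonal.mem_antidiagonal.1 hx]
  · rw [Finset.sum_const, Finset.Nat.card_antidiagonal, nsmul_eq_mul]
    push_cast
    exact le_of_eq (by ring)

theorem norm_coeff_pow_le {B : ℝ} (hB : 0 ≤ B) (hw : 0 ≤ w)
    (hf : ∀ k, ‖coeff k f‖ ≤ B * w ^ k) {n₀ : ℕ} (r n : ℕ) (hn : n ≤ n₀) :
    ‖coeff n (f ^ r)‖ ≤ ((n₀ + 1) * B) ^ r * w ^ n := by
  induction r generalizing n with
  | zero =>
    rw [pow_zero, pow_zero, one_mul, coeff_one]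
    split_ifs with h
    · simp [h]
    · simpa using pow_nonneg hw n
  | succ r ih =>
    rw [pow_succ]
    refine (norm_coeff_mul_le hw (F := ((n₀ + 1) * B) ^ r) (by positivity)
      (fun k hk => ih k (hk.trans hn)) fun k _ => hf k).trans ?_
    have h1 : ((n : ℝ) + 1) ≤ n₀ + 1 := by exact_mod_cast Nat.succ_le_succ hn
    calc ((n : ℝ) + 1) * (((n₀ + 1) * B) ^ r * B) * w ^ n
        ≤ ((n₀ : ℝ) + 1) * (((n₀ + 1) * B) ^ r * B) * w ^ n := by gcongr
      _ = ((n₀ + 1) * B) ^ (r + 1) * w ^ n := by ring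

theorem exists_norm_coeff_expSeries_le {B : ℝ} (hB : 0 ≤ B) (n : ℕ) :
    ∃ C : ℝ, 0 ≤ C ∧ ∀ (w : ℝ) (f : PowerSeries ℂ), 0 ≤ w → (∀ k, ‖coeff k f‖ ≤ B * w ^ k) →
      ‖coeff n (expSeries f)‖ ≤ C * w ^ n := by
  refine ⟨∑ r ∈ Finset.range (n + 1), ((n + 1) * B) ^ r, Finset.sum_nonneg fun _ _ => by positivity,
    fun w f hw hf => ?_⟩
  rw [expSeries, coeff_mk, Finset.sum_mul]
  refine norm_sum_le_of_le _ fun r _ => ?_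
  rw [norm_div, Complex.norm_natCast]
  refine (div_le_self (norm_nonneg _) ?_).trans (norm_coeff_pow_le hB hw hf r n le_rfl)
  exact_mod_cast r.factorial_pos

/-- The sum of the first `n₀` coefficients. -/
noncomputable def partialSum (n₀ : ℕ) (f : PowerSeries ℂ) : ℂ := ∑ n ∈ Finset.range n₀, coeff n f

/-- The difference consists of the products of total degree at least `n₀`; there are at most `n₀²`
of them. -/
theorem norm_partialSum_mul_sub_le {F G : ℝ} (hF : 0 ≤ F) (hG : 0 ≤ G) (hw : 0 ≤ w) (hw1 : w ≤ 1)
    {n₀ : ℕ} (hf : ∀ k ≤ n₀, ‖coeff k f‖ ≤ F * w ^ k) (hg : ∀ k ≤ n₀, ‖coeff k g‖ ≤ G * w ^ k) :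
    ‖partialSum n₀ f * partialSum n₀ g - partialSum n₀ (f * g)‖ ≤ n₀ ^ 2 * (F * G) * w ^ n₀ := by
  set P := Finset.range n₀ ×ˢ Finset.range n₀ with hP
  have h1 : partialSum n₀ f * partialSum n₀ g = ∑ x ∈ P, coeff x.1 f * coeff x.2 g := by
    rw [partialSum, partialSum, Finset.sum_mul_sum, Finset.sum_product]
  have h2 : partialSum n₀ (f * g) = ∑ x ∈ P with x.1 + x.2 < n₀, coeff x.1 f * coeff x.2 g := by
    rw [partialSum, ← Finset.sum_fiberwise_of_maps_to (g := fun x : ℕ × ℕ => x.1 + x.2)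
      (t := Finset.range n₀) fun x hx => Finset.mem_range.2 (Finset.mem_filter.1 hx).2]
    refine Finset.sum_congr rfl fun n hn => ?_
    rw [coeff_mul]
    refine Finset.sum_congr ?_ fun _ _ => rfl
    ext x
    simp only [Finset.HasAntidiagonal.mem_antidiagonal, Finset.mem_filter, hP, Finset.mem_product,
      Finset.mem_range] at hn ⊢
    omega
  rw [h1, h2, ← Finset.sum_filter_add_sum_filter_not P (fun x => x.1 + x.2 < n₀),
    add_sub_cancel_left]
  refine (norm_sum_le_of_le _ (n := fun _ => F * G * w ^ n₀) fun x hx => ?_).trans ?_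
  · simp only [hP, Finset.mem_filter, Finset.mem_product, Finset.mem_range, not_lt] at hx
    rw [norm_mul]
    calc ‖coeff x.1 f‖ * ‖coeff x.2 g‖ ≤ (F * w ^ x.1) * (G * w ^ x.2) :=
          mul_le_mul (hf _ hx.1.1.le) (hg _ hx.1.2.le) (norm_nonneg _) (by positivity)
      _ = F * G * w ^ (x.1 + x.2) := by rw [pow_add]; ring
      _ ≤ F * G * w ^ n₀ := by
          gcongr ?_ * ?_
          exact pow_le_pow_of_le_one hw hw1 hx.2
  · rw [Finset.sum_const, nsmul_eq_mul, mul_assoc ((n₀ : ℝ) ^ 2)]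
    refine mul_le_mul_of_nonneg_right ?_ (by positivity)
    have := Finset.card_filter_le P fun x => ¬ x.1 + x.2 < n₀
    rw [hP, Finset.card_product, Finset.card_range] at this
    rw [sq]
    exact_mod_cast this

theorem norm_partialSum_le {B : ℝ} (hB : 0 ≤ B) (hw : 0 ≤ w) (hw1 : w ≤ 1) (h0 : coeff 0 f = 0)
    (hf : ∀ k, ‖coeff k f‖ ≤ B * w ^ k) (n₀ : ℕ) : ‖partialSum n₀ f‖ ≤ n₀ * B * w := by
  refine (norm_sum_le_of_le _ (n := fun _ => B * w) fun k _ => ?_).trans ?_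
  · rcases eq_or_ne k 0 with rfl | hk
    · rw [h0, norm_zero]; positivity
    · refine (hf k).trans (mul_le_mul_of_nonneg_left ?_ hB)
      exact pow_le_of_le_one hw hw1 hk
  · rw [Finset.sum_const, Finset.card_range, nsmul_eq_mul, mul_assoc]

theorem exists_norm_partialSum_pow_sub_le {B : ℝ} (hB : 0 ≤ B) (n₀ r : ℕ) :
    ∃ C : ℝ, 0 ≤ C ∧ ∀ (w : ℝ) (f : PowerSeries ℂ), 0 ≤ w → w ≤ 1 → coeff 0 f = 0 →
      (∀ k, ‖coeff k f‖ ≤ B * w ^ k) →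
      ‖partialSum n₀ f ^ r - partialSum n₀ (f ^ r)‖ ≤ C * w ^ n₀ := by
  induction r with
  | zero =>
    refine ⟨1, zero_le_one, fun w f hw hw1 _ _ => ?_⟩
    rw [pow_zero, pow_zero, partialSum, one_mul]
    -- For `n₀ = 0` the truncation of the series `1` is `0`, so the difference is `1`, which the
    -- constant `1` covers.
    rcases Nat.eq_zero_or_pos n₀ with rfl | h
    · simp
    · rw [Finset.sum_eq_single 0 (fun b _ hb => by rw [coeff_one, if_neg hb])
        (fun h' => absurd (Finset.mem_range.2 h) h')]
      simpa using pow_nonneg hw n₀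
  | succ r ih =>
    obtain ⟨C, hC, h⟩ := ih
    refine ⟨C * (n₀ * B) + n₀ ^ 2 * (((n₀ + 1) * B) ^ r * B), by positivity,
      fun w f hw hw1 h0 hf => ?_⟩
    have e : partialSum n₀ f ^ (r + 1) - partialSum n₀ (f ^ (r + 1))
        = (partialSum n₀ f ^ r - partialSum n₀ (f ^ r)) * partialSum n₀ f
          + (partialSum n₀ (f ^ r) * partialSum n₀ f - partialSum n₀ (f ^ r * f)) := by
      rw [pow_succ, pow_succ]; ring
    rw [e, add_mul]
    refine norm_add_le_of_le ?_ ?_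
    · rw [norm_mul, mul_right_comm]
      refine mul_le_mul (h w f hw hw1 h0 hf) ?_ (norm_nonneg _) (by positivity)
      refine (norm_partialSum_le hB hw hw1 h0 hf n₀).trans ?_
      exact mul_le_of_le_one_right (by positivity) hw1
    · exact norm_partialSum_mul_sub_le (by positivity) hB hw hw1
        (fun k hk => norm_coeff_pow_le hB hw hf r k hk) fun k _ => hf k

theorem norm_exp_sub_one_le (z : ℂ) : ‖Complex.exp z - 1‖ ≤ ‖z‖ * Real.exp ‖z‖ := by
  simpa using Complex.norm_exp_sub_sum_le_norm_mul_exp z 1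

/-- With `p` the truncation of `f`, three errors are added: replacing `a` by `p`, truncating the
Taylor series of `exp` at `p`, and replacing `p ^ r` by the truncation of `f ^ r`. The constant
depends on `B` and `n₀` only, which gives uniformity in `Λ` and `X`. -/
theorem exists_norm_exp_sub_partialSum_expSeries_le {B : ℝ} (hB : 0 ≤ B) (n₀ : ℕ) :
    ∃ C : ℝ, 0 ≤ C ∧ ∀ (w : ℝ) (f : PowerSeries ℂ) (a : ℂ), 0 ≤ w → w ≤ 1 → coeff 0 f = 0 →
      (∀ k, ‖coeff k f‖ ≤ B * w ^ k) → ‖a - partialSum n₀ f‖ ≤ B * w ^ n₀ →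
      ‖Complex.exp a - partialSum n₀ (expSeries f)‖ ≤ C * w ^ n₀ := by
  choose K hK0 hK using fun r => exists_norm_partialSum_pow_sub_le hB n₀ r
  set D : ℝ := n₀ * B with hD
  have hD0 : 0 ≤ D := by positivity
  refine ⟨Real.exp D * (B * Real.exp B) + D ^ n₀ * Real.exp D + ∑ r ∈ Finset.range n₀, K r,
    add_nonneg (by positivity) (Finset.sum_nonneg fun r _ => hK0 r),
    fun w f a hw hw1 h0 hf ha => ?_⟩
  set p := partialSum n₀ f with hp
  have hpw : ‖p‖ ≤ D * w := norm_partialSum_le hB hw hw1 h0 hf n₀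
  have hpD : ‖p‖ ≤ D := hpw.trans (mul_le_of_le_one_right hD0 hw1)
  have haB : ‖a - p‖ ≤ B := ha.trans (mul_le_of_le_one_right hB (pow_le_one₀ hw hw1))
  have hE : partialSum n₀ (expSeries f)
      = ∑ r ∈ Finset.range n₀, partialSum n₀ (f ^ r) / (r.factorial : ℂ) := by
    simp only [partialSum, Finset.sum_div]
    rw [Finset.sum_comm]
    exact Finset.sum_congr rfl fun n hn => coeff_expSeries_eq h0 (Finset.mem_range.1 hn)
  have e : Complex.exp a - partialSum n₀ (expSeries f)
      = Complex.exp p * (Complex.exp (a - p) - 1)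
        + (Complex.exp p - ∑ r ∈ Finset.range n₀, p ^ r / (r.factorial : ℂ))
        + ∑ r ∈ Finset.range n₀, (p ^ r - partialSum n₀ (f ^ r)) / (r.factorial : ℂ) := by
    simp only [hE, sub_div, Finset.sum_sub_distrib, mul_sub, ← Complex.exp_add]
    ring_nf
  rw [e, add_mul, add_mul]
  refine norm_add_le_of_le (norm_add_le_of_le ?_ ?_) ?_
  · rw [norm_mul, Complex.norm_exp, mul_assoc]
    refine mul_le_mul (Real.exp_le_exp.2 ((Complex.re_le_norm p).trans hpD)) ?_ (norm_nonneg _)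
      (Real.exp_pos _).le
    calc ‖Complex.exp (a - p) - 1‖ ≤ ‖a - p‖ * Real.exp ‖a - p‖ := norm_exp_sub_one_le _
      _ ≤ (B * w ^ n₀) * Real.exp B := by gcongr
      _ = B * Real.exp B * w ^ n₀ := by ring
  · refine (Complex.norm_exp_sub_sum_le_norm_mul_exp p n₀).trans ?_
    calc ‖p‖ ^ n₀ * Real.exp ‖p‖ ≤ (D * w) ^ n₀ * Real.exp D := by gcongr
      _ = D ^ n₀ * Real.exp D * w ^ n₀ := by rw [mul_pow]; ring
  · rw [Finset.sum_mul]
    refine norm_sum_le_of_le _ fun r _ => ?_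
    rw [norm_div, Complex.norm_natCast]
    refine (div_le_self (norm_nonneg _) ?_).trans (hK r w f hw hw1 h0 hf)
    exact_mod_cast r.factorial_pos

end PowerSeries

/-! ### Hermitian matrices and their eigenvalues -/

namespace Matrix.IsHermitian

variable {n : Type*} [Fintype n] [DecidableEq n] {A : Matrix n n ℂ}

theorem trace_conj (hA : A.IsHermitian) (D : Matrix n n ℂ) :
    (Unitary.conjStarAlgAut ℂ _ hA.eigenvectorUnitary D).trace = D.trace := by
  rw [Unitary.conjStarAlgAut_apply, Matrix.trace_mul_comm, ← mul_assoc]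
  simp

theorem det_conj (hA : A.IsHermitian) (D : Matrix n n ℂ) :
    (Unitary.conjStarAlgAut ℂ _ hA.eigenvectorUnitary D).det = D.det := by
  rw [Unitary.conjStarAlgAut_apply, Matrix.det_mul_comm, ← mul_assoc]
  simp

theorem trace_pow_eq (hA : A.IsHermitian) (k : ℕ) :
    (A ^ k).trace = ∑ i, (hA.eigenvalues i : ℂ) ^ k := by
  have h : A ^ k = Unitary.conjStarAlgAut ℂ _ hA.eigenvectorUnitary
      (diagonal (RCLike.ofReal ∘ hA.eigenvalues) ^ k) := by
    rw [map_pow, ← hA.spectral_theorem]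
  rw [h, trace_conj, Matrix.diagonal_pow, Matrix.trace_diagonal]
  rfl

theorem det_one_add_eq (hA : A.IsHermitian) :
    (1 + A).det = ∏ i, (1 + (hA.eigenvalues i : ℂ)) := by
  have h : 1 + A = Unitary.conjStarAlgAut ℂ _ hA.eigenvectorUnitary
      (1 + diagonal (RCLike.ofReal ∘ hA.eigenvalues)) := by
    rw [map_add, map_one, ← hA.spectral_theorem]
  rw [h, det_conj, ← Matrix.diagonal_one, Matrix.diagonal_add, Matrix.det_diagonal]
  rfl

/-- As `Real.log` is `log |·|`, it is additive on products of nonzero reals, so positivity of the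
eigenvalues plays no role. -/
theorem trace_cfc_log (hA : A.IsHermitian) (h : A.det ≠ 0) :
    (cfc Real.log A).trace = ((Real.log A.det.re : ℝ) : ℂ) := by
  have h1 := hA.det_eq_prod_eigenvalues
  have h2 : A.det.re = ∏ i, hA.eigenvalues i := by
    rw [h1]
    exact_mod_cast Complex.ofReal_re (∏ i, hA.eigenvalues i)
  have h3 : ∀ i, hA.eigenvalues i ≠ 0 := fun i hi => h (by
    rw [h1]; exact Finset.prod_eq_zero (Finset.mem_univ i) (by rw [hi]; rfl))
  rw [hA.cfc_eq, Matrix.IsHermitian.cfc, trace_conj, Matrix.trace_diagonal, h2,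
    Real.log_prod fun i _ => h3 i]
  push_cast
  rfl

end Matrix.IsHermitian

namespace KontsevichPenner

variable {N : ℕ}

/-! ### Bounds near and away from the critical point -/

/-- `Tr X²` for a Hermitian matrix. -/
noncomputable def sqNorm (u : Fin N × Fin N → ℝ) : ℝ := ∑ i, ∑ j, Complex.normSq (hermitian u i j)

theorem hermitian_mul_swap (u : Fin N × Fin N → ℝ) (i j : Fin N) :
    hermitian u i j * hermitian u j i = (Complex.normSq (hermitian u i j) : ℂ) := by
  rw [← star_hermitian_apply u i j]
  exact Complex.mul_conj _

theorem trace_hermitian_sq (u : Fin N × Fin N → ℝ) :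
    (hermitian u ^ 2).trace = (sqNorm u : ℂ) := by
  simp only [sq, Matrix.trace, Matrix.diag_apply, Matrix.mul_apply, hermitian_mul_swap, sqNorm]
  push_cast
  rfl

theorem quadForm_eq_sum (lam : Fin N → ℝ) (u : Fin N × Fin N → ℝ) :
    quadForm (coordWeight lam) u = ∑ i, ∑ j, lam i * Complex.normSq (hermitian u i j) := by
  have h : (hermitian u ^ 2 * Lam lam).trace
      = ((∑ i, ∑ j, lam i * Complex.normSq (hermitian u i j) : ℝ) : ℂ) := by
    simp only [Lam, Matrix.trace, Matrix.diag_apply, Matrix.mul_diagonal]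
    push_cast
    refine Finset.sum_congr rfl fun i _ => ?_
    rw [sq, Matrix.mul_apply, Finset.sum_mul]
    exact Finset.sum_congr rfl fun j _ => by rw [hermitian_mul_swap, mul_comm]
  rw [trace_sq_mul_Lam] at h
  exact_mod_cast h

theorem sqNorm_nonneg (u : Fin N × Fin N → ℝ) : 0 ≤ sqNorm u :=
  Finset.sum_nonneg fun _ _ => Finset.sum_nonneg fun _ _ => Complex.normSq_nonneg _

/-- Every eigenvalue is bounded by the Hilbert-Schmidt norm, so `∑ |x|³ ≤ √(∑ x²) * ∑ x²`. -/
theorem norm_trace_hermitian_pow_three_le (u : Fin N × Fin N → ℝ) :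
    ‖(hermitian u ^ 3).trace‖ ≤ √(sqNorm u) * sqNorm u := by
  have hX := isHermitian_hermitian u
  have hT : sqNorm u = ∑ i, hX.eigenvalues i ^ 2 := by
    have h := trace_hermitian_sq u
    rw [hX.trace_pow_eq] at h
    exact_mod_cast h.symm
  have hx : ∀ i, |hX.eigenvalues i| ≤ √(sqNorm u) := fun i => by
    refine Real.abs_le_sqrt ?_
    rw [hT]
    exact Finset.single_le_sum (f := fun i => hX.eigenvalues i ^ 2) (fun _ _ => sq_nonneg _)
      (Finset.mem_univ i)
  rw [hX.trace_pow_eq]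
  conv_rhs => rw [hT, Finset.mul_sum, ← hT]
  refine norm_sum_le_of_le _ fun i _ => ?_
  rw [norm_pow, Complex.norm_real, Real.norm_eq_abs, pow_succ', sq_abs]
  exact mul_le_mul_of_nonneg_right (hx i) (sq_nonneg _)

/-- The eigenvalues of `Λ^(-1/2) X Λ^(-1/2)`. -/
theorem exists_relative_eigenvalues {lam : Fin N → ℝ} (h : ∀ i, 0 < lam i)
    (u : Fin N × Fin N → ℝ) :
    ∃ y : Fin N → ℝ,
      (∀ k : ℕ, ((-((Lam lam)⁻¹ * hermitian u)) ^ k).trace = ∑ i, (-(y i : ℂ)) ^ k) ∧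
      (hermitian u + Lam lam).det = (((∏ i, lam i) * ∏ i, (1 + y i) : ℝ) : ℂ) ∧
      ∑ i, y i ^ 2 = ∑ i, ∑ j, Complex.normSq (hermitian u i j) / (lam i * lam j) := by
  set X := hermitian u with hX
  set R : Matrix (Fin N) (Fin N) ℂ := Matrix.diagonal fun i => (√(lam i) : ℂ) with hR
  set R' : Matrix (Fin N) (Fin N) ℂ := Matrix.diagonal fun i => (√(lam i) : ℂ)⁻¹ with hR'
  have hs : ∀ i, (√(lam i) : ℂ) ≠ 0 := fun i => by exact_mod_cast (Real.sqrt_pos.2 (h i)).ne'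
  have hss : ∀ i, (√(lam i) : ℂ) * √(lam i) = lam i := fun i => by
    exact_mod_cast Real.mul_self_sqrt (h i).le
  have hRR' : R * R' = 1 := by
    rw [hR, hR', Matrix.diagonal_mul_diagonal, ← Matrix.diagonal_one]
    exact congrArg _ (funext fun i => mul_inv_cancel₀ (hs i))
  have hR'R : R' * R = 1 := mul_eq_one_comm.1 hRR'
  have hRR : R * R = Lam lam := by
    rw [hR, Matrix.diagonal_mul_diagonal, Lam]
    exact congrArg _ (funext hss)
  have hinv : (Lam lam)⁻¹ = R' * R' := by
    refine Matrix.inv_eq_left_inv ?_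
    rw [← hRR, mul_assoc, ← mul_assoc R' R R, hR'R, one_mul, hR'R]
  set S := R' * X * R' with hS
  have hSapp : ∀ i j, S i j = (√(lam i) : ℂ)⁻¹ * X i j * (√(lam j) : ℂ)⁻¹ := fun i j => by
    rw [hS, hR', Matrix.mul_diagonal, Matrix.diagonal_mul]
  have hSH : S.IsHermitian := by
    ext i j
    rw [Matrix.conjTranspose_apply, hSapp, hSapp, star_mul', star_mul', star_hermitian_apply]
    simp only [star_inv₀, Complex.star_def, Complex.conj_ofReal]
    ring
  refine ⟨hSH.eigenvalues, fun k => ?_, ?_, ?_⟩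
  · let v : (Matrix (Fin N) (Fin N) ℂ)ˣ := ⟨R', R, hR'R, hRR'⟩
    -- `Λ⁻¹X` is not Hermitian, but conjugation by `Λ^(-1/2)` relates it to the Hermitian matrix `S
    -- = Λ^(-1/2) X Λ^(-1/2)`.
    have e1 : -((Lam lam)⁻¹ * X) = (v : Matrix (Fin N) (Fin N) ℂ) * (-S)
        * ((v⁻¹ : (Matrix (Fin N) (Fin N) ℂ)ˣ) : Matrix (Fin N) (Fin N) ℂ) := by
      change -((Lam lam)⁻¹ * X) = R' * (-S) * R
      rw [hinv, hS, mul_neg, neg_mul, mul_assoc R' (R' * X * R') R, mul_assoc (R' * X) R' R, hR'R,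
        mul_one, mul_assoc]
    rw [e1, Units.conj_pow, Matrix.trace_units_conj]
    rcases Nat.even_or_odd k with hk | hk
    · simp only [hk.neg_pow, hSH.trace_pow_eq]
    · simp only [hk.neg_pow, Matrix.trace_neg, hSH.trace_pow_eq, Finset.sum_neg_distrib]
  · have e1 : X + Lam lam = R * (1 + S) * R := by
      rw [mul_add, mul_one, add_mul, hRR, add_comm, hS, ← mul_assoc, ← mul_assoc, hRR', one_mul,
        mul_assoc, hR'R, mul_one]
    rw [e1, Matrix.det_mul, Matrix.det_mul, hSH.det_one_add_eq, mul_right_comm, ← Matrix.det_mul, hRR,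
      Lam, Matrix.det_diagonal]
    push_cast
    rfl
  · have e1 : (S ^ 2).trace
        = ((∑ i, ∑ j, Complex.normSq (X i j) / (lam i * lam j) : ℝ) : ℂ) := by
      simp only [sq, Matrix.trace, Matrix.diag_apply, Matrix.mul_apply, hSapp]
      push_cast
      refine Finset.sum_congr rfl fun i _ => Finset.sum_congr rfl fun j _ => ?_
      rw [← hermitian_mul_swap, ← hX, ← hss i, ← hss j]
      field_simp
    rw [hSH.trace_pow_eq] at e1
    exact_mod_cast e1

theorem inv_le_norm {lam : Fin N → ℝ} (i : Fin N) :
    (lam i)⁻¹ ≤ ‖fun i : Fin N => (lam i)⁻¹‖ :=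
  (le_abs_self _).trans (norm_le_pi_norm (fun i : Fin N => (lam i)⁻¹) i)

theorem sqNorm_le {lam : Fin N → ℝ} (h : ∀ i, 0 < lam i) (u : Fin N × Fin N → ℝ) :
    sqNorm u ≤ ‖fun i : Fin N => (lam i)⁻¹‖ * quadForm (coordWeight lam) u := by
  rw [quadForm_eq_sum, sqNorm, Finset.mul_sum]
  refine Finset.sum_le_sum fun i _ => ?_
  rw [Finset.mul_sum]
  refine Finset.sum_le_sum fun j _ => ?_
  have h1 : 1 ≤ ‖fun i : Fin N => (lam i)⁻¹‖ * lam i := by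
    have := mul_le_mul_of_nonneg_right (inv_le_norm (lam := lam) i) (h i).le
    rwa [inv_mul_cancel₀ (h i).ne'] at this
  rw [← mul_assoc]
  exact le_mul_of_one_le_left (Complex.normSq_nonneg _) h1

theorem sum_normSq_div_le {lam : Fin N → ℝ} (h : ∀ i, 0 < lam i) (u : Fin N × Fin N → ℝ) :
    ∑ i, ∑ j, Complex.normSq (hermitian u i j) / (lam i * lam j)
      ≤ ‖fun i : Fin N => (lam i)⁻¹‖ ^ 3 * quadForm (coordWeight lam) u := by
  set r := ‖fun i : Fin N => (lam i)⁻¹‖ with hr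
  have hr0 : 0 ≤ r := norm_nonneg _
  calc ∑ i, ∑ j, Complex.normSq (hermitian u i j) / (lam i * lam j) ≤ r ^ 2 * sqNorm u := by
        rw [sqNorm, Finset.mul_sum]
        refine Finset.sum_le_sum fun i _ => ?_
        rw [Finset.mul_sum]
        refine Finset.sum_le_sum fun j _ => ?_
        rw [div_eq_mul_inv, mul_comm, mul_inv]
        refine mul_le_mul_of_nonneg_right ?_ (Complex.normSq_nonneg _)
        rw [sq]
        exact mul_le_mul (inv_le_norm i) (inv_le_norm j) (inv_nonneg.2 (h j).le) hr0
    _ ≤ r ^ 2 * (r * quadForm (coordWeight lam) u) := by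
        gcongr
        exact sqNorm_le h u
    _ = r ^ 3 * quadForm (coordWeight lam) u := by ring

theorem mem_nearSaddle {ε : ℝ} {lam : Fin N → ℝ} {u : Fin N × Fin N → ℝ} :
    u ∈ nearSaddle ε lam ↔ ∀ i, sqNorm u ≤ (ε * lam i) ^ 2 := by
  simp [nearSaddle, trace_hermitian_sq]

theorem sqrt_sqNorm_le_of_mem {ε : ℝ} (hε : 0 < ε) {lam : Fin N → ℝ} (h : ∀ i, 0 < lam i)
    {u : Fin N × Fin N → ℝ} (hu : u ∈ nearSaddle ε lam) (i : Fin N) :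
    √(sqNorm u) ≤ ε * lam i :=
  Real.sqrt_le_iff.2 ⟨(mul_pos hε (h i)).le, mem_nearSaddle.1 hu i⟩

/-- On the ball, the cubic term is dominated by the quadratic form of the Gaussian; this replaces
the missing convergence at infinity. -/
theorem norm_trace_pow_three_le_of_mem {ε : ℝ} (hε : 0 < ε) {lam : Fin N → ℝ}
    (h : ∀ i, 0 < lam i) {u : Fin N × Fin N → ℝ} (hu : u ∈ nearSaddle ε lam) :
    ‖(hermitian u ^ 3).trace‖ ≤ ε * quadForm (coordWeight lam) u := by
  refine (norm_trace_hermitian_pow_three_le u).trans ?_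
  rw [quadForm_eq_sum, Finset.mul_sum]
  conv_lhs => rw [sqNorm, Finset.mul_sum, ← sqNorm]
  refine Finset.sum_le_sum fun i _ => ?_
  rw [Finset.mul_sum, Finset.mul_sum]
  refine Finset.sum_le_sum fun j _ => ?_
  rw [← mul_assoc]
  exact mul_le_mul_of_nonneg_right (sqrt_sqNorm_le_of_mem hε h hu i) (Complex.normSq_nonneg _)

/-- The left side is the sum of the squared relative eigenvalues. On the ball these therefore stay
in `[-ε, ε]`, and the logarithms `log (1 + y)` are bounded. -/
theorem sum_normSq_div_le_of_mem {ε : ℝ} (hε : 0 < ε) {lam : Fin N → ℝ}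
    (h : ∀ i, 0 < lam i) {u : Fin N × Fin N → ℝ} (hu : u ∈ nearSaddle ε lam) :
    ∑ i, ∑ j, Complex.normSq (hermitian u i j) / (lam i * lam j) ≤ ε ^ 2 := by
  have h1 : ∀ i j, sqNorm u ≤ ε ^ 2 * (lam i * lam j) := fun i j => by
    have e1 := sqrt_sqNorm_le_of_mem hε h hu i
    have e2 := sqrt_sqNorm_le_of_mem hε h hu j
    calc sqNorm u = √(sqNorm u) * √(sqNorm u) := (Real.mul_self_sqrt (sqNorm_nonneg u)).symm
      _ ≤ (ε * lam i) * (ε * lam j) :=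
        mul_le_mul e1 e2 (Real.sqrt_nonneg _) (mul_pos hε (h i)).le
      _ = ε ^ 2 * (lam i * lam j) := by ring
  -- The main case uses `1 / (λᵢ λⱼ) ≤ ε² / Tr X²`, so `X = 0` is treated apart.
  rcases (sqNorm_nonneg u).eq_or_lt with h0 | h0
  · have h2 : ∀ i j, Complex.normSq (hermitian u i j) = 0 := fun i j => by
      have e1 := (Finset.sum_eq_zero_iff_of_nonneg fun i _ =>
        Finset.sum_nonneg fun j _ => Complex.normSq_nonneg (hermitian u i j)).1 h0.symm i
        (Finset.mem_univ i)
      exact (Finset.sum_eq_zero_iff_of_nonneg fun j _ =>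
        Complex.normSq_nonneg (hermitian u i j)).1 e1 j (Finset.mem_univ j)
    simp only [h2, zero_div, Finset.sum_const_zero]
    positivity
  · have h2 : ∑ i, ∑ j, Complex.normSq (hermitian u i j) / (lam i * lam j)
        ≤ (ε ^ 2 / sqNorm u) * sqNorm u := by
      conv_rhs => rw [sqNorm.eq_def u, Finset.mul_sum, ← sqNorm.eq_def u]
      refine Finset.sum_le_sum fun i _ => ?_
      rw [Finset.mul_sum]
      refine Finset.sum_le_sum fun j _ => ?_
      rw [div_eq_mul_inv, mul_comm]
      refine mul_le_mul_of_nonneg_right ?_ (Complex.normSq_nonneg _)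
      have := mul_pos (h i) (h j)
      rw [inv_eq_one_div, div_le_div_iff₀ this h0, one_mul]
      exact h1 i j
    rwa [div_mul_cancel₀ _ h0.ne'] at h2

end KontsevichPenner

namespace KontsevichPenner

variable {N : ℕ}

/-! ### The integrand on the ball -/

/-- The exponent of the integrand, without the Gaussian and after normalization by `det(Λ)^Q`. -/
noncomputable def phase (Q : ℂ) (lam : Fin N → ℝ) (u : Fin N × Fin N → ℝ) : ℂ :=
  -(hermitian u ^ 3).trace / 6
    - Q * ((Real.log (hermitian u + Lam lam).det.re - ∑ i, Real.log (lam i) : ℝ) : ℂ)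

theorem measurable_phase (Q : ℂ) (lam : Fin N → ℝ) : Measurable (phase Q lam) := by
  have h1 : Continuous fun u : Fin N × Fin N → ℝ => (hermitian u ^ 3).trace :=
    (continuous_hermitian.pow 3).matrix_trace
  have h2 : Continuous fun u : Fin N × Fin N → ℝ => (hermitian u + Lam lam).det.re :=
    Complex.continuous_re.comp (continuous_hermitian.add continuous_const).matrix_det
  have h3 := Real.measurable_log.comp h2.measurable
  exact (h1.measurable.neg.div_const _).sub
    ((Complex.measurable_ofReal.comp (h3.sub_const _)).const_mul Q)

theorem measurableSet_nearSaddle (ε : ℝ) (lam : Fin N → ℝ) :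
    MeasurableSet (nearSaddle ε lam) := by
  have h : Continuous fun u : Fin N × Fin N → ℝ => (hermitian u ^ 2).trace.re :=
    Complex.continuous_re.comp (continuous_hermitian.pow 2).matrix_trace
  rw [nearSaddle, Set.ofPred_forall]
  exact MeasurableSet.iInter fun i => measurableSet_le h.measurable measurable_const

theorem isHermitian_Lam (lam : Fin N → ℝ) : (Lam lam).IsHermitian := by
  rw [Lam, Matrix.IsHermitian, Matrix.diagonal_conjTranspose]
  congr 1
  funext i
  exact Complex.conj_ofReal _

theorem phase_eq (Q : ℂ) {lam : Fin N → ℝ} (h : ∀ i, 0 < lam i) {u : Fin N × Fin N → ℝ}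
    {y : Fin N → ℝ} (hdet : (hermitian u + Lam lam).det = (((∏ i, lam i) * ∏ i, (1 + y i) : ℝ) : ℂ))
    (hy : ∀ i, |y i| < 1) :
    phase Q lam u = -(hermitian u ^ 3).trace / 6 - Q * ∑ i, (Real.log (1 + y i) : ℂ) := by
  have hy' : ∀ i, 1 + y i ≠ 0 := fun i => by have := (abs_lt.1 (hy i)).1; linarith
  rw [phase, hdet, Complex.ofReal_re, Real.log_mul (Finset.prod_pos fun i _ => h i).ne'
    (Finset.prod_ne_zero_iff.2 fun i _ => hy' i), Real.log_prod fun i _ => (h i).ne',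
    Real.log_prod fun i _ => hy' i, add_sub_cancel_left]
  push_cast
  rfl

theorem det_Lam_cpow (Q : ℂ) {lam : Fin N → ℝ} (h : ∀ i, 0 < lam i) :
    (Lam lam).det ^ Q = Complex.exp (Q * (∑ i, Real.log (lam i) : ℝ)) := by
  have h0 : 0 < ∏ i, lam i := Finset.prod_pos fun i _ => h i
  have h1 : (Lam lam).det = ((∏ i, lam i : ℝ) : ℂ) := by
    rw [Lam, Matrix.det_diagonal]; push_cast; rfl
  rw [h1, Complex.cpow_def_of_ne_zero (by exact_mod_cast h0.ne'), ← Complex.ofReal_log h0.le,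
    Real.log_prod fun i _ => (h i).ne', mul_comm]

theorem abs_le_of_sum_sq_le {y : Fin N → ℝ} {b : ℝ} (hb : 0 ≤ b) (h : ∑ i, y i ^ 2 ≤ b ^ 2)
    (i : Fin N) : |y i| ≤ b :=
  abs_le_of_sq_le_sq ((Finset.single_le_sum (f := fun i => y i ^ 2) (fun _ _ => sq_nonneg _)
    (Finset.mem_univ i)).trans h) hb

/-- `Tr log (X + Λ)` is `log det (X + Λ)`, and the prefactor `det(Λ)^Q` subtracts its value at `X =
0`. -/
theorem det_mul_integrand_eq {ε : ℝ} (hε : 0 < ε) (hε1 : ε < 1) (Q : ℂ) {lam : Fin N → ℝ}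
    (h : ∀ i, 0 < lam i) {u : Fin N × Fin N → ℝ} (hu : u ∈ nearSaddle ε lam) :
    (Lam lam).det ^ Q * integrand Q lam (hermitian u)
      = Complex.exp (phase Q lam u) * gaussian lam (hermitian u) := by
  obtain ⟨y, -, hdet, hsq⟩ := exists_relative_eigenvalues h u
  have hy : ∀ i, |y i| < 1 := fun i =>
    (abs_le_of_sum_sq_le hε.le (hsq.trans_le (sum_normSq_div_le_of_mem hε h hu)) i).trans_lt hε1
  have hne : (hermitian u + Lam lam).det ≠ 0 := by
    rw [hdet]
    have h1 : 0 < ∏ i, (1 + y i) := Finset.prod_pos fun i _ => by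
      have := (abs_lt.1 (hy i)).1; linarith
    exact_mod_cast (mul_pos (Finset.prod_pos fun i _ => h i) h1).ne'
  rw [det_Lam_cpow Q h, integrand, gaussian, ← Complex.exp_add, ← Complex.exp_add]
  congr 1
  rw [Matrix.trace_add, Matrix.trace_add, Matrix.trace_smul, Matrix.trace_smul, Matrix.trace_smul,
    ((isHermitian_hermitian u).add (isHermitian_Lam lam)).trace_cfc_log hne, phase]
  simp only [smul_eq_mul, Nat.factorial]
  push_cast
  ring

theorem abs_log_one_add_le {ε y : ℝ} (hε1 : ε < 1) (hy : |y| ≤ ε) :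
    |Real.log (1 + y)| ≤ ε / (1 - ε) := by
  have h0 : 0 ≤ ε := (abs_nonneg y).trans hy
  obtain ⟨h1, h2⟩ := abs_le.1 hy
  have h3 : 0 < 1 + y := by linarith
  have h4 : 0 < 1 - ε := by linarith
  have h5 : ε ≤ ε / (1 - ε) := by
    rw [le_div_iff₀ h4]; nlinarith
  refine abs_le.2 ⟨?_, ?_⟩
  · have h6 := Real.one_sub_inv_le_log_of_pos h3
    have h7 : (1 + y)⁻¹ ≤ (1 - ε)⁻¹ := inv_anti₀ h4 (by linarith)
    have h8 : ε / (1 - ε) = (1 - ε)⁻¹ - 1 := by field_simp; ring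
    linarith
  · have := Real.log_le_sub_one_of_pos h3
    linarith

/-- The cubic term costs at most `1/6` of the quadratic form, less than the `1/2` in the Gaussian,
and the logarithmic term costs a constant independent of `Λ`. -/
theorem norm_exp_phase_le {ε : ℝ} (hε : 0 < ε) (hε1 : ε < 1) (Q : ℂ) {lam : Fin N → ℝ}
    (h : ∀ i, 0 < lam i) {u : Fin N × Fin N → ℝ} (hu : u ∈ nearSaddle ε lam) :
    ‖Complex.exp (phase Q lam u)‖ ≤ Real.exp (‖Q‖ * (N * (ε / (1 - ε))))
      * Real.exp (1 / 6 * quadForm (coordWeight lam) u) := by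
  obtain ⟨y, -, hdet, hsq⟩ := exists_relative_eigenvalues h u
  have hy : ∀ i, |y i| ≤ ε := fun i =>
    abs_le_of_sum_sq_le hε.le (hsq.trans_le (sum_normSq_div_le_of_mem hε h hu)) i
  rw [Complex.norm_exp, ← Real.exp_add, phase_eq Q h hdet fun i => (hy i).trans_lt hε1]
  refine Real.exp_le_exp.2 ((Complex.re_le_norm _).trans ((norm_sub_le _ _).trans ?_))
  rw [add_comm]
  refine add_le_add ?_ ?_
  · rw [norm_mul]
    refine mul_le_mul_of_nonneg_left ?_ (norm_nonneg _)
    refine (norm_sum_le_of_le _ (n := fun _ => ε / (1 - ε)) fun i _ => ?_).trans ?_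
    · rw [Complex.norm_real]
      exact abs_log_one_add_le hε1 (hy i)
    · simp
  · rw [norm_div, norm_neg]
    have h1 := norm_trace_pow_three_le_of_mem hε h hu
    have h2 := quadForm_nonneg (coordWeight_pos h) u
    have h3 : ‖(6 : ℂ)‖ = 6 := by norm_num
    rw [h3]
    have : ε * quadForm (coordWeight lam) u ≤ 1 * quadForm (coordWeight lam) u := by gcongr
    linarith

theorem norm_gaussian_hermitian (lam : Fin N → ℝ) (u : Fin N × Fin N → ℝ) :
    ‖gaussian lam (hermitian u)‖ = Real.exp (-(1 / 2) * quadForm (coordWeight lam) u) := by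
  rw [gaussian_hermitian, Complex.norm_real, Real.norm_eq_abs, abs_of_pos (Real.exp_pos _)]

theorem continuous_gaussian_hermitian (lam : Fin N → ℝ) :
    Continuous fun u => gaussian lam (hermitian u) := by
  simp_rw [gaussian_hermitian]
  have := continuous_quadForm (coordWeight lam)
  fun_prop

theorem det_Lam_cpow_ne_zero (Q : ℂ) {lam : Fin N → ℝ} (h : ∀ i, 0 < lam i) :
    (Lam lam).det ^ Q ≠ 0 := by
  rw [det_Lam_cpow Q h]; exact Complex.exp_ne_zero _

theorem integrableOn_exp_phase {ε : ℝ} (hε : 0 < ε) (hε1 : ε < 1) (Q : ℂ) {lam : Fin N → ℝ}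
    (h : ∀ i, 0 < lam i) :
    IntegrableOn (fun u => Complex.exp (phase Q lam u) * gaussian lam (hermitian u))
      (nearSaddle ε lam) := by
  have hint := ((integrable_exp_neg_mul_quadForm (coordWeight_pos h)
    (show (0 : ℝ) < 1 / 3 by norm_num)).const_mul
      (Real.exp (‖Q‖ * (N * (ε / (1 - ε)))))).integrableOn (s := nearSaddle ε lam)
  refine Integrable.mono' hint ?_ ?_
  · exact ((measurable_phase Q lam).cexp.mul
      (continuous_gaussian_hermitian lam).measurable).aestronglyMeasurable
  · refine ae_restrict_of_forall_mem (measurableSet_nearSaddle ε lam) fun u hu => ?_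
    rw [norm_mul, norm_gaussian_hermitian]
    refine (mul_le_mul_of_nonneg_right (norm_exp_phase_le hε hε1 Q h hu)
      (Real.exp_pos _).le).trans (le_of_eq ?_)
    rw [mul_assoc, ← Real.exp_add]
    ring_nf

theorem integrableOn_integrand {ε : ℝ} (hε : 0 < ε) (hε1 : ε < 1) (Q : ℂ) {lam : Fin N → ℝ}
    (h : ∀ i, 0 < lam i) :
    IntegrableOn (fun u => integrand Q lam (hermitian u)) (nearSaddle ε lam) := by
  refine IntegrableOn.congr_fun (f := fun u => ((Lam lam).det ^ Q)⁻¹ *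
      (Complex.exp (phase Q lam u) * gaussian lam (hermitian u)))
    ((integrableOn_exp_phase hε hε1 Q h).const_mul _) (fun u hu => ?_)
    (measurableSet_nearSaddle ε lam)
  dsimp only
  rw [← det_mul_integrand_eq hε hε1 Q h hu, inv_mul_cancel_left₀ (det_Lam_cpow_ne_zero Q h)]

/-! ### Comparison of the integrand with its expansion -/

/-- The small parameter that controls all terms of the expansion. -/
noncomputable def size (lam : Fin N → ℝ) (u : Fin N × Fin N → ℝ) : ℝ :=
  -- With `r = max 1/λᵢ`, the matrix `X` is bounded by `√(r q)`, so both `Tr X³` and the eigenvalues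
  -- of `Λ⁻¹X` scale as `r^(3/2)`. The power `(1 + q)²` dominates the factors `q^(3/2)` and `√q`
  -- that occur.
  (‖fun i : Fin N => (lam i)⁻¹‖ * √‖fun i : Fin N => (lam i)⁻¹‖)
    * (1 + quadForm (coordWeight lam) u) ^ 2

theorem size_nonneg (lam : Fin N → ℝ) (u : Fin N × Fin N → ℝ) : 0 ≤ size lam u := by
  unfold size; positivity

theorem sqrt_mul_cube_le_size {lam : Fin N → ℝ} (h : ∀ i, 0 < lam i) (u : Fin N × Fin N → ℝ) :
    ‖fun i : Fin N => (lam i)⁻¹‖ ^ 3 * quadForm (coordWeight lam) u ≤ size lam u ^ 2 := by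
  have hq := quadForm_nonneg (coordWeight_pos h) u
  set q := quadForm (coordWeight lam) u
  unfold size
  set r := ‖fun i : Fin N => (lam i)⁻¹‖
  have hr : 0 ≤ r := norm_nonneg _
  have h1 : (r * √r * (1 + q) ^ 2) ^ 2 = r ^ 3 * (1 + q) ^ 4 := by
    rw [mul_pow, mul_pow, Real.sq_sqrt hr]; ring
  rw [h1]
  have h2 : (1 + q) ≤ (1 + q) ^ 4 := le_self_pow₀ (by linarith) (by norm_num)
  exact mul_le_mul_of_nonneg_left (by linarith) (by positivity)

theorem norm_trace_pow_three_le_size {lam : Fin N → ℝ} (h : ∀ i, 0 < lam i)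
    (u : Fin N × Fin N → ℝ) : ‖(hermitian u ^ 3).trace‖ ≤ size lam u := by
  refine (norm_trace_hermitian_pow_three_le u).trans ?_
  have hq := quadForm_nonneg (coordWeight_pos h) u
  have hT := sqNorm_le h u
  set q := quadForm (coordWeight lam) u
  unfold size
  set r := ‖fun i : Fin N => (lam i)⁻¹‖
  have hr : 0 ≤ r := norm_nonneg _
  have h1 : √q ≤ 1 + q := Real.sqrt_le_iff.2 ⟨by linarith, by nlinarith⟩
  calc √(sqNorm u) * sqNorm u ≤ √(r * q) * (r * q) :=
        mul_le_mul (Real.sqrt_le_sqrt hT) hT (sqNorm_nonneg u) (Real.sqrt_nonneg _)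
    _ = (r * √r) * (√q * q) := by rw [Real.sqrt_mul hr]; ring
    _ ≤ (r * √r) * ((1 + q) * (1 + q)) := by gcongr; linarith
    _ = (r * √r) * (1 + q) ^ 2 := by ring

/-- Outside the ball `size` exceeds `ε`. The cutoff error can thus be charged to powers of `size`,
and no separate tail estimate is needed. -/
theorem mem_nearSaddle_of_size_le {ε : ℝ} (hε : 0 < ε) {lam : Fin N → ℝ} (h : ∀ i, 0 < lam i)
    {u : Fin N × Fin N → ℝ} (hu : size lam u ≤ ε) : u ∈ nearSaddle ε lam := by
  rw [mem_nearSaddle]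
  intro i
  have h1 := sqrt_mul_cube_le_size h u
  have hT := sqNorm_le h u
  have hs := size_nonneg lam u
  set q := quadForm (coordWeight lam) u
  set r := ‖fun i : Fin N => (lam i)⁻¹‖ with hr
  have h2 : 1 ≤ r * lam i := by
    have := mul_le_mul_of_nonneg_right (inv_le_norm (lam := lam) i) (h i).le
    rwa [inv_mul_cancel₀ (h i).ne'] at this
  have hr0 : 0 < r := by
    by_contra hr0
    have : r * lam i ≤ 0 := mul_nonpos_of_nonpos_of_nonneg (not_lt.1 hr0) (h i).le
    linarith
  have h3 : r ^ 2 * (r * q) ≤ ε ^ 2 := by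
    calc r ^ 2 * (r * q) = r ^ 3 * q := by ring
      _ ≤ size lam u ^ 2 := h1
      _ ≤ ε ^ 2 := by gcongr
  have h4 : ε ^ 2 ≤ r ^ 2 * (ε * lam i) ^ 2 := by
    have : ε ^ 2 * 1 ≤ ε ^ 2 * (r * lam i) ^ 2 := by
      gcongr
      exact one_le_pow₀ h2
    calc ε ^ 2 = ε ^ 2 * 1 := by ring
      _ ≤ ε ^ 2 * (r * lam i) ^ 2 := this
      _ = r ^ 2 * (ε * lam i) ^ 2 := by ring
  have h5 : r * q ≤ (ε * lam i) ^ 2 := le_of_mul_le_mul_left (h3.trans h4) (by positivity)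
  exact hT.trans h5

/-- In the constant, `1` pays for the cubic term and `‖Q‖ * N` for the traces. The factor `2` is
there so that the same constant serves in `norm_phase_sub_partialSum_le`. -/
theorem norm_coeff_interaction_le (Q : ℂ) {lam : Fin N → ℝ} (h : ∀ i, 0 < lam i)
    (u : Fin N × Fin N → ℝ) (k : ℕ) :
    ‖PowerSeries.coeff k (interaction Q lam (hermitian u))‖
      ≤ (1 + 2 * ‖Q‖ * N) * size lam u ^ k := by
  obtain ⟨y, htr, -, hsq⟩ := exists_relative_eigenvalues h u
  have hs := size_nonneg lam u
  have hy : ∀ i, |y i| ≤ size lam u := abs_le_of_sum_sq_le hs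
    ((hsq.trans_le (sum_normSq_div_le h u)).trans (sqrt_mul_cube_le_size h u))
  rw [interaction, PowerSeries.coeff_mk, add_mul, htr]
  refine norm_add_le_of_le ?_ ?_
  · split_ifs with hk
    · subst hk
      rw [norm_div, norm_neg, one_mul, pow_one, Complex.norm_natCast]
      exact (div_le_self (norm_nonneg _) (by norm_num [Nat.factorial])).trans
        (norm_trace_pow_three_le_size h u)
    · rw [norm_zero]; positivity
  · split_ifs with hk
    · rw [norm_zero]; positivity
    · rw [norm_mul, norm_div, Complex.norm_natCast]
      have h1 : ‖∑ i, (-(y i : ℂ)) ^ k‖ ≤ N * size lam u ^ k := by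
        refine (norm_sum_le_of_le _ (n := fun _ => size lam u ^ k) fun i _ => ?_).trans
          (by simp)
        rw [norm_pow, norm_neg, Complex.norm_real]
        exact pow_le_pow_left₀ (abs_nonneg _) (hy i) k
      have h2 : ‖Q‖ / k ≤ 2 * ‖Q‖ := by
        have h3 : (1 : ℝ) ≤ k := by exact_mod_cast Nat.one_le_iff_ne_zero.2 hk
        exact (div_le_self (norm_nonneg _) h3).trans (by linarith [norm_nonneg Q])
      rw [mul_assoc]
      exact mul_le_mul h2 h1 (norm_nonneg _) (by positivity)

/-- The cubic term has degree `1` in `s`, so for `1 ≤ n` it cancels exactly. What remains is the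
Taylor remainder of `log (1 + y)`, whose denominator `1 - |y|` is at least `1/2`. -/
theorem norm_phase_sub_partialSum_le (Q : ℂ) {lam : Fin N → ℝ} (h : ∀ i, 0 < lam i)
    {u : Fin N × Fin N → ℝ} (hu : size lam u ≤ 1 / 2) {n : ℕ} (hn : 1 ≤ n) :
    ‖phase Q lam u - PowerSeries.partialSum (n + 1) (interaction Q lam (hermitian u))‖
      ≤ (1 + 2 * ‖Q‖ * N) * size lam u ^ (n + 1) := by
  obtain ⟨y, htr, hdet, hsq⟩ := exists_relative_eigenvalues h u
  have hs := size_nonneg lam u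
  have hy : ∀ i, |y i| ≤ size lam u := abs_le_of_sum_sq_le hs
    ((hsq.trans_le (sum_normSq_div_le h u)).trans (sqrt_mul_cube_le_size h u))
  have hy1 : ∀ i, |y i| < 1 := fun i => by have := hy i; linarith
  have hp : PowerSeries.partialSum (n + 1) (interaction Q lam (hermitian u))
      = -(hermitian u ^ 3).trace / 6
        + Q * ∑ i, ((∑ j ∈ Finset.range n, (-y i) ^ (j + 1) / (j + 1) : ℝ) : ℂ) := by
    rw [PowerSeries.partialSum, Finset.sum_range_succ', coeff_zero_interaction, add_zero]
    simp only [interaction, PowerSeries.coeff_mk, Nat.add_eq_right, Nat.add_eq_zero_iff,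
      one_ne_zero, and_false, if_false, Finset.sum_add_distrib, htr]
    congr 1
    · rw [Finset.sum_ite_eq' , if_pos (Finset.mem_range.2 hn)]
      norm_num [Nat.factorial]
    · push_cast
      rw [Finset.sum_comm, Finset.mul_sum]
      refine Finset.sum_congr rfl fun j _ => ?_
      rw [Finset.mul_sum, Finset.mul_sum]
      exact Finset.sum_congr rfl fun i _ => by ring
  have e : phase Q lam u - PowerSeries.partialSum (n + 1) (interaction Q lam (hermitian u))
      = -Q * ∑ i, ((∑ j ∈ Finset.range n, (-y i) ^ (j + 1) / (j + 1) + Real.log (1 - -y i) : ℝ) : ℂ)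
      := by
    rw [phase_eq Q h hdet hy1, hp]
    push_cast
    rw [Finset.sum_add_distrib]
    simp only [sub_neg_eq_add]
    ring
  rw [e, norm_mul, norm_neg]
  have h1 : ‖∑ i, ((∑ j ∈ Finset.range n, (-y i) ^ (j + 1) / (j + 1)
      + Real.log (1 - -y i) : ℝ) : ℂ)‖ ≤ N * (2 * size lam u ^ (n + 1)) := by
    refine (norm_sum_le_of_le _ (n := fun _ => 2 * size lam u ^ (n + 1)) fun i _ => ?_).trans
      (by simp)
    rw [Complex.norm_real]
    refine (Real.abs_log_sub_add_sum_range_le (by rw [abs_neg]; exact hy1 i) n).trans ?_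
    rw [abs_neg, div_le_iff₀ (by linarith [hy1 i])]
    have h2 : |y i| ^ (n + 1) ≤ size lam u ^ (n + 1) := pow_le_pow_left₀ (abs_nonneg _) (hy i) _
    have h3 : 0 ≤ size lam u ^ (n + 1) := by positivity
    have h4 : 1 / 2 ≤ 1 - |y i| := by have := hy i; linarith
    nlinarith
  calc ‖Q‖ * _ ≤ ‖Q‖ * (N * (2 * size lam u ^ (n + 1))) :=
        mul_le_mul_of_nonneg_left h1 (norm_nonneg _)
    _ ≤ (1 + 2 * ‖Q‖ * N) * size lam u ^ (n + 1) := by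
        have : 0 ≤ size lam u ^ (n + 1) := by positivity
        nlinarith

/-- The integrand on the ball minus the truncated expansion, without the Gaussian. -/
theorem exists_norm_sub_expansion_le {ε : ℝ} (hε : 0 < ε) (hε1 : ε < 1) (N : ℕ) (Q : ℂ) (M : ℕ) :
    ∃ C : ℝ, 0 ≤ C ∧ ∀ lam : Fin N → ℝ, (∀ i, 0 < lam i) → ∀ u,
      ‖(nearSaddle ε lam).indicator (fun u => Complex.exp (phase Q lam u)) u
          - ∑ n ∈ Finset.range (2 * M), expansionCoeff Q lam n (hermitian u)‖
        ≤ C * size lam u ^ (2 * M) * Real.exp (1 / 6 * quadForm (coordWeight lam) u) := by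
  set B : ℝ := 1 + 2 * ‖Q‖ * N with hB
  have hB0 : 0 ≤ B := by positivity
  obtain ⟨C₁, hC₁, h₁⟩ :=
    PowerSeries.exists_norm_exp_sub_partialSum_expSeries_le hB0 (2 * M)
  choose K hK0 hK using fun n => PowerSeries.exists_norm_coeff_expSeries_le hB0 n
  -- The bound `1/2` serves the Taylor remainder of the logarithm, and `ε` ensures membership in the
  -- ball.
  set δ : ℝ := min (1 / 2) ε with hδ
  have hδ0 : 0 < δ := lt_min (by norm_num) hε
  have hδ1 : δ ≤ 1 := (min_le_left _ _).trans (by norm_num)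
  set E : ℝ := Real.exp (‖Q‖ * (N * (ε / (1 - ε)))) with hE
  have hK' : 0 ≤ ∑ n ∈ Finset.range (2 * M), K n := Finset.sum_nonneg fun n _ => hK0 n
  refine ⟨C₁ + (E + ∑ n ∈ Finset.range (2 * M), K n) / δ ^ (2 * M),
    add_nonneg hC₁ (div_nonneg (add_nonneg (Real.exp_pos _).le hK') (by positivity)),
    fun lam h u => ?_⟩
  have hs := size_nonneg lam u
  have hq := quadForm_nonneg (coordWeight_pos h) u
  have he1 : 1 ≤ Real.exp (1 / 6 * quadForm (coordWeight lam) u) := Real.one_le_exp (by positivity)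
  set w := size lam u with hw
  set q := quadForm (coordWeight lam) u with hqq
  have hI := norm_coeff_interaction_le Q h u
  have hI0 := coeff_zero_interaction Q lam (hermitian u)
  simp only [expansionCoeff_eq_coeff]
  rw [add_mul, add_mul]
  -- For `M = 0` nothing is expanded and the crude bound is the whole claim, so this case joins that
  -- of large `w`.
  by_cases hA : M ≠ 0 ∧ w ≤ δ
  · have hmem := mem_nearSaddle_of_size_le hε h (hA.2.trans (min_le_right _ _))
    obtain ⟨n, hn⟩ : ∃ n, 2 * M = n + 1 := ⟨2 * M - 1, by have := hA.1; omega⟩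
    have hn1 : 1 ≤ n := by have := hA.1; omega
    rw [Set.indicator_of_mem hmem]
    have h2 := h₁ w _ (phase Q lam u) hs (hA.2.trans hδ1) hI0 hI (by
      rw [hn]
      exact norm_phase_sub_partialSum_le Q h (hA.2.trans (min_le_left _ _)) hn1)
    refine h2.trans (le_add_of_le_of_nonneg ?_ ?_)
    · exact le_mul_of_one_le_right (by positivity) he1
    · exact mul_nonneg (mul_nonneg (div_nonneg (add_nonneg (Real.exp_pos _).le hK')
        (by positivity)) (by positivity)) (Real.exp_pos _).le
  -- For large `w` the integrand and each coefficient are bounded separately; the factor `(w / δ) ^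
  -- (2 * M) ≥ 1` makes up for the absence of cancellation.
  · have hv : M ≠ 0 → 1 ≤ w / δ := fun hM => by
      rw [le_div_iff₀ hδ0, one_mul]
      by_contra hlt
      exact hA ⟨hM, (not_le.1 hlt).le⟩
    have hvn : ∀ n ∈ Finset.range (2 * M), w ^ n ≤ (w / δ) ^ (2 * M) := fun n hn => by
      have hn' := Finset.mem_range.1 hn
      have hM : M ≠ 0 := by omega
      calc w ^ n ≤ (w / δ) ^ n := by
            refine pow_le_pow_left₀ hs ?_ n
            exact le_div_self hs hδ0 hδ1
        _ ≤ (w / δ) ^ (2 * M) := pow_le_pow_right₀ (hv hM) hn'.le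
    have hv1 : 1 ≤ (w / δ) ^ (2 * M) := by
      by_cases hM : M = 0
      · simp [hM]
      · exact one_le_pow₀ (hv hM)
    refine le_add_of_nonneg_of_le (mul_nonneg (by positivity) (Real.exp_pos _).le) ?_
    have e : (E + ∑ n ∈ Finset.range (2 * M), K n) / δ ^ (2 * M) * w ^ (2 * M) * Real.exp (1 / 6 * q)
        = E * Real.exp (1 / 6 * q) * (w / δ) ^ (2 * M)
          + (∑ n ∈ Finset.range (2 * M), K n * (w / δ) ^ (2 * M)) * Real.exp (1 / 6 * q) := by
      rw [← Finset.sum_mul, div_pow]; ring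
    rw [e]
    refine (norm_sub_le _ _).trans (add_le_add ?_ ?_)
    · refine le_trans ?_ (le_mul_of_one_le_right (by positivity) hv1)
      by_cases hmem : u ∈ nearSaddle ε lam
      · rw [Set.indicator_of_mem hmem]
        exact norm_exp_phase_le hε hε1 Q h hmem
      · rw [Set.indicator_of_notMem hmem, norm_zero]
        positivity
    · refine le_trans (norm_sum_le_of_le _ fun n hn => ?_)
        (le_mul_of_one_le_right (Finset.sum_nonneg fun n _ => mul_nonneg (hK0 n) (by positivity)) he1)
      exact (hK n w _ hs hI).trans (mul_le_mul_of_nonneg_left (hvn n hn) (hK0 n))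

theorem tau_sub_graphSum_eq {ε : ℝ} (hε : 0 < ε) (hε1 : ε < 1) (Q : ℂ) {lam : Fin N → ℝ}
    (h : ∀ i, 0 < lam i) (n : ℕ) :
    tau ε Q lam - ∑ k ∈ Finset.range n, ColoredRibbonGraph.graphSum Q lam k
      = (normalization lam)⁻¹ * ∫ u,
        ((nearSaddle ε lam).indicator (fun u => Complex.exp (phase Q lam u)) u
          - ∑ k ∈ Finset.range n, expansionCoeff Q lam k (hermitian u))
          * gaussian lam (hermitian u) := by
  have hm := measurableSet_nearSaddle ε lam
  have h1 : (Lam lam).det ^ Q * ∫ u in nearSaddle ε lam, integrand Q lam (hermitian u)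
      = ∫ u, (nearSaddle ε lam).indicator
        (fun u => Complex.exp (phase Q lam u) * gaussian lam (hermitian u)) u := by
    rw [integral_indicator hm, ← integral_const_mul]
    exact setIntegral_congr_fun hm fun u hu => det_mul_integrand_eq hε hε1 Q h hu
  have h2 : ∀ u, ((nearSaddle ε lam).indicator (fun u => Complex.exp (phase Q lam u)) u
      - ∑ k ∈ Finset.range n, expansionCoeff Q lam k (hermitian u)) * gaussian lam (hermitian u)
      = (nearSaddle ε lam).indicator
        (fun u => Complex.exp (phase Q lam u) * gaussian lam (hermitian u)) u
        - ∑ k ∈ Finset.range n, expansionCoeff Q lam k (hermitian u) * gaussian lam (hermitian u) :=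
    fun u => by
      rw [sub_mul, Finset.sum_mul]
      congr 1
      by_cases hu : u ∈ nearSaddle ε lam
      · simp [hu]
      · simp [hu]
  simp_rw [h2]
  rw [integral_sub ((integrableOn_exp_phase hε hε1 Q h).integrable_indicator hm)
    (integrable_finsetSum _ fun k _ => integrable_expansionCoeff Q h k),
    integral_finsetSum _ fun k _ => integrable_expansionCoeff Q h k, mul_sub, Finset.mul_sum, ← h1,
    tau]
  congr 1
  · ring
  · exact Finset.sum_congr rfl fun k _ => (average_expansionCoeff Q h k).symm

theorem exists_norm_tau_sub_graphSum_le {ε : ℝ} (hε : 0 < ε) (hε1 : ε < 1) (N : ℕ) (Q : ℂ) (M : ℕ) :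
    ∃ C : ℝ, ∀ lam : Fin N → ℝ, (∀ i, 0 < lam i) →
      ‖tau ε Q lam - ∑ n ∈ Finset.range (2 * M), ColoredRibbonGraph.graphSum Q lam n‖
        ≤ C * ‖fun i : Fin N => (lam i)⁻¹‖ ^ (3 * M) := by
  obtain ⟨C, hC, hb⟩ := exists_norm_sub_expansion_le hε hε1 N Q M
  -- `size ^ (2 * M)` contains `(1 + q) ^ (4 * M)`. The rate `1/12` leaves `1/12 + 1/6 - 1/2 = -1/4`
  -- in the exponent.
  obtain ⟨D, hD, hDb⟩ := exists_one_add_pow_le_exp (4 * M) (show (0 : ℝ) < 1 / 12 by norm_num)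
  -- The last factor is the ratio of the Gaussian integrals with exponents `1/4` and `1/2`, the
  -- latter being the normalization.
  refine ⟨C * D * √(1 / (2 * (1 / 4))) ^ Fintype.card (Fin N × Fin N), fun lam h => ?_⟩
  set r := ‖fun i : Fin N => (lam i)⁻¹‖ with hr
  have hr0 : 0 ≤ r := norm_nonneg _
  have hw := coordWeight_pos h
  have hpt : ∀ u, ‖((nearSaddle ε lam).indicator (fun u => Complex.exp (phase Q lam u)) u
      - ∑ k ∈ Finset.range (2 * M), expansionCoeff Q lam k (hermitian u))
        * gaussian lam (hermitian u)‖
      ≤ (C * D * r ^ (3 * M)) * Real.exp (-(1 / 4) * quadForm (coordWeight lam) u) := fun u => by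
    have hq := quadForm_nonneg hw u
    have h1 := hb lam h u
    have h2 := hDb _ hq
    have h3 : size lam u ^ (2 * M) = r ^ (3 * M) * (1 + quadForm (coordWeight lam) u) ^ (4 * M) := by
      rw [size, ← hr, mul_pow, ← pow_mul, pow_mul, mul_pow, Real.sq_sqrt hr0, ← pow_succ, ← pow_mul]
      ring_nf
    rw [norm_mul, norm_gaussian_hermitian]
    set q := quadForm (coordWeight lam) u
    calc _ ≤ (C * size lam u ^ (2 * M) * Real.exp (1 / 6 * q)) * Real.exp (-(1 / 2) * q) :=
          mul_le_mul_of_nonneg_right h1 (Real.exp_pos _).le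
      _ = C * r ^ (3 * M) * (1 + q) ^ (4 * M) * (Real.exp (1 / 6 * q) * Real.exp (-(1 / 2) * q)) := by
          rw [h3]; ring
      _ ≤ C * r ^ (3 * M) * (D * Real.exp (1 / 12 * q))
            * (Real.exp (1 / 6 * q) * Real.exp (-(1 / 2) * q)) := by gcongr
      _ = (C * D * r ^ (3 * M)) * (Real.exp (1 / 12 * q) * Real.exp (1 / 6 * q)
            * Real.exp (-(1 / 2) * q)) := by ring
      _ = (C * D * r ^ (3 * M)) * Real.exp (-(1 / 4) * q) := by
          rw [← Real.exp_add, ← Real.exp_add]; ring_nf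
  rw [tau_sub_graphSum_eq hε hε1 Q h, norm_mul, norm_inv, normalization_eq, Complex.norm_real,
    Real.norm_eq_abs, abs_of_pos (integral_exp_neg_mul_quadForm_pos hw one_half_pos),
    inv_mul_le_iff₀ (integral_exp_neg_mul_quadForm_pos hw one_half_pos)]
  refine (norm_integral_le_of_norm_le ((integrable_exp_neg_mul_quadForm hw
    (show (0 : ℝ) < 1 / 4 by norm_num)).const_mul _) (ae_of_all _ hpt)).trans (le_of_eq ?_)
  rw [integral_const_mul, integral_exp_neg_mul_quadForm_eq hw (show (0 : ℝ) < 1 / 4 by norm_num)]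
  ring

end KontsevichPenner

/-! ### The main theorem. -/

theorem mainTheorem1 (N : ℕ) (Q : ℂ) :
    -- for every number of vertices, the sum over graphs is a finite sum
    (∀ n : ℕ, (ColoredRibbonGraph.trivalentClasses N n).Finite) ∧
    -- the expansion under the Gaussian integral agrees, term by term, with the sum over graphs
    (∀ lam : Fin N → ℝ, (∀ i, 0 < lam i) → ∀ n : ℕ,
      Integrable (fun u : Fin N × Fin N → ℝ =>
        KontsevichPenner.expansionCoeff Q lam n (KontsevichPenner.hermitian u)
          * KontsevichPenner.gaussian lam (KontsevichPenner.hermitian u)) ∧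
      KontsevichPenner.average lam (KontsevichPenner.expansionCoeff Q lam n)
        = ColoredRibbonGraph.graphSum Q lam n) ∧
    -- the sum over graphs is the asymptotic expansion of the integral as all `λᵢ → ∞`
    (∀ ε : ℝ, 0 < ε → ε < 1 →
      (∀ lam : Fin N → ℝ, (∀ i, 0 < lam i) →
        IntegrableOn (fun u : Fin N × Fin N → ℝ =>
          KontsevichPenner.integrand Q lam (KontsevichPenner.hermitian u))
          (KontsevichPenner.nearSaddle ε lam)) ∧
      ∀ M : ℕ,
        (fun lam : Fin N → ℝ => KontsevichPenner.tau ε Q lam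
            - ∑ n ∈ Finset.range (2 * M), ColoredRibbonGraph.graphSum Q lam n)
          =O[Filter.pi fun _ : Fin N => (atTop : Filter ℝ)]
        fun lam : Fin N → ℝ => ‖fun i : Fin N => (lam i)⁻¹‖ ^ (3 * M)) := by
  refine ⟨ColoredRibbonGraph.finite_trivalentClasses N,
    fun lam h n => ⟨KontsevichPenner.integrable_expansionCoeff Q h n,
      KontsevichPenner.average_expansionCoeff Q h n⟩,
    fun ε hε hε1 => ⟨fun lam h => KontsevichPenner.integrableOn_integrand hε hε1 Q h, fun M => ?_⟩⟩
  -- The bound holds for all positive `λ`; the filter is used only to make every `λᵢ` eventually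
  -- positive.
  obtain ⟨C, hC⟩ := KontsevichPenner.exists_norm_tau_sub_graphSum_le hε hε1 N Q M
  refine Asymptotics.IsBigO.of_bound C ?_
  have hpos : ∀ᶠ lam : Fin N → ℝ in Filter.pi fun _ => atTop, ∀ i, 0 < lam i :=
    eventually_all.2 fun i => (tendsto_eval_pi _ i).eventually (eventually_gt_atTop 0)
  filter_upwards [hpos] with lam h
  rw [norm_pow, norm_norm]
  exact hC lam h
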